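/- Consider the class of equations $$u_{tt}=u_{xx}-u^{-1}u_x^2+A(x)u_x+B(x)\,u\ln|u|+u\,D(t,x)\qquad(*)$$ on nonempty connected open sets $W$ of $(t,x,u)$-space on which $u\neq0$ and whose slices $x=\mathrm{const}$ are connected, with $A,B,D$ smooth on the projections of $W$. A (Lie point) symmetry on $W$ is a vector field $\tau\partial_t+\xi\partial_x+\eta\partial_u$ with smooth coefficients $\tau,\xi,\eta$ of $(t,x,u)\in W$ that satisfies Lie's infinitesimal invariance criterion; the maximal invariance algebra is the Lie algebra of all symmetries on $W$. Two equations with their domains are equivalent if a transformation $\bar t=kt+k_1$, $\bar x=\epsilon kx+k_2$, $v=X(x)u+Y(t,x)$ ($k\ne0$, $\epsilon=\pm1$, $X\neq0$ and $Y$ smooth) carries one into the other. **Theorem.** (a) The maximal invariance algebra of an equation $(*)$ has dimension at most five. That of $u_{tt}=u_{xx}-u^{-1}u_x^2$ is the five-dimensional Lie algebra $\langle\partial_t,\partial_x,t\partial_t+x\partial_x,xu\partial_u,u\partial_u\rangle$, and every equation $(*)$ whose algebra has dimension greater than four is equivalent to this one. (b) Every equation $(*)$ whose maximal invariance algebra is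 four-dimensional is equivalent to one of the equations listed below. Each listed equation, on any such $W$ where its coefficients are defined ($x\ne0$ for I.7–I.14 and II, $t\neq0$ for IV, $x\neq kt$ for V), belongs to $(*)$ and has as its maximal invariance algebra the listed four-dimensional Lie algebra $A_4$, which is of the listed isomorphism type. (c) Equations from different items of the list are inequivalent. Equations from the same item with different parameters are inequivalent, except that all equations of I.1 are equivalent to one another, likewise all of I.2 and all of III.1, and in III.3 and in III.4 the equations with parameters $(k,\beta)$, $(k',\beta')$ are equivalent if and only if $k/|\beta|^3=k'/|\beta'|^3$. (Here "equivalent" means: on some domains on which the two equations are defined.) Here $h\cdot$ abbreviates $h(x)\,u\partial_u$, $P=t\partial_t+x\partial_x$, and all parameters are real. I. $D=0$: 1) $A=0$, $B=-\beta^2$, $\beta\ne0$: $\langle\partial_t,\partial_x,\cosh(\beta x)\cdot,\sinh(\beta x)\cdot\rangle$, type $A_{3.6}\oplus A_1$; 2) $A=0$, $B=\beta^2$, $\beta\neq0$: $\langle\partial_t,\partial_x,\cos(\beta x)\cdot,\sin(\beta x)\cdot\rangle$, $A_{3.8}\oplus A_1$; 3) $A=1$, $B=0$: $\langle\partial_t,\partial_x,1\cdot,e^{-x}\cdot\rangle$,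 $A_{2.1}\oplus A_{2.2}$; 4) $A=2$, $B=1$: $\langle\partial_t,\partial_x,e^{-x}\cdot,xe^{-x}\cdot\rangle$, $A_{3.4}\oplus A_1$; 5) $A=2$, $B=m>1$, $\beta=\sqrt{m-1}$: $\langle\partial_t,\partial_x,e^{-x}\cos(\beta x)\cdot,e^{-x}\sin(\beta x)\cdot\rangle$, $A_{3.9}\oplus A_1$; 6) $A=2$, $B=m<1$, $m\ne0$, $\beta=\sqrt{1-m}$: $\langle\partial_t,\partial_x,e^{-x}\cosh(\beta x)\cdot,e^{-x}\sinh(\beta x)\cdot\rangle$, $A_{3.7}\oplus A_1$; 7) $A=0$, $B=\frac14x^{-2}$: $\langle\partial_t,P,\sqrt{|x|}\cdot,\sqrt{|x|}\ln|x|\cdot\rangle$, $A_{4.2}$; 8) $A=0$, $B=mx^{-2}$, $m<\frac14$, $m\neq0$, $\beta=\sqrt{\frac14-m}$: $\langle\partial_t,P,|x|^{\frac12+\beta}\cdot,|x|^{\frac12-\beta}\cdot\rangle$, $A_{4.5}$; 9) $A=0$, $B=mx^{-2}$, $m>\frac14$, $\beta=\sqrt{m-\frac14}$: $\langle\partial_t,P,\sqrt{|x|}\cos(\beta\ln|x|)\cdot,\sqrt{|x|}\sin(\beta\ln|x|)\cdot\rangle$,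 $A_{4.6}$; 10) $A=x^{-1}$, $B=0$: $\langle\partial_t,P,\ln|x|\cdot,1\cdot\rangle$, $A_{4.3}$; 11) $A=nx^{-1}$, $B=0$, $n\ne0,1$: $\langle\partial_t,P,|x|^{1-n}\cdot,1\cdot\rangle$, $A_{3.7}\oplus A_1$ if $n\neq2$ and $A_{3.5}\oplus A_1$ if $n=2$; 12) $A=nx^{-1}$, $B=\frac14(n-1)^2x^{-2}$, $n\ne0,1$: $\langle\partial_t,P,|x|^{\frac{1-n}2}\cdot,|x|^{\frac{1-n}2}\ln|x|\cdot\rangle$, $A_{4.2}$; 13) $A=nx^{-1}$, $B=mx^{-2}$, $n\ne0$, $m\neq0$, $m<\frac14(n-1)^2$, $\beta=\sqrt{(n-1)^2-4m}$: $\langle\partial_t,P,|x|^{\frac12(1-n+\beta)}\cdot,|x|^{\frac12(1-n-\beta)}\cdot\rangle$, $A_{4.5}$; 14) $A=nx^{-1}$, $B=mx^{-2}$, $n\neq0$, $m>\frac14(n-1)^2$, $\beta=\sqrt{m-\frac14(n-1)^2}$: $\langle\partial_t,P,|x|^{\frac{1-n}2}\cos(\beta\ln|x|)\cdot,|x|^{\frac{1-n}2}\sin(\beta\ln|x|)\cdot\rangle$,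 $A_{4.6}$. II. $D=ktx^{-3}$, $k>0$: 1) $A=B=0$: $\langle\partial_t-\frac k2x^{-1}\cdot,P,x\cdot,1\cdot\rangle$, $A_{3.6}\oplus A_1$; 2) $A=0$, $B=\frac14x^{-2}$: $\langle\partial_t-\frac{4k}9x^{-1}\cdot,P,\sqrt{|x|}\cdot,\sqrt{|x|}\ln|x|\cdot\rangle$, $A_{4.2}$; 3) $A=0$, $B=mx^{-2}$, $m\ne0,-2$, $m<\frac14$, $\beta=\sqrt{\frac14-m}$: $\langle\partial_t-\frac k{m+2}x^{-1}\cdot,P,|x|^{\frac12+\beta}\cdot,|x|^{\frac12-\beta}\cdot\rangle$, $A_{4.5}$; 4) $A=0$, $B=-2x^{-2}$: $\langle\partial_t+\frac k9x^{-1}(1+3\ln|x|)\cdot,P,x^2\cdot,x^{-1}\cdot\rangle$, $A_{4.2}$; 5) $A=0$, $B=mx^{-2}$, $m>\frac14$, $\beta=\sqrt{m-\frac14}$: $\langle\partial_t-\frac k{m+2}x^{-1}\cdot,P,\sqrt{|x|}\cos(\beta\ln|x|)\cdot,\sqrt{|x|}\sin(\beta\ln|x|)\cdot\rangle$, $A_{4.6}$;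 6) $A=x^{-1}$, $B=0$: $\langle\partial_t-kx^{-1}\cdot,P,1\cdot,\ln|x|\cdot\rangle$, $A_{4.3}$; 7) $A=2x^{-1}$, $B=0$: $\langle\partial_t+kx^{-1}(1+\ln|x|)\cdot,P,1\cdot,x^{-1}\cdot\rangle$, $A_{3.4}\oplus A_1$; 8) $A=nx^{-1}$, $B=0$, $n\ne0,1,2$: $\langle\partial_t+\frac k{n-2}x^{-1}\cdot,P,1\cdot,|x|^{1-n}\cdot\rangle$, $A_{3.7}\oplus A_1$; 9) $A=3x^{-1}$, $B=x^{-2}$: $\langle\partial_t-\frac k2x^{-1}\ln^2|x|\cdot,P,x^{-1}\cdot,x^{-1}\ln|x|\cdot\rangle$, $A_{4.4}$; 10) $A=nx^{-1}$, $B=\frac14(n-1)^2x^{-2}$, $n\ne0,1,3$: $\langle\partial_t-\frac{4k}{(n-3)^2}x^{-1}\cdot,P,|x|^{\frac{1-n}2}\cdot,|x|^{\frac{1-n}2}\ln|x|\cdot\rangle$, $A_{4.2}$; 11) $A=nx^{-1}$, $B=mx^{-2}$, $n\ne0$, $m\neq0$, $m\ne n-2$, $m<\frac14(n-1)^2$,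 $\beta=\sqrt{(n-1)^2-4m}$: $\langle P,\partial_t-\frac k{2-n+m}x^{-1}\cdot,|x|^{\frac12(1-n+\beta)}\cdot,|x|^{\frac12(1-n-\beta)}\cdot\rangle$, $A_{4.5}$; 12) $A=nx^{-1}$, $B=(n-2)x^{-2}$, $n\ne0,2,3$: $\langle P,\partial_t+\frac k{3-n}x^{-1}\ln|x|\cdot,x^{-1}\cdot,|x|^{2-n}\cdot\rangle$, $A_{4.2}$; 13) $A=nx^{-1}$, $B=mx^{-2}$, $n\ne0$, $m>\frac14(n-1)^2$, $\beta=\sqrt{m-\frac14(n-1)^2}$: $\langle P,\partial_t-\frac k{2-n+m}x^{-1}\cdot,|x|^{\frac{1-n}2}\cos(\beta\ln|x|)\cdot,|x|^{\frac{1-n}2}\sin(\beta\ln|x|)\cdot\rangle$, $A_{4.6}$. III. $D=kt$, $k>0$: 1) $A=B=0$: $\langle\partial_x,\partial_t-\frac k2x^2\cdot,x\cdot,1\cdot\rangle$, $A_{4.1}$; 2) $A=1$, $B=0$: $\langle\partial_x,\partial_t-kx\cdot,e^{-x}\cdot,1\cdot\rangle$, $A_{4.3}$; 3) $A=0$, $B=\beta^2$,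 $\beta\ne0$: $\langle\partial_x,\partial_t-k\beta^{-2}\cdot,\cos(\beta x)\cdot,\sin(\beta x)\cdot\rangle$, $A_{3.8}\oplus A_1$; 4) $A=0$, $B=-\beta^2$, $\beta\neq0$: $\langle\partial_x,\partial_t+k\beta^{-2}\cdot,\cosh(\beta x)\cdot,\sinh(\beta x)\cdot\rangle$, $A_{3.6}\oplus A_1$; 5) $A=1$, $B=\frac14$: $\langle\partial_x,\partial_t-4k\cdot,e^{-x/2}\cdot,xe^{-x/2}\cdot\rangle$, $A_{3.4}\oplus A_1$; 6) $A=1$, $B=m<\frac14$, $m\ne0$, $\beta=\sqrt{1-4m}$: $\langle\partial_x,\partial_t-\frac km\cdot,e^{-\frac12(1-\beta)x}\cdot,e^{-\frac12(1+\beta)x}\cdot\rangle$, $A_{3.7}\oplus A_1$; 7) $A=1$, $B=m>\frac14$, $\beta=\sqrt{m-\frac14}$: $\langle\partial_x,\partial_t-\frac km\cdot,e^{-x/2}\cos(\beta x)\cdot,e^{-x/2}\sin(\beta x)\cdot\rangle$, $A_{3.9}\oplus A_1$. IV. $D=kt^{-2}$, $k\ne0$, $A=B=0$: $\langle\partial_x,P,x\cdot,1\cdot\rangle$,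 $A_{4.8}$ with $q=-1$. V. $D=m(x-kt)^{-2}$, $k>0$, $m\neq0$, $A=B=0$: $\langle\partial_t+k\partial_x,P,x\cdot,1\cdot\rangle$, $A_{4.8}$ with $q=-1$. The isomorphism types, by nonzero brackets of a basis $e_1,e_2,\dots$ (type parameters $p,q$ are some reals in the stated range; $\oplus A_1$ adds a central one-dimensional summand): $A_{2.1}$: none, two-dimensional; $A_{2.2}$: $[e_1,e_2]=e_2$; $A_{3.4}$: $[e_1,e_3]=e_1$, $[e_2,e_3]=e_1+e_2$; $A_{3.5}$: $[e_1,e_3]=e_1$, $[e_2,e_3]=e_2$; $A_{3.6}$: $[e_1,e_3]=e_1$, $[e_2,e_3]=-e_2$; $A_{3.7}$: $[e_1,e_3]=e_1$, $[e_2,e_3]=qe_2$, $0<|q|<1$; $A_{3.8}$: $[e_1,e_3]=-e_2$, $[e_2,e_3]=e_1$; $A_{3.9}$: $[e_1,e_3]=qe_1-e_2$, $[e_2,e_3]=e_1+qe_2$, $q>0$; $A_{4.1}$: $[e_2,e_4]=e_1$, $[e_3,e_4]=e_2$; $A_{4.2}$: $[e_1,e_4]=qe_1$, $[e_2,e_4]=e_2$,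 $[e_3,e_4]=e_2+e_3$, $q\ne0$; $A_{4.3}$: $[e_1,e_4]=e_1$, $[e_3,e_4]=e_2$; $A_{4.4}$: $[e_1,e_4]=e_1$, $[e_2,e_4]=e_1+e_2$, $[e_3,e_4]=e_2+e_3$; $A_{4.5}$: $[e_1,e_4]=e_1$, $[e_2,e_4]=qe_2$, $[e_3,e_4]=pe_3$, $-1\le p\le q\le1$, $pq\ne0$; $A_{4.6}$: $[e_1,e_4]=qe_1$, $[e_2,e_4]=pe_2-e_3$, $[e_3,e_4]=e_2+pe_3$, $q\neq0$, $p\ge0$; $A_{4.8}$ with $q=-1$: $[e_2,e_3]=e_1$, $[e_2,e_4]=e_2$, $[e_3,e_4]=-e_3$. -/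

import Mathlib

open scoped ContDiff

noncomputable section

namespace WaveClass

/-! ### Equations `u_tt = u_xx + F(t,x,u,u_x)`, vector fields and Lie's invariance criterion -/

/-- Points `(t, x, u)`. -/
abbrev Pt := ℝ × ℝ × ℝ

/-- Vector fields `τ ∂_t + ξ ∂_x + η ∂_u`, written as `p ↦ (τ p, ξ p, η p)`. -/
abbrev VF := Pt → Pt

/-- Right-hand sides `F t x u u_x`. -/
abbrev Rhs := ℝ → ℝ → ℝ → ℝ → ℝ

/-- Partial derivative in the first variable of a function of `(t, x)`. -/
def dt (f : ℝ → ℝ → ℝ) : ℝ → ℝ → ℝ := fun t x => deriv (fun s => f s x) t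

/-- Partial derivative in the second variable of a function of `(t, x)`. -/
def dx (f : ℝ → ℝ → ℝ) : ℝ → ℝ → ℝ := fun t x => deriv (fun y => f t y) x

/-- Smooth functions `u = f(t,x)`. -/
def Smooth₂ (f : ℝ → ℝ → ℝ) : Prop := ContDiff ℝ ∞ (fun p : ℝ × ℝ => f p.1 p.2)

/-- `u = f(t,x)` satisfies `u_tt = u_xx + F(t,x,u,u_x)` at the point `(t,x)`. -/
def SolvesAt (F : Rhs) (f : ℝ → ℝ → ℝ) (t x : ℝ) : Prop :=
  dt (dt f) t x = dx (dx f) t x + F t x (f t x) (dx f t x)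

/-! The coefficients `τ, ξ, η` of a vector field along the graph `u = f(t,x)`. The total
derivatives `D_t, D_x` along the graph are the partial derivatives `dt, dx` of the
composed functions. -/

def tauAlong (Q : VF) (f : ℝ → ℝ → ℝ) : ℝ → ℝ → ℝ := fun t x => (Q (t, x, f t x)).1

def xiAlong (Q : VF) (f : ℝ → ℝ → ℝ) : ℝ → ℝ → ℝ := fun t x => (Q (t, x, f t x)).2.1

def etaAlong (Q : VF) (f : ℝ → ℝ → ℝ) : ℝ → ℝ → ℝ := fun t x => (Q (t, x, f t x)).2.2

/-- `φ^t = D_t η - u_t D_t τ - u_x D_t ξ`. -/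
def phiT (Q : VF) (f : ℝ → ℝ → ℝ) : ℝ → ℝ → ℝ := fun t x =>
  dt (etaAlong Q f) t x - dt f t x * dt (tauAlong Q f) t x - dx f t x * dt (xiAlong Q f) t x

/-- `φ^x = D_x η - u_t D_x τ - u_x D_x ξ`. -/
def phiX (Q : VF) (f : ℝ → ℝ → ℝ) : ℝ → ℝ → ℝ := fun t x =>
  dx (etaAlong Q f) t x - dt f t x * dx (tauAlong Q f) t x - dx f t x * dx (xiAlong Q f) t x

/-- `φ^tt = D_t φ^t - u_tt D_t τ - u_tx D_t ξ`. -/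
def phiTT (Q : VF) (f : ℝ → ℝ → ℝ) : ℝ → ℝ → ℝ := fun t x =>
  dt (phiT Q f) t x - dt (dt f) t x * dt (tauAlong Q f) t x
    - dx (dt f) t x * dt (xiAlong Q f) t x

/-- `φ^xx = D_x φ^x - u_tx D_x τ - u_xx D_x ξ`. -/
def phiXX (Q : VF) (f : ℝ → ℝ → ℝ) : ℝ → ℝ → ℝ := fun t x =>
  dx (phiX Q f) t x - dx (dt f) t x * dx (tauAlong Q f) t x
    - dx (dx f) t x * dx (xiAlong Q f) t x

/-- `φ^tt - φ^xx - τ F_t - ξ F_x - η F_u - φ^x F_{u_x}` at the 2-jet of `f` at `(t,x)`. -/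
def lieExpr (F : Rhs) (Q : VF) (f : ℝ → ℝ → ℝ) (t x : ℝ) : ℝ :=
  phiTT Q f t x - phiXX Q f t x
    - tauAlong Q f t x * deriv (fun s => F s x (f t x) (dx f t x)) t
    - xiAlong Q f t x * deriv (fun y => F t y (f t x) (dx f t x)) x
    - etaAlong Q f t x * deriv (fun v => F t x v (dx f t x)) (f t x)
    - phiX Q f t x * deriv (fun q => F t x (f t x) q) (dx f t x)

/-- `Q` is an infinitesimal (Lie point) symmetry of `u_tt = u_xx + F` on the domain `W` of
`(t,x,u)`-space: its coefficients are smooth on `W`, and Lie's invariance criterion holds at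
every 2-jet over `W` that satisfies the equation. (Every 2-jet is the jet of a smooth `f`.) -/
def IsSymmetry (W : Set Pt) (F : Rhs) (Q : VF) : Prop :=
  ContDiffOn ℝ ∞ Q W ∧
    ∀ f : ℝ → ℝ → ℝ, Smooth₂ f → ∀ t x : ℝ, (t, x, f t x) ∈ W →
      SolvesAt F f t x → lieExpr F Q f t x = 0

/-- A vector field regarded as a field on `W` only. -/
def restr (W : Set Pt) (Q : VF) : W → Pt := fun p => Q p

/-- The maximal invariance algebra, as a vector space of vector fields on `W`. (The criterion is
linear in `Q`, so the span adds nothing to the set of symmetries.) -/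
def symmetryAlgebra (W : Set Pt) (F : Rhs) : Submodule ℝ (W → Pt) :=
  Submodule.span ℝ {R | ∃ Q : VF, IsSymmetry W F Q ∧ R = restr W Q}

/-- The dimension of the maximal invariance algebra. -/
def symDim (W : Set Pt) (F : Rhs) : Cardinal := Module.rank ℝ (symmetryAlgebra W F)

/-- The maximal invariance algebra on `W` is the Lie algebra with basis `Q 0, …, Q (n-1)`. -/
structure IsMaximalAlgebra (W : Set Pt) (F : Rhs) {n : ℕ} (Q : Fin n → VF) : Prop where
  symmetry : ∀ i, IsSymmetry W F (Q i)
  indep : LinearIndependent ℝ (fun i => restr W (Q i))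
  maximal : ∀ R : VF, IsSymmetry W F R →
    restr W R ∈ Submodule.span ℝ (Set.range fun i => restr W (Q i))
  bracket : ∀ i j, restr W (VectorField.lieBracket ℝ (Q i) (Q j)) ∈
    Submodule.span ℝ (Set.range fun i => restr W (Q i))

/-! ### The class `u_tt = u_xx - u⁻¹ u_x² + A(x) u_x + B(x) u ln|u| + u D(t,x)` -/

/-- Coefficient functions of an equation of the class. -/
structure WaveEq where
  A : ℝ → ℝ
  B : ℝ → ℝ
  D : ℝ → ℝ → ℝ

/-- `F = -u⁻¹ u_x² + A(x) u_x + B(x) u ln|u| + u D(t,x)`. -/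
def WaveEq.rhs (e : WaveEq) : Rhs := fun t x u q =>
  -u⁻¹ * q ^ 2 + e.A x * q + e.B x * u * Real.log |u| + u * e.D t x

/-- The set of `x` that occur in `W`. -/
def projX (W : Set Pt) : Set ℝ := (fun p : Pt => p.2.1) '' W

/-- The set of `(t,x)` that occur in `W`. -/
def projTX (W : Set Pt) : Set (ℝ × ℝ) := (fun p : Pt => (p.1, p.2.1)) '' W

/-- The domains of `(t,x,u)`-space on which equations are considered: nonempty connected open sets
on which `u ≠ 0`, whose slices `x = const` are connected (so that a function on the domain with
vanishing derivatives in `t` and `u` is a function of `x`). -/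
structure IsAdmissible (W : Set Pt) : Prop where
  isOpen : IsOpen W
  isConnected : IsConnected W
  u_ne_zero : ∀ p ∈ W, p.2.2 ≠ 0
  slice : ∀ x : ℝ, IsPreconnected {p : Pt | p ∈ W ∧ p.2.1 = x}

/-- An equation of the class, on an admissible domain on which its coefficients are smooth. -/
structure InClass (W : Set Pt) (e : WaveEq) : Prop where
  domain : IsAdmissible W
  smooth_A : ContDiffOn ℝ ∞ e.A (projX W)
  smooth_B : ContDiffOn ℝ ∞ e.B (projX W)
  smooth_D : ContDiffOn ℝ ∞ (fun p : ℝ × ℝ => e.D p.1 p.2) (projTX W)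

/-! ### The equivalence group `t' = k t + k₁, x' = ε k x + k₂, v = X(x) u + Y(t,x)` -/

/-- The point transformation. -/
def pointMap (k k₁ k₂ ε : ℝ) (X : ℝ → ℝ) (Y : ℝ → ℝ → ℝ) : Pt → Pt := fun p =>
  (k * p.1 + k₁, ε * k * p.2.1 + k₂, X p.2.1 * p.2.2 + Y p.1 p.2.1)

/-- The function `v = v(t',x')` into which the transformation carries `u = f(t,x)`. -/
def transformed (k k₁ k₂ ε : ℝ) (X : ℝ → ℝ) (Y : ℝ → ℝ → ℝ) (f : ℝ → ℝ → ℝ) :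
    ℝ → ℝ → ℝ := fun s y =>
  X ((y - k₂) / (ε * k)) * f ((s - k₁) / k) ((y - k₂) / (ε * k))
    + Y ((s - k₁) / k) ((y - k₂) / (ε * k))

/-- A transformation of the equivalence group carries the equation with right-hand side `F` on `W`
into the equation with right-hand side `F'` on `W'`. -/
def Equivalent (W : Set Pt) (F : Rhs) (W' : Set Pt) (F' : Rhs) : Prop :=
  ∃ (k k₁ k₂ ε : ℝ) (X : ℝ → ℝ) (Y : ℝ → ℝ → ℝ),
    k ≠ 0 ∧ (ε = 1 ∨ ε = -1) ∧
    ContDiffOn ℝ ∞ X (projX W) ∧ (∀ x ∈ projX W, X x ≠ 0) ∧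
    ContDiffOn ℝ ∞ (fun p : ℝ × ℝ => Y p.1 p.2) (projTX W) ∧
    pointMap k k₁ k₂ ε X Y '' W = W' ∧
    ∀ f : ℝ → ℝ → ℝ, Smooth₂ f → ∀ t x : ℝ, (t, x, f t x) ∈ W →
      (SolvesAt F f t x ↔
        SolvesAt F' (transformed k k₁ k₂ ε X Y f) (k * t + k₁) (ε * k * x + k₂))

/-! ### Abstract four-dimensional real Lie algebras, by structure constants -/

/-- `c i j l` is the coefficient of `e_l` in `[e_i, e_j]`. -/
abbrev StructConst := Fin 4 → Fin 4 → Fin 4 → ℝ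

/-- Structure constants from the brackets `[e₁,e₂], [e₁,e₃], [e₁,e₄], [e₂,e₃], [e₂,e₄], [e₃,e₄]`. -/
def brackets (b12 b13 b14 b23 b24 b34 : Fin 4 → ℝ) : StructConst :=
  ![![0, b12, b13, b14],
    ![-b12, 0, b23, b24],
    ![-b13, -b23, 0, b34],
    ![-b14, -b24, -b34, 0]]

/-- `A_{2.1} ⊕ A_{2.2}`: `[e₁,e₂] = e₂`. -/
def typeA21A22 : Set StructConst := {brackets ![0, 1, 0, 0] 0 0 0 0 0}

/-- `A_{3.4} ⊕ A_1`: `[e₁,e₃] = e₁`, `[e₂,e₃] = e₁ + e₂`. -/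
def typeA34A1 : Set StructConst := {brackets 0 ![1, 0, 0, 0] 0 ![1, 1, 0, 0] 0 0}

/-- `A_{3.5} ⊕ A_1`: `[e₁,e₃] = e₁`, `[e₂,e₃] = e₂`. -/
def typeA35A1 : Set StructConst := {brackets 0 ![1, 0, 0, 0] 0 ![0, 1, 0, 0] 0 0}

/-- `A_{3.6} ⊕ A_1`: `[e₁,e₃] = e₁`, `[e₂,e₃] = -e₂`. -/
def typeA36A1 : Set StructConst := {brackets 0 ![1, 0, 0, 0] 0 ![0, -1, 0, 0] 0 0}

/-- `A_{3.7} ⊕ A_1`: `[e₁,e₃] = e₁`, `[e₂,e₃] = q e₂`, `0 < |q| < 1`. -/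
def typeA37A1 : Set StructConst :=
  {c | ∃ q : ℝ, 0 < |q| ∧ |q| < 1 ∧ c = brackets 0 ![1, 0, 0, 0] 0 ![0, q, 0, 0] 0 0}

/-- `A_{3.8} ⊕ A_1`: `[e₁,e₃] = -e₂`, `[e₂,e₃] = e₁`. -/
def typeA38A1 : Set StructConst := {brackets 0 ![0, -1, 0, 0] 0 ![1, 0, 0, 0] 0 0}

/-- `A_{3.9} ⊕ A_1`: `[e₁,e₃] = q e₁ - e₂`, `[e₂,e₃] = e₁ + q e₂`, `q > 0`. -/
def typeA39A1 : Set StructConst :=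
  {c | ∃ q : ℝ, 0 < q ∧ c = brackets 0 ![q, -1, 0, 0] 0 ![1, q, 0, 0] 0 0}

/-- `A_{4.1}`: `[e₂,e₄] = e₁`, `[e₃,e₄] = e₂`. -/
def typeA41 : Set StructConst := {brackets 0 0 0 0 ![1, 0, 0, 0] ![0, 1, 0, 0]}

/-- `A_{4.2}`: `[e₁,e₄] = q e₁`, `[e₂,e₄] = e₂`, `[e₃,e₄] = e₂ + e₃`, `q ≠ 0`. -/
def typeA42 : Set StructConst :=
  {c | ∃ q : ℝ, q ≠ 0 ∧ c = brackets 0 0 ![q, 0, 0, 0] 0 ![0, 1, 0, 0] ![0, 1, 1, 0]}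

/-- `A_{4.3}`: `[e₁,e₄] = e₁`, `[e₃,e₄] = e₂`. -/
def typeA43 : Set StructConst := {brackets 0 0 ![1, 0, 0, 0] 0 0 ![0, 1, 0, 0]}

/-- `A_{4.4}`: `[e₁,e₄] = e₁`, `[e₂,e₄] = e₁ + e₂`, `[e₃,e₄] = e₂ + e₃`. -/
def typeA44 : Set StructConst :=
  {brackets 0 0 ![1, 0, 0, 0] 0 ![1, 1, 0, 0] ![0, 1, 1, 0]}

/-- `A_{4.5}`: `[e₁,e₄] = e₁`, `[e₂,e₄] = q e₂`, `[e₃,e₄] = p e₃`, `-1 ≤ p ≤ q ≤ 1`, `p q ≠ 0`. -/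
def typeA45 : Set StructConst :=
  {c | ∃ p q : ℝ, -1 ≤ p ∧ p ≤ q ∧ q ≤ 1 ∧ p * q ≠ 0 ∧
    c = brackets 0 0 ![1, 0, 0, 0] 0 ![0, q, 0, 0] ![0, 0, p, 0]}

/-- `A_{4.6}`: `[e₁,e₄] = q e₁`, `[e₂,e₄] = p e₂ - e₃`, `[e₃,e₄] = e₂ + p e₃`, `q ≠ 0`, `p ≥ 0`. -/
def typeA46 : Set StructConst :=
  {c | ∃ p q : ℝ, q ≠ 0 ∧ 0 ≤ p ∧
    c = brackets 0 0 ![q, 0, 0, 0] 0 ![0, p, -1, 0] ![0, 1, p, 0]}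

/-- `A_{4.8}` with `q = -1`: `[e₂,e₃] = e₁`, `[e₂,e₄] = e₂`, `[e₃,e₄] = -e₃`. -/
def typeA48 : Set StructConst :=
  {brackets 0 0 0 ![1, 0, 0, 0] ![0, 1, 0, 0] ![0, 0, -1, 0]}

/-- The Lie algebra of vector fields on `W` spanned by `Q` has a basis with structure
constants `c`. -/
def HasStructConst (W : Set Pt) (Q : Fin 4 → VF) (c : StructConst) : Prop :=
  ∃ e : Fin 4 → VF,
    LinearIndependent ℝ (fun i => restr W (e i)) ∧
    Submodule.span ℝ (Set.range fun i => restr W (e i)) =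
      Submodule.span ℝ (Set.range fun i => restr W (Q i)) ∧
    ∀ i j, ∀ p ∈ W, VectorField.lieBracket ℝ (e i) (e j) p = ∑ l, c i j l • e l p

/-! ### The vector fields and equations of the classification -/

/-- `∂_t`. -/
def dT : VF := fun _ => (1, 0, 0)

/-- `∂_x`. -/
def dX : VF := fun _ => (0, 1, 0)

/-- `t ∂_t + x ∂_x`. -/
def dil : VF := fun p => (p.1, p.2.1, 0)

/-- `h(x) u ∂_u`. -/
def uU (h : ℝ → ℝ) : VF := fun p => (0, 0, h p.2.1 * p.2.2)

/-- The equation `u_tt = u_xx - u⁻¹ u_x²`. -/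
def freeEq : WaveEq := ⟨fun _ => 0, fun _ => 0, fun _ _ => 0⟩

/-- `∂_t, ∂_x, t ∂_t + x ∂_x, x u ∂_u, u ∂_u`. -/
def freeBasis : Fin 5 → VF := ![dT, dX, dil, uU (fun x => x), uU (fun _ => 1)]

/-- The labels of the listed equations, with their parameters. -/
inductive Listed where
  | I1 (β : ℝ) | I2 (β : ℝ) | I3 | I4 | I5 (m : ℝ) | I6 (m : ℝ)
  | I7 | I8 (m : ℝ) | I9 (m : ℝ) | I10 | I11 (n : ℝ) | I12 (n : ℝ)
  | I13 (n m : ℝ) | I14 (n m : ℝ)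
  | II1 (k : ℝ) | II2 (k : ℝ) | II3 (k m : ℝ) | II4 (k : ℝ) | II5 (k m : ℝ)
  | II6 (k : ℝ) | II7 (k : ℝ) | II8 (k n : ℝ) | II9 (k : ℝ) | II10 (k n : ℝ)
  | II11 (k n m : ℝ) | II12 (k n : ℝ) | II13 (k n m : ℝ)
  | III1 (k : ℝ) | III2 (k : ℝ) | III3 (k β : ℝ) | III4 (k β : ℝ)
  | III5 (k : ℝ) | III6 (k m : ℝ) | III7 (k m : ℝ)
  | IV (k : ℝ) | V (k m : ℝ)

/-- One entry of the list: the condition on the parameters, the coefficients, the set of `(t,x)`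
where they are defined, a basis of the symmetry algebra, and its abstract type. -/
structure Entry where
  valid : Prop
  eqn : WaveEq
  regular : Set (ℝ × ℝ)
  basis : Fin 4 → VF
  type : Set StructConst

/-- `x ≠ 0`. -/
def xNonzero : Set (ℝ × ℝ) := {p | p.2 ≠ 0}

/-- The coefficients `A = n`, `B = m`, `D = k t` (with `k = 0` for `D = 0`). -/
def constEq (n m k : ℝ) : WaveEq := ⟨fun _ => n, fun _ => m, fun t _ => k * t⟩

/-- The coefficients `A = n x⁻¹`, `B = m x⁻²`, `D = k t x⁻³` (with `k = 0` for `D = 0`). -/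
def powEq (n m k : ℝ) : WaveEq :=
  ⟨fun x => n * x⁻¹, fun x => m * (x ^ 2)⁻¹, fun t x => k * t * (x ^ 3)⁻¹⟩

open Real in
/-- The list. -/
def entry : Listed → Entry
  -- D = 0
  | .I1 β => ⟨β ≠ 0, constEq 0 (-β ^ 2) 0, Set.univ,
      ![dT, dX, uU (fun x => cosh (β * x)), uU (fun x => sinh (β * x))], typeA36A1⟩
  | .I2 β => ⟨β ≠ 0, constEq 0 (β ^ 2) 0, Set.univ,
      ![dT, dX, uU (fun x => cos (β * x)), uU (fun x => sin (β * x))], typeA38A1⟩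
  | .I3 => ⟨True, constEq 1 0 0, Set.univ,
      ![dT, dX, uU (fun _ => 1), uU (fun x => exp (-x))], typeA21A22⟩
  | .I4 => ⟨True, constEq 2 1 0, Set.univ,
      ![dT, dX, uU (fun x => exp (-x)), uU (fun x => x * exp (-x))], typeA34A1⟩
  | .I5 m => ⟨1 < m, constEq 2 m 0, Set.univ,
      ![dT, dX, uU (fun x => exp (-x) * cos (√(m - 1) * x)),
        uU (fun x => exp (-x) * sin (√(m - 1) * x))], typeA39A1⟩
  | .I6 m => ⟨m < 1 ∧ m ≠ 0, constEq 2 m 0, Set.univ,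
      ![dT, dX, uU (fun x => exp (-x) * cosh (√(1 - m) * x)),
        uU (fun x => exp (-x) * sinh (√(1 - m) * x))], typeA37A1⟩
  | .I7 => ⟨True, powEq 0 (1 / 4) 0, xNonzero,
      ![dT, dil, uU (fun x => √|x|), uU (fun x => √|x| * log |x|)], typeA42⟩
  | .I8 m => ⟨m < 1 / 4 ∧ m ≠ 0, powEq 0 m 0, xNonzero,
      ![dT, dil, uU (fun x => |x| ^ (1 / 2 + √(1 / 4 - m))),
        uU (fun x => |x| ^ (1 / 2 - √(1 / 4 - m)))], typeA45⟩
  | .I9 m => ⟨1 / 4 < m, powEq 0 m 0, xNonzero,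
      ![dT, dil, uU (fun x => √|x| * cos (√(m - 1 / 4) * log |x|)),
        uU (fun x => √|x| * sin (√(m - 1 / 4) * log |x|))], typeA46⟩
  | .I10 => ⟨True, powEq 1 0 0, xNonzero,
      ![dT, dil, uU (fun x => log |x|), uU (fun _ => 1)], typeA43⟩
  | .I11 n => ⟨n ≠ 0 ∧ n ≠ 1, powEq n 0 0, xNonzero,
      ![dT, dil, uU (fun x => |x| ^ (1 - n)), uU (fun _ => 1)],
      {c | (n ≠ 2 ∧ c ∈ typeA37A1) ∨ (n = 2 ∧ c ∈ typeA35A1)}⟩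
  | .I12 n => ⟨n ≠ 0 ∧ n ≠ 1, powEq n ((n - 1) ^ 2 / 4) 0, xNonzero,
      ![dT, dil, uU (fun x => |x| ^ ((1 - n) / 2)),
        uU (fun x => |x| ^ ((1 - n) / 2) * log |x|)], typeA42⟩
  | .I13 n m => ⟨n ≠ 0 ∧ m ≠ 0 ∧ m < (n - 1) ^ 2 / 4, powEq n m 0, xNonzero,
      ![dT, dil, uU (fun x => |x| ^ ((1 - n + √((n - 1) ^ 2 - 4 * m)) / 2)),
        uU (fun x => |x| ^ ((1 - n - √((n - 1) ^ 2 - 4 * m)) / 2))], typeA45⟩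
  | .I14 n m => ⟨n ≠ 0 ∧ (n - 1) ^ 2 / 4 < m, powEq n m 0, xNonzero,
      ![dT, dil,
        uU (fun x => |x| ^ ((1 - n) / 2) * cos (√(m - (n - 1) ^ 2 / 4) * log |x|)),
        uU (fun x => |x| ^ ((1 - n) / 2) * sin (√(m - (n - 1) ^ 2 / 4) * log |x|))], typeA46⟩
  -- D = k t x⁻³
  | .II1 k => ⟨0 < k, powEq 0 0 k, xNonzero,
      ![dT + uU (fun x => -(k / 2) * x⁻¹), dil, uU (fun x => x), uU (fun _ => 1)], typeA36A1⟩
  | .II2 k => ⟨0 < k, powEq 0 (1 / 4) k, xNonzero,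
      ![dT + uU (fun x => -(4 * k / 9) * x⁻¹), dil,
        uU (fun x => √|x|), uU (fun x => √|x| * log |x|)], typeA42⟩
  | .II3 k m => ⟨0 < k ∧ m ≠ 0 ∧ m ≠ -2 ∧ m < 1 / 4, powEq 0 m k, xNonzero,
      ![dT + uU (fun x => -(k / (m + 2)) * x⁻¹), dil,
        uU (fun x => |x| ^ (1 / 2 + √(1 / 4 - m))),
        uU (fun x => |x| ^ (1 / 2 - √(1 / 4 - m)))], typeA45⟩
  | .II4 k => ⟨0 < k, powEq 0 (-2) k, xNonzero,
      ![dT + uU (fun x => k / 9 * x⁻¹ * (1 + 3 * log |x|)), dil,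
        uU (fun x => x ^ 2), uU (fun x => x⁻¹)], typeA42⟩
  | .II5 k m => ⟨0 < k ∧ 1 / 4 < m, powEq 0 m k, xNonzero,
      ![dT + uU (fun x => -(k / (m + 2)) * x⁻¹), dil,
        uU (fun x => √|x| * cos (√(m - 1 / 4) * log |x|)),
        uU (fun x => √|x| * sin (√(m - 1 / 4) * log |x|))], typeA46⟩
  | .II6 k => ⟨0 < k, powEq 1 0 k, xNonzero,
      ![dT + uU (fun x => -k * x⁻¹), dil, uU (fun _ => 1), uU (fun x => log |x|)], typeA43⟩
  | .II7 k => ⟨0 < k, powEq 2 0 k, xNonzero,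
      ![dT + uU (fun x => k * x⁻¹ * (1 + log |x|)), dil,
        uU (fun _ => 1), uU (fun x => x⁻¹)], typeA34A1⟩
  | .II8 k n => ⟨0 < k ∧ n ≠ 0 ∧ n ≠ 1 ∧ n ≠ 2, powEq n 0 k, xNonzero,
      ![dT + uU (fun x => k / (n - 2) * x⁻¹), dil,
        uU (fun _ => 1), uU (fun x => |x| ^ (1 - n))], typeA37A1⟩
  | .II9 k => ⟨0 < k, powEq 3 1 k, xNonzero,
      ![dT + uU (fun x => -(k / 2) * x⁻¹ * log |x| ^ 2), dil,
        uU (fun x => x⁻¹), uU (fun x => x⁻¹ * log |x|)], typeA44⟩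
  | .II10 k n => ⟨0 < k ∧ n ≠ 0 ∧ n ≠ 1 ∧ n ≠ 3, powEq n ((n - 1) ^ 2 / 4) k, xNonzero,
      ![dT + uU (fun x => -(4 * k / (n - 3) ^ 2) * x⁻¹), dil,
        uU (fun x => |x| ^ ((1 - n) / 2)),
        uU (fun x => |x| ^ ((1 - n) / 2) * log |x|)], typeA42⟩
  | .II11 k n m =>
      ⟨0 < k ∧ n ≠ 0 ∧ m ≠ 0 ∧ m ≠ n - 2 ∧ m < (n - 1) ^ 2 / 4, powEq n m k, xNonzero,
      ![dil, dT + uU (fun x => -(k / (2 - n + m)) * x⁻¹),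
        uU (fun x => |x| ^ ((1 - n + √((n - 1) ^ 2 - 4 * m)) / 2)),
        uU (fun x => |x| ^ ((1 - n - √((n - 1) ^ 2 - 4 * m)) / 2))], typeA45⟩
  | .II12 k n => ⟨0 < k ∧ n ≠ 0 ∧ n ≠ 2 ∧ n ≠ 3, powEq n (n - 2) k, xNonzero,
      ![dil, dT + uU (fun x => k / (3 - n) * x⁻¹ * log |x|),
        uU (fun x => x⁻¹), uU (fun x => |x| ^ (2 - n))], typeA42⟩
  | .II13 k n m => ⟨0 < k ∧ n ≠ 0 ∧ (n - 1) ^ 2 / 4 < m, powEq n m k, xNonzero,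
      ![dil, dT + uU (fun x => -(k / (2 - n + m)) * x⁻¹),
        uU (fun x => |x| ^ ((1 - n) / 2) * cos (√(m - (n - 1) ^ 2 / 4) * log |x|)),
        uU (fun x => |x| ^ ((1 - n) / 2) * sin (√(m - (n - 1) ^ 2 / 4) * log |x|))], typeA46⟩
  -- D = k t
  | .III1 k => ⟨0 < k, constEq 0 0 k, Set.univ,
      ![dX, dT + uU (fun x => -(k / 2) * x ^ 2), uU (fun x => x), uU (fun _ => 1)], typeA41⟩
  | .III2 k => ⟨0 < k, constEq 1 0 k, Set.univ,
      ![dX, dT + uU (fun x => -k * x), uU (fun x => exp (-x)), uU (fun _ => 1)], typeA43⟩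
  | .III3 k β => ⟨0 < k ∧ β ≠ 0, constEq 0 (β ^ 2) k, Set.univ,
      ![dX, dT + uU (fun _ => -(k / β ^ 2)),
        uU (fun x => cos (β * x)), uU (fun x => sin (β * x))], typeA38A1⟩
  | .III4 k β => ⟨0 < k ∧ β ≠ 0, constEq 0 (-β ^ 2) k, Set.univ,
      ![dX, dT + uU (fun _ => k / β ^ 2),
        uU (fun x => cosh (β * x)), uU (fun x => sinh (β * x))], typeA36A1⟩
  | .III5 k => ⟨0 < k, constEq 1 (1 / 4) k, Set.univ,
      ![dX, dT + uU (fun _ => -(4 * k)),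
        uU (fun x => exp (-x / 2)), uU (fun x => x * exp (-x / 2))], typeA34A1⟩
  | .III6 k m => ⟨0 < k ∧ m < 1 / 4 ∧ m ≠ 0, constEq 1 m k, Set.univ,
      ![dX, dT + uU (fun _ => -(k / m)),
        uU (fun x => exp (-((1 - √(1 - 4 * m)) / 2) * x)),
        uU (fun x => exp (-((1 + √(1 - 4 * m)) / 2) * x))], typeA37A1⟩
  | .III7 k m => ⟨0 < k ∧ 1 / 4 < m, constEq 1 m k, Set.univ,
      ![dX, dT + uU (fun _ => -(k / m)),
        uU (fun x => exp (-x / 2) * cos (√(m - 1 / 4) * x)),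
        uU (fun x => exp (-x / 2) * sin (√(m - 1 / 4) * x))], typeA39A1⟩
  -- D = k t⁻²
  | .IV k => ⟨k ≠ 0, ⟨fun _ => 0, fun _ => 0, fun t _ => k * (t ^ 2)⁻¹⟩, {p | p.1 ≠ 0},
      ![dX, dil, uU (fun x => x), uU (fun _ => 1)], typeA48⟩
  -- D = m (x - k t)⁻²
  | .V k m => ⟨0 < k ∧ m ≠ 0,
      ⟨fun _ => 0, fun _ => 0, fun t x => m * ((x - k * t) ^ 2)⁻¹⟩, {p | p.2 - k * p.1 ≠ 0},
      ![dT + k • dX, dil, uU (fun x => x), uU (fun _ => 1)], typeA48⟩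

/-- The only coincidences in the list up to equivalence: within the families `I1`, `I2`, `III1`,
`III3`, `III4` a scaling of `(t,x)` changes the parameters. -/
def SameClass : Listed → Listed → Prop
  | .I1 _, .I1 _ => True
  | .I2 _, .I2 _ => True
  | .III1 _, .III1 _ => True
  | .III3 k β, .III3 k' β' => k * |β'| ^ 3 = k' * |β| ^ 3
  | .III4 k β, .III4 k' β' => k * |β'| ^ 3 = k' * |β| ^ 3
  | a, b => a = b

end WaveClass

end

/-!
The proof solves Lie's determining equations once for the whole class, and reads everything off from
the result.

Along a graph, Lie's criterion is a polynomial in the jet variables `u_t, u_x, u_tx, u_xx`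
(`isSymmetry_iff_lieJet`). Comparing coefficients, every symmetry of an equation of the class is
`(c t + c₁) ∂_t + (c x + c₂) ∂_x + a(x) u ∂_u` with constants `c, c₁, c₂`, where
`c A + (c x + c₂) A' = 0`, `2 c B + (c x + c₂) B' = 0` and
`a'' + A a' + B a + (c t + c₁) D_t + (c x + c₂) D_x + 2 c D = 0`; conversely all of these are
symmetries (`IsSymmetry.exists_determining`, `Determining.isSymmetry`). The slices `x = const` of the
domain have to be connected in order that `a` is a function of `x`.

The algebra is therefore an extension of the space of admissible `(c, c₁, c₂)` (`genSpace`), of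
dimension at most three, by the solutions of `a'' + A a' + B a = 0`, of dimension at most two
(`rank_ker_le`). This gives the bound five. Dimension five forces both translations and the dilation
into `genSpace`, and dimension four forces a subspace of dimension at least two.

In the same way an equivalence is seen to be `v = ± exp(θ(x)) u` up to a scaling, a translation and a
reflection of `(t, x)`, and it acts on `A` and `B` by substitution, and on `D` by substitution and
addition of `θ'' + A θ' + B θ` (`Equivalent.exists_related`, `Related.equivalent`). A summand of `D`
that depends on `x` only can be removed by solving a linear equation for `θ`.

If `genSpace` has dimension at least two, the determining equations are of first order and can be
integrated: `A, B, D_t` are constant if it contains both translations (`normal_const`), they are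
multiples of `z⁻¹, z⁻², z⁻³` with `z = x + c₂` if it contains `∂_t` and a dilation (`normal_pow`), and
`A = B = 0` while `D` is a multiple of `z⁻²`, for an affine function `z` of `(t, x)`, if it contains
a dilation and another translation (`normal_wave`). In the first two cases `a'' + A a' + B a = 0` has
explicit solutions, and the four-dimensional algebras that result are the listed ones
(`equivalent_free`, `equivalent_listed`).

For a listed equation the algebra is spanned by `T`, `X`, `h₁ u ∂_u`, `h₂ u ∂_u`, where `h₁, h₂`
span an invariant space of `(c x + c₂) d/dx` (`SpanPair`). By the Cayley–Hamilton theorem the matrix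
of this operator decides which equation `h₁` and `h₂` solve, and it determines the brackets
(`IsFrame`) and, by linear algebra, the isomorphism type (`Table.HasType`). For `IV` and `V` the pair
is `x, 1`, and `T` is the translation along the level lines of `z`.

Finally `A`, `B` and `D_t` of equivalent equations are related by substitution and scaling. Comparing
them as functions distinguishes the listed equations, except for those with `A = 0` and constant `B`
and `D_t`, where the scaling acts on the parameters (`sameClass_of_equivalent`,
`equivalent_of_sameClass`).
-/

open scoped ContDiff

noncomputable section

namespace WaveClass

open Filter Topology

/-! ### Partial derivatives and total derivatives along a graph -/

/-- Partial derivative in `t` of a function on `(t,x,u)`-space. -/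
def pt (G : Pt → ℝ) : Pt → ℝ := fun p => fderiv ℝ G p (1, 0, 0)

/-- Partial derivative in `x` of a function on `(t,x,u)`-space. -/
def px (G : Pt → ℝ) : Pt → ℝ := fun p => fderiv ℝ G p (0, 1, 0)

/-- Partial derivative in `u` of a function on `(t,x,u)`-space. -/
def pu (G : Pt → ℝ) : Pt → ℝ := fun p => fderiv ℝ G p (0, 0, 1)

/-- The restriction of `G` to the graph of `f`. -/
def along (G : Pt → ℝ) (f : ℝ → ℝ → ℝ) : ℝ → ℝ → ℝ := fun t x => G (t, x, f t x)

section Calculus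

variable {W : Set Pt} {G : Pt → ℝ} {f : ℝ → ℝ → ℝ} {t x : ℝ}

theorem contDiffOn_fderiv_apply {E : Type*} [NormedAddCommGroup E] [NormedSpace ℝ E]
    {s : Set E} (hs : IsOpen s) {g : E → ℝ} (hg : ContDiffOn ℝ ∞ g s) (v : E) :
    ContDiffOn ℝ ∞ (fun p => fderiv ℝ g p v) s :=
  (hg.fderiv_of_isOpen hs (by simp)).clm_apply contDiffOn_const

theorem contDiffOn_pt (hW : IsOpen W) (hG : ContDiffOn ℝ ∞ G W) : ContDiffOn ℝ ∞ (pt G) W :=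
  contDiffOn_fderiv_apply hW hG _

theorem contDiffOn_px (hW : IsOpen W) (hG : ContDiffOn ℝ ∞ G W) : ContDiffOn ℝ ∞ (px G) W :=
  contDiffOn_fderiv_apply hW hG _

theorem contDiffOn_pu (hW : IsOpen W) (hG : ContDiffOn ℝ ∞ G W) : ContDiffOn ℝ ∞ (pu G) W :=
  contDiffOn_fderiv_apply hW hG _

theorem differentiableAt_of_smooth {E F : Type*} [NormedAddCommGroup E] [NormedSpace ℝ E]
    [NormedAddCommGroup F] [NormedSpace ℝ F]
    {s : Set E} (hs : IsOpen s) {g : E → F} (hg : ContDiffOn ℝ ∞ g s) {p : E} (hp : p ∈ s) :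
    DifferentiableAt ℝ g p :=
  (hg.contDiffAt (hs.mem_nhds hp)).differentiableAt (by simp)

/-- Mixed second derivatives agree. -/
theorem fderiv_fderiv_comm {E : Type*} [NormedAddCommGroup E] [NormedSpace ℝ E]
    {s : Set E} (hs : IsOpen s) {g : E → ℝ} (hg : ContDiffOn ℝ ∞ g s) {p : E} (hp : p ∈ s)
    (v w : E) :
    fderiv ℝ (fun q => fderiv ℝ g q v) p w = fderiv ℝ (fun q => fderiv ℝ g q w) p v := by
  have hg' : DifferentiableAt ℝ (fderiv ℝ g) p :=
    differentiableAt_of_smooth hs (hg.fderiv_of_isOpen hs (by simp)) hp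
  have hsym : IsSymmSndFDerivAt ℝ g p :=
    (hg.contDiffAt (hs.mem_nhds hp)).isSymmSndFDerivAt (by
      rw [minSmoothness_of_isRCLikeNormedField]; exact WithTop.coe_le_coe.2 le_top)
  have key : ∀ v : E, fderiv ℝ (fun q => fderiv ℝ g q v) p = (fderiv ℝ (fderiv ℝ g) p).flip v := by
    intro v
    rw [fderiv_clm_apply hg' (differentiableAt_const v)]
    ext w
    simp
  rw [key, key]
  exact hsym.eq w v

theorem Smooth₂.dt_eq (hf : Smooth₂ f) (t x : ℝ) :
    HasDerivAt (fun s => f s x) (fderiv ℝ (fun p : ℝ × ℝ => f p.1 p.2) (t, x) (1, 0)) t := by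
  have h := ((hf.differentiable (by simp)) (t, x)).hasFDerivAt
  exact h.comp_hasDerivAt t ((hasDerivAt_id t).prodMk (hasDerivAt_const t x))

theorem Smooth₂.dx_eq (hf : Smooth₂ f) (t x : ℝ) :
    HasDerivAt (fun y => f t y) (fderiv ℝ (fun p : ℝ × ℝ => f p.1 p.2) (t, x) (0, 1)) x := by
  have h := ((hf.differentiable (by simp)) (t, x)).hasFDerivAt
  exact h.comp_hasDerivAt x ((hasDerivAt_const x t).prodMk (hasDerivAt_id x))

theorem Smooth₂.hasDerivAt_dt (hf : Smooth₂ f) (t x : ℝ) :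
    HasDerivAt (fun s => f s x) (dt f t x) t :=
  (hf.dt_eq t x).differentiableAt.hasDerivAt

theorem Smooth₂.hasDerivAt_dx (hf : Smooth₂ f) (t x : ℝ) :
    HasDerivAt (fun y => f t y) (dx f t x) x :=
  (hf.dx_eq t x).differentiableAt.hasDerivAt

theorem Smooth₂.dt (hf : Smooth₂ f) : Smooth₂ (dt f) := by
  have h : (fun p : ℝ × ℝ => WaveClass.dt f p.1 p.2)
      = fun p => fderiv ℝ (fun p : ℝ × ℝ => f p.1 p.2) p (1, 0) := by
    funext p
    exact (hf.dt_eq p.1 p.2).deriv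
  rw [Smooth₂, h, ← contDiffOn_univ]
  exact contDiffOn_fderiv_apply isOpen_univ hf.contDiffOn _

theorem Smooth₂.dx (hf : Smooth₂ f) : Smooth₂ (dx f) := by
  have h : (fun p : ℝ × ℝ => WaveClass.dx f p.1 p.2)
      = fun p => fderiv ℝ (fun p : ℝ × ℝ => f p.1 p.2) p (0, 1) := by
    funext p
    exact (hf.dx_eq p.1 p.2).deriv
  rw [Smooth₂, h, ← contDiffOn_univ]
  exact contDiffOn_fderiv_apply isOpen_univ hf.contDiffOn _

theorem Smooth₂.dt_dx (hf : Smooth₂ f) (t x : ℝ) :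
    WaveClass.dt (WaveClass.dx f) t x = WaveClass.dx (WaveClass.dt f) t x := by
  rw [(hf.dx.hasDerivAt_dt t x).unique (hf.dx.dt_eq t x),
    (hf.dt.hasDerivAt_dx t x).unique (hf.dt.dx_eq t x)]
  have h1 : (fun p : ℝ × ℝ => WaveClass.dx f p.1 p.2)
      = fun p => fderiv ℝ (fun p : ℝ × ℝ => f p.1 p.2) p (0, 1) := by
    funext p
    exact (hf.dx_eq p.1 p.2).deriv
  have h2 : (fun p : ℝ × ℝ => WaveClass.dt f p.1 p.2)
      = fun p => fderiv ℝ (fun p : ℝ × ℝ => f p.1 p.2) p (1, 0) := by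
    funext p
    exact (hf.dt_eq p.1 p.2).deriv
  rw [h1, h2]
  exact fderiv_fderiv_comm isOpen_univ hf.contDiffOn (Set.mem_univ _) _ _

theorem fderiv_apply_pt (L : Pt →L[ℝ] ℝ) (a b c : ℝ) :
    L (a, b, c) = a * L (1, 0, 0) + b * L (0, 1, 0) + c * L (0, 0, 1) := by
  have : ((a, b, c) : Pt) = a • (1, 0, 0) + b • (0, 1, 0) + c • (0, 0, 1) := by
    simp
  rw [this, map_add, map_add, map_smul, map_smul, map_smul]
  simp

theorem hasDerivAt_along_t (hW : IsOpen W) (hG : ContDiffOn ℝ ∞ G W) (hf : Smooth₂ f)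
    (hp : (t, x, f t x) ∈ W) :
    HasDerivAt (fun s => along G f s x)
      (along (pt G) f t x + along (pu G) f t x * dt f t x) t := by
  have h := (differentiableAt_of_smooth hW hG hp).hasFDerivAt
  have h2 := h.comp_hasDerivAt t
    ((hasDerivAt_id t).prodMk ((hasDerivAt_const t x).prodMk (hf.hasDerivAt_dt t x)))
  refine h2.congr_deriv ?_
  rw [fderiv_apply_pt]
  simp only [along, pt, pu]
  ring

theorem hasDerivAt_along_x (hW : IsOpen W) (hG : ContDiffOn ℝ ∞ G W) (hf : Smooth₂ f)
    (hp : (t, x, f t x) ∈ W) :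
    HasDerivAt (fun y => along G f t y)
      (along (px G) f t x + along (pu G) f t x * dx f t x) x := by
  have h := (differentiableAt_of_smooth hW hG hp).hasFDerivAt
  have h2 := h.comp_hasDerivAt x
    ((hasDerivAt_const x t).prodMk ((hasDerivAt_id x).prodMk (hf.hasDerivAt_dx t x)))
  refine h2.congr_deriv ?_
  rw [fderiv_apply_pt]
  simp only [along, px, pu]
  ring

theorem eventually_graph_t (hW : IsOpen W) (hf : Smooth₂ f) (hp : (t, x, f t x) ∈ W) :
    ∀ᶠ s in 𝓝 t, (s, x, f s x) ∈ W := by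
  have : ContinuousAt (fun s => ((s, x, f s x) : Pt)) t :=
    continuousAt_id.prodMk (continuousAt_const.prodMk (hf.hasDerivAt_dt t x).continuousAt)
  exact this (hW.mem_nhds hp)

theorem eventually_graph_x (hW : IsOpen W) (hf : Smooth₂ f) (hp : (t, x, f t x) ∈ W) :
    ∀ᶠ y in 𝓝 x, (t, y, f t y) ∈ W := by
  have : ContinuousAt (fun y => ((t, y, f t y) : Pt)) x :=
    continuousAt_const.prodMk (continuousAt_id.prodMk (hf.hasDerivAt_dx t x).continuousAt)
  exact this (hW.mem_nhds hp)

/-- Second total derivative in `t` along a graph. -/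
theorem hasDerivAt_dt_along (hW : IsOpen W) (hG : ContDiffOn ℝ ∞ G W) (hf : Smooth₂ f)
    (hp : (t, x, f t x) ∈ W) :
    HasDerivAt (fun s => dt (along G f) s x)
      (along (pt (pt G)) f t x + 2 * along (pt (pu G)) f t x * dt f t x
        + along (pu (pu G)) f t x * dt f t x ^ 2 + along (pu G) f t x * dt (dt f) t x) t := by
  have h := (hasDerivAt_along_t hW (contDiffOn_pt hW hG) hf hp).add
    ((hasDerivAt_along_t hW (contDiffOn_pu hW hG) hf hp).mul (hf.dt.hasDerivAt_dt t x))
  have hs : along (pu (pt G)) f t x = along (pt (pu G)) f t x :=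
    fderiv_fderiv_comm hW hG hp _ _
  refine (h.congr_deriv ?_).congr_of_eventuallyEq ?_
  · rw [hs]; ring
  · filter_upwards [eventually_graph_t hW hf hp] with s hs
    exact (hasDerivAt_along_t hW hG hf hs).deriv

/-- Second total derivative in `x` along a graph. -/
theorem hasDerivAt_dx_along (hW : IsOpen W) (hG : ContDiffOn ℝ ∞ G W) (hf : Smooth₂ f)
    (hp : (t, x, f t x) ∈ W) :
    HasDerivAt (fun y => dx (along G f) t y)
      (along (px (px G)) f t x + 2 * along (px (pu G)) f t x * dx f t x
        + along (pu (pu G)) f t x * dx f t x ^ 2 + along (pu G) f t x * dx (dx f) t x) x := by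
  have h := (hasDerivAt_along_x hW (contDiffOn_px hW hG) hf hp).add
    ((hasDerivAt_along_x hW (contDiffOn_pu hW hG) hf hp).mul (hf.dx.hasDerivAt_dx t x))
  have hs : along (pu (px G)) f t x = along (px (pu G)) f t x :=
    fderiv_fderiv_comm hW hG hp _ _
  refine (h.congr_deriv ?_).congr_of_eventuallyEq ?_
  · rw [hs]; ring
  · filter_upwards [eventually_graph_x hW hf hp] with s hs
    exact (hasDerivAt_along_x hW hG hf hs).deriv

end Calculus

/-- The coefficient `τ` of a vector field. -/
abbrev cT (Q : VF) : Pt → ℝ := fun p => (Q p).1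

/-- The coefficient `ξ` of a vector field. -/
abbrev cX (Q : VF) : Pt → ℝ := fun p => (Q p).2.1

/-- The coefficient `η` of a vector field. -/
abbrev cU (Q : VF) : Pt → ℝ := fun p => (Q p).2.2

/-- The expression `φ^tt - φ^xx - τ F_t - ξ F_x - η F_u - φ^x F_{u_x}` as a polynomial in the jet
`(v, w, a, r, s) = (u_t, u_x, u_tt, u_tx, u_xx)`, in terms of the partial derivatives of the
coefficients at a point; `Ft Fx Fu Fq` are the partial derivatives of the right-hand side. -/
def lieJet (Q : VF) (P : Pt) (Ft Fx Fu Fq v w a r s : ℝ) : ℝ :=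
  ((pt (pt (cU Q)) P + 2 * pt (pu (cU Q)) P * v + pu (pu (cU Q)) P * v ^ 2 + pu (cU Q) P * a)
    - v * (pt (pt (cT Q)) P + 2 * pt (pu (cT Q)) P * v + pu (pu (cT Q)) P * v ^ 2
        + pu (cT Q) P * a)
    - w * (pt (pt (cX Q)) P + 2 * pt (pu (cX Q)) P * v + pu (pu (cX Q)) P * v ^ 2
        + pu (cX Q) P * a)
    - 2 * a * (pt (cT Q) P + pu (cT Q) P * v) - 2 * r * (pt (cX Q) P + pu (cX Q) P * v))
  - ((px (px (cU Q)) P + 2 * px (pu (cU Q)) P * w + pu (pu (cU Q)) P * w ^ 2 + pu (cU Q) P * s)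
    - v * (px (px (cT Q)) P + 2 * px (pu (cT Q)) P * w + pu (pu (cT Q)) P * w ^ 2
        + pu (cT Q) P * s)
    - w * (px (px (cX Q)) P + 2 * px (pu (cX Q)) P * w + pu (pu (cX Q)) P * w ^ 2
        + pu (cX Q) P * s)
    - 2 * r * (px (cT Q) P + pu (cT Q) P * w) - 2 * s * (px (cX Q) P + pu (cX Q) P * w))
  - cT Q P * Ft - cX Q P * Fx - cU Q P * Fu
  - (px (cU Q) P + pu (cU Q) P * w - v * (px (cT Q) P + pu (cT Q) P * w)
      - w * (px (cX Q) P + pu (cX Q) P * w)) * Fq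

section LieExpr

variable {W : Set Pt} {Q : VF} {f : ℝ → ℝ → ℝ} {t x : ℝ}

theorem contDiffOn_cT (hQ : ContDiffOn ℝ ∞ Q W) : ContDiffOn ℝ ∞ (cT Q) W := hQ.fst
theorem contDiffOn_cX (hQ : ContDiffOn ℝ ∞ Q W) : ContDiffOn ℝ ∞ (cX Q) W := hQ.snd.fst
theorem contDiffOn_cU (hQ : ContDiffOn ℝ ∞ Q W) : ContDiffOn ℝ ∞ (cU Q) W := hQ.snd.snd

/-- Lie's expression along a graph depends only on the 2-jet. -/
theorem lieExpr_eq (F : Rhs) (hW : IsOpen W) (hQ : ContDiffOn ℝ ∞ Q W) (hf : Smooth₂ f)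
    (hp : (t, x, f t x) ∈ W) :
    lieExpr F Q f t x = lieJet Q (t, x, f t x)
      (deriv (fun s => F s x (f t x) (dx f t x)) t)
      (deriv (fun y => F t y (f t x) (dx f t x)) x)
      (deriv (fun v => F t x v (dx f t x)) (f t x))
      (deriv (fun q => F t x (f t x) q) (dx f t x))
      (dt f t x) (dx f t x) (dt (dt f) t x) (dx (dt f) t x) (dx (dx f) t x) := by
  have hT := contDiffOn_cT hQ
  have hX := contDiffOn_cX hQ
  have hU := contDiffOn_cU hQ
  have t1 : ∀ G : Pt → ℝ, ContDiffOn ℝ ∞ G W → dt (along G f) t x = _ :=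
    fun G hG => (hasDerivAt_along_t hW hG hf hp).deriv
  have x1 : ∀ G : Pt → ℝ, ContDiffOn ℝ ∞ G W → dx (along G f) t x = _ :=
    fun G hG => (hasDerivAt_along_x hW hG hf hp).deriv
  have tt : dt (phiT Q f) t x = _ :=
    (((hasDerivAt_dt_along hW hU hf hp).sub
      ((hf.dt.hasDerivAt_dt t x).mul (hasDerivAt_dt_along hW hT hf hp))).sub
      ((hf.dx.hasDerivAt_dt t x).mul (hasDerivAt_dt_along hW hX hf hp))).deriv
  have xx : dx (phiX Q f) t x = _ :=
    (((hasDerivAt_dx_along hW hU hf hp).sub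
      ((hf.dt.hasDerivAt_dx t x).mul (hasDerivAt_dx_along hW hT hf hp))).sub
      ((hf.dx.hasDerivAt_dx t x).mul (hasDerivAt_dx_along hW hX hf hp))).deriv
  have eT : tauAlong Q f = along (cT Q) f := rfl
  have eX : xiAlong Q f = along (cX Q) f := rfl
  have eU : etaAlong Q f = along (cU Q) f := rfl
  unfold lieExpr phiTT phiXX
  rw [tt, xx]
  unfold phiX
  rw [eT, eX, eU, t1 _ hT, t1 _ hX, x1 _ hT, x1 _ hX, x1 _ hU, hf.dt_dx]
  simp only [along, lieJet]
  ring

/-- A polynomial with prescribed 2-jet at `(t,x)`. -/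
def jetPoly (t x u v w a r s : ℝ) : ℝ → ℝ → ℝ := fun t' x' =>
  u + v * (t' - t) + w * (x' - x) + a / 2 * (t' - t) ^ 2 + r * (t' - t) * (x' - x)
    + s / 2 * (x' - x) ^ 2

theorem smooth_jetPoly (t x u v w a r s : ℝ) : Smooth₂ (jetPoly t x u v w a r s) := by
  unfold Smooth₂ jetPoly
  fun_prop

theorem dt_jetPoly (t x u v w a r s : ℝ) :
    dt (jetPoly t x u v w a r s) = jetPoly t x v a r 0 0 0 := by
  funext t' x'
  have h1 : HasDerivAt (fun z : ℝ => z - t) 1 t' := (hasDerivAt_id t').sub_const t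
  have := (((((h1.const_mul v).const_add u).add_const (w * (x' - x))).add
    ((h1.pow 2).const_mul (a / 2))).add ((h1.const_mul r).mul_const (x' - x))).add_const
      (s / 2 * (x' - x) ^ 2)
  refine (this.deriv).trans ?_
  simp only [jetPoly]
  ring

theorem dx_jetPoly (t x u v w a r s : ℝ) :
    dx (jetPoly t x u v w a r s) = jetPoly t x w r s 0 0 0 := by
  funext t' x'
  have h1 : HasDerivAt (fun z : ℝ => z - x) 1 x' := (hasDerivAt_id x').sub_const x
  have := ((((h1.const_mul w).const_add (u + v * (t' - t))).add_const (a / 2 * (t' - t) ^ 2)).add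
    (h1.const_mul (r * (t' - t)))).add ((h1.pow 2).const_mul (s / 2))
  refine (this.deriv).trans ?_
  simp only [jetPoly]
  ring

theorem jetPoly_self (t x u v w a r s : ℝ) : jetPoly t x u v w a r s t x = u := by
  simp [jetPoly]

/-- Lie's criterion as a condition on 2-jets. -/
theorem isSymmetry_iff_lieJet {F : Rhs} (hW : IsOpen W) :
    IsSymmetry W F Q ↔ ContDiffOn ℝ ∞ Q W ∧ ∀ t x u, (t, x, u) ∈ W → ∀ v w r s : ℝ,
      lieJet Q (t, x, u) (deriv (fun s => F s x u w) t) (deriv (fun y => F t y u w) x)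
        (deriv (fun z => F t x z w) u) (deriv (fun q => F t x u q) w)
        v w (s + F t x u w) r s = 0 := by
  refine and_congr_right fun hQ => ⟨fun h t x u hp v w r s => ?_, fun h f hf t x hp hs => ?_⟩
  · have hj := smooth_jetPoly t x u v w (s + F t x u w) r s
    have h0 := jetPoly_self t x u v w (s + F t x u w) r s
    have hp' : (t, x, jetPoly t x u v w (s + F t x u w) r s t x) ∈ W := by rwa [h0]
    have := h _ hj t x hp' (by
      simp only [SolvesAt, dt_jetPoly, dx_jetPoly, jetPoly_self])
    rw [lieExpr_eq F hW hQ hj hp'] at this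
    simpa only [dt_jetPoly, dx_jetPoly, jetPoly_self] using this
  · rw [lieExpr_eq F hW hQ hf hp]
    have := h t x (f t x) hp (dt f t x) (dx f t x) (dx (dt f) t x) (dx (dx f) t x)
    rwa [← hs] at this

end LieExpr

/-! ### Functions on admissible domains -/

section Domains

variable {W : Set Pt}

theorem isOpen_projX (hW : IsOpen W) : IsOpen (projX W) := by
  have : IsOpenMap (fun p : Pt => p.2.1) := isOpenMap_fst.comp isOpenMap_snd
  exact this W hW

theorem isOpen_projTX (hW : IsOpen W) : IsOpen (projTX W) := by
  have : IsOpenMap (fun p : Pt => (p.1, p.2.1)) := IsOpenMap.id.prodMap isOpenMap_fst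
  exact this W hW

theorem mem_projX {p : Pt} (hp : p ∈ W) : p.2.1 ∈ projX W := ⟨p, hp, rfl⟩

theorem mem_projTX {p : Pt} (hp : p ∈ W) : (p.1, p.2.1) ∈ projTX W := ⟨p, hp, rfl⟩

theorem mem_projX_of_projTX {t x : ℝ} (h : (t, x) ∈ projTX W) : x ∈ projX W := by
  obtain ⟨p, hp, h⟩ := h
  exact ⟨p, hp, (Prod.ext_iff.1 h).2⟩

theorem exists_of_mem_projTX {t x : ℝ} (h : (t, x) ∈ projTX W) : ∃ u, (t, x, u) ∈ W := by
  obtain ⟨⟨t', x', u⟩, hp, h⟩ := h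
  obtain ⟨rfl, rfl⟩ := Prod.ext_iff.1 h
  exact ⟨u, hp⟩

theorem exists_of_mem_projX {x : ℝ} (h : x ∈ projX W) : ∃ t, (t, x) ∈ projTX W := by
  obtain ⟨⟨t', x', u⟩, hp, rfl⟩ := h
  exact ⟨t', _, hp, rfl⟩

theorem isPreconnected_projX (hW : IsPreconnected W) : IsPreconnected (projX W) :=
  hW.image _ (by fun_prop)

theorem pt_congr (hW : IsOpen W) {G G' : Pt → ℝ} (h : Set.EqOn G G' W) :
    Set.EqOn (pt G) (pt G') W := fun p hp => by
  simp only [pt, (h.eventuallyEq_of_mem (hW.mem_nhds hp)).fderiv_eq]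

theorem px_congr (hW : IsOpen W) {G G' : Pt → ℝ} (h : Set.EqOn G G' W) :
    Set.EqOn (px G) (px G') W := fun p hp => by
  simp only [px, (h.eventuallyEq_of_mem (hW.mem_nhds hp)).fderiv_eq]

theorem pu_congr (hW : IsOpen W) {G G' : Pt → ℝ} (h : Set.EqOn G G' W) :
    Set.EqOn (pu G) (pu G') W := fun p hp => by
  simp only [pu, (h.eventuallyEq_of_mem (hW.mem_nhds hp)).fderiv_eq]

@[simp] theorem pt_const (k : ℝ) : pt (fun _ => k) = fun _ => 0 := by funext p; simp [pt]
@[simp] theorem px_const (k : ℝ) : px (fun _ => k) = fun _ => 0 := by funext p; simp [px]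
@[simp] theorem pu_const (k : ℝ) : pu (fun _ => k) = fun _ => 0 := by funext p; simp [pu]

theorem pt_pu (hW : IsOpen W) {G : Pt → ℝ} (hG : ContDiffOn ℝ ∞ G W) :
    Set.EqOn (pt (pu G)) (pu (pt G)) W := fun _ hp => fderiv_fderiv_comm hW hG hp _ _

theorem pt_px (hW : IsOpen W) {G : Pt → ℝ} (hG : ContDiffOn ℝ ∞ G W) :
    Set.EqOn (pt (px G)) (px (pt G)) W := fun _ hp => fderiv_fderiv_comm hW hG hp _ _

theorem partials_of_hasFDerivAt {G : Pt → ℝ} {p : Pt} {L : Pt →L[ℝ] ℝ} (h : HasFDerivAt G L p) :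
    pt G p = L (1, 0, 0) ∧ px G p = L (0, 1, 0) ∧ pu G p = L (0, 0, 1) := by
  simp [pt, px, pu, h.fderiv]

/-- A function on a connected open set whose partial derivatives vanish is constant. -/
theorem exists_const_of_partials (hW : IsOpen W) (hc : IsPreconnected W) {G : Pt → ℝ}
    (hG : ContDiffOn ℝ ∞ G W) (h1 : ∀ p ∈ W, pt G p = 0) (h2 : ∀ p ∈ W, px G p = 0)
    (h3 : ∀ p ∈ W, pu G p = 0) : ∃ k, ∀ p ∈ W, G p = k := by
  refine hW.exists_is_const_of_fderiv_eq_zero hc (hG.differentiableOn (by simp)) fun p hp => ?_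
  ext <;> simp
  · exact h1 p hp
  · exact h2 p hp
  · exact h3 p hp

/-- The slice of an open set at `x`, as a subset of the `(t,u)`-plane. -/
theorem isOpen_slice (hW : IsOpen W) (x : ℝ) : IsOpen {q : ℝ × ℝ | (q.1, x, q.2) ∈ W} :=
  hW.preimage (by fun_prop)

theorem isPreconnected_slice (hW : IsAdmissible W) (x : ℝ) :
    IsPreconnected {q : ℝ × ℝ | (q.1, x, q.2) ∈ W} := by
  have h := (hW.slice x).image (fun p : Pt => (p.1, p.2.2)) (by fun_prop)
  convert h using 1
  ext ⟨t, u⟩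
  constructor
  · intro hp
    exact ⟨(t, x, u), ⟨hp, rfl⟩, rfl⟩
  · rintro ⟨⟨t', x', u'⟩, ⟨hp, h'⟩, h''⟩
    simp only [Prod.mk.injEq] at h' h''
    obtain ⟨rfl, rfl⟩ := h''
    subst h'
    exact hp

/-- A function on an admissible domain whose derivatives in `t` and `u` vanish is a smooth
function of `x`. -/
theorem exists_fun_x (hW : IsAdmissible W) {G : Pt → ℝ} (hG : ContDiffOn ℝ ∞ G W)
    (h1 : ∀ p ∈ W, pt G p = 0) (h3 : ∀ p ∈ W, pu G p = 0) :
    ∃ a : ℝ → ℝ, ContDiffOn ℝ ∞ a (projX W) ∧ ∀ p ∈ W, G p = a p.2.1 := by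
  have key : ∀ x, ∃ k, ∀ q ∈ {q : ℝ × ℝ | (q.1, x, q.2) ∈ W}, G (q.1, x, q.2) = k := by
    intro x
    have hd : ∀ q ∈ {q : ℝ × ℝ | (q.1, x, q.2) ∈ W},
        HasFDerivAt (fun q : ℝ × ℝ => G (q.1, x, q.2)) (0 : ℝ × ℝ →L[ℝ] ℝ) q := by
      intro q hq
      have h := (differentiableAt_of_smooth hW.isOpen hG hq).hasFDerivAt
      have h2 := h.comp q ((hasFDerivAt_fst (𝕜 := ℝ) (p := q)).prodMk
        ((hasFDerivAt_const x q).prodMk (hasFDerivAt_snd (𝕜 := ℝ) (p := q))))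
      refine h2.congr_fderiv ?_
      ext
      · have := h1 _ hq
        simpa [pt] using this
      · have := h3 _ hq
        simpa [pu] using this
    exact (isOpen_slice hW.isOpen x).exists_is_const_of_fderiv_eq_zero
      (isPreconnected_slice hW x) (fun q hq => (hd q hq).differentiableAt.differentiableWithinAt)
      fun q hq => (hd q hq).fderiv
  choose a ha using key
  have hGa : ∀ p ∈ W, G p = a p.2.1 := fun p hp => ha p.2.1 (p.1, p.2.2) hp
  refine ⟨a, ?_, hGa⟩
  rintro x ⟨⟨t, x, u⟩, hp, rfl⟩
  have hcont : ContDiff ℝ ∞ (fun y : ℝ => ((t, y, u) : Pt)) := by fun_prop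
  have h1 : ContDiffAt ℝ ∞ (fun y : ℝ => G (t, y, u)) x :=
    ContDiffAt.comp x (f := fun y : ℝ => ((t, y, u) : Pt))
      (hG.contDiffAt (hW.isOpen.mem_nhds hp)) hcont.contDiffAt
  refine (h1.congr_of_eventuallyEq ?_).contDiffWithinAt
  filter_upwards [hcont.continuous.continuousAt.preimage_mem_nhds (hW.isOpen.mem_nhds hp)] with y hy
  exact (hGa _ hy).symm

end Domains

/-! ### The determining equations -/

/-- The vector field `(c t + c₁) ∂_t + (c x + c₂) ∂_x + a(x) u ∂_u`. -/
def symField (c c₁ c₂ : ℝ) (a : ℝ → ℝ) : VF := fun p =>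
  (c * p.1 + c₁, c * p.2.1 + c₂, a p.2.1 * p.2.2)

/-- The differential operator `a'' + A a' + B a`. -/
def WaveEq.op (e : WaveEq) (a : ℝ → ℝ) (x : ℝ) : ℝ :=
  deriv (deriv a) x + e.A x * deriv a x + e.B x * a x

/-- The conditions on `c, c₁, c₂, a` under which `(c t + c₁) ∂_t + (c x + c₂) ∂_x + a(x) u ∂_u` is
a symmetry. -/
structure Determining (W : Set Pt) (e : WaveEq) (c c₁ c₂ : ℝ) (a : ℝ → ℝ) : Prop where
  smooth : ContDiffOn ℝ ∞ a (projX W)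
  eqA : ∀ x ∈ projX W, c * e.A x + (c * x + c₂) * deriv e.A x = 0
  eqB : ∀ x ∈ projX W, 2 * c * e.B x + (c * x + c₂) * deriv e.B x = 0
  eqD : ∀ t x, (t, x) ∈ projTX W → e.op a x + (c * t + c₁) * dt e.D t x
    + (c * x + c₂) * dx e.D t x + 2 * c * e.D t x = 0

section Determining

variable {W : Set Pt} {e : WaveEq} {c c₁ c₂ : ℝ} {a : ℝ → ℝ}

theorem contDiffOn_comp_x {h : ℝ → ℝ} (hh : ContDiffOn ℝ ∞ h (projX W)) :
    ContDiffOn ℝ ∞ (fun p : Pt => h p.2.1) W :=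
  hh.comp (by fun_prop) fun _ hp => mem_projX hp

theorem contDiffOn_symField (ha : ContDiffOn ℝ ∞ a (projX W)) :
    ContDiffOn ℝ ∞ (symField c c₁ c₂ a) W :=
  ContDiffOn.prodMk (by fun_prop) (ContDiffOn.prodMk (by fun_prop)
    ((contDiffOn_comp_x ha).mul (by fun_prop)))

theorem contDiffOn_deriv' {s : Set ℝ} (hs : IsOpen s) {h : ℝ → ℝ} (hh : ContDiffOn ℝ ∞ h s) :
    ContDiffOn ℝ ∞ (deriv h) s := hh.deriv_of_isOpen hs (by simp)

theorem hasFDerivAt_comp_x {h : ℝ → ℝ} {p : Pt} (hh : DifferentiableAt ℝ h p.2.1) :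
    HasFDerivAt (fun p : Pt => h p.2.1) (deriv h p.2.1 •
      (ContinuousLinearMap.fst ℝ ℝ ℝ).comp (ContinuousLinearMap.snd ℝ ℝ (ℝ × ℝ))) p :=
  hh.hasDerivAt.comp_hasFDerivAt p ((hasFDerivAt_fst).comp p hasFDerivAt_snd)

theorem partials_comp_x (hW : IsOpen W) {h : ℝ → ℝ} (hh : ContDiffOn ℝ ∞ h (projX W))
    {p : Pt} (hp : p ∈ W) :
    pt (fun p => h p.2.1) p = 0 ∧ px (fun p => h p.2.1) p = deriv h p.2.1 ∧
      pu (fun p => h p.2.1) p = 0 := by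
  have := partials_of_hasFDerivAt (hasFDerivAt_comp_x
    (differentiableAt_of_smooth (isOpen_projX hW) hh (mem_projX hp)))
  simpa using this

theorem partials_comp_x_mul_u (hW : IsOpen W) {h : ℝ → ℝ} (hh : ContDiffOn ℝ ∞ h (projX W))
    {p : Pt} (hp : p ∈ W) :
    pt (fun p => h p.2.1 * p.2.2) p = 0 ∧ px (fun p => h p.2.1 * p.2.2) p = deriv h p.2.1 * p.2.2 ∧
      pu (fun p => h p.2.1 * p.2.2) p = h p.2.1 := by
  have := partials_of_hasFDerivAt (G := fun p : Pt => h p.2.1 * p.2.2) ((hasFDerivAt_comp_x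
    (differentiableAt_of_smooth (isOpen_projX hW) hh (mem_projX hp))).mul
    ((hasFDerivAt_snd (𝕜 := ℝ) (p := p.2)).comp p hasFDerivAt_snd))
  simpa [mul_comm] using this

/-- Lie's expression for the fields of the special form. -/
theorem lieJet_symField (hW : IsOpen W) (ha : ContDiffOn ℝ ∞ a (projX W)) {p : Pt} (hp : p ∈ W)
    (Ft Fx Fu Fq v w F r s : ℝ) :
    lieJet (symField c c₁ c₂ a) p Ft Fx Fu Fq v w (s + F) r s =
      (a p.2.1 - 2 * c) * F - deriv (deriv a) p.2.1 * p.2.2 - 2 * deriv a p.2.1 * w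
      - (c * p.1 + c₁) * Ft - (c * p.2.1 + c₂) * Fx - a p.2.1 * p.2.2 * Fu
      - (deriv a p.2.1 * p.2.2 + a p.2.1 * w - c * w) * Fq := by
  have hJ := isOpen_projX hW
  have ha' := contDiffOn_deriv' hJ ha
  have T : ∀ q : Pt, pt (cT (symField c c₁ c₂ a)) q = c ∧ px (cT (symField c c₁ c₂ a)) q = 0 ∧
      pu (cT (symField c c₁ c₂ a)) q = 0 := fun q => by
    have := partials_of_hasFDerivAt (G := cT (symField c c₁ c₂ a)) (((hasFDerivAt_fst (𝕜 := ℝ) (p := q)).const_mul c).add_const c₁)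
    simpa using this
  have X : ∀ q : Pt, pt (cX (symField c c₁ c₂ a)) q = 0 ∧ px (cX (symField c c₁ c₂ a)) q = c ∧
      pu (cX (symField c c₁ c₂ a)) q = 0 := fun q => by
    have := partials_of_hasFDerivAt (G := cX (symField c c₁ c₂ a)) ((((hasFDerivAt_fst (𝕜 := ℝ) (p := q.2)).comp q
      hasFDerivAt_snd).const_mul c).add_const c₂)
    simpa using this
  have Tt : pt (cT (symField c c₁ c₂ a)) = fun _ => c := funext fun q => (T q).1
  have Tx : px (cT (symField c c₁ c₂ a)) = fun _ => 0 := funext fun q => (T q).2.1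
  have Tu : pu (cT (symField c c₁ c₂ a)) = fun _ => 0 := funext fun q => (T q).2.2
  have Xt : pt (cX (symField c c₁ c₂ a)) = fun _ => 0 := funext fun q => (X q).1
  have Xx : px (cX (symField c c₁ c₂ a)) = fun _ => c := funext fun q => (X q).2.1
  have Xu : pu (cX (symField c c₁ c₂ a)) = fun _ => 0 := funext fun q => (X q).2.2
  have U : cU (symField c c₁ c₂ a) = fun p => a p.2.1 * p.2.2 := rfl
  have Ut : Set.EqOn (pt (cU (symField c c₁ c₂ a))) (fun _ => 0) W :=
    fun q hq => (partials_comp_x_mul_u hW ha hq).1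
  have Ux : Set.EqOn (px (cU (symField c c₁ c₂ a))) (fun p => deriv a p.2.1 * p.2.2) W :=
    fun q hq => (partials_comp_x_mul_u hW ha hq).2.1
  have Uu : Set.EqOn (pu (cU (symField c c₁ c₂ a))) (fun p => a p.2.1) W :=
    fun q hq => (partials_comp_x_mul_u hW ha hq).2.2
  have Utt := (pt_congr hW Ut hp).trans (congrFun (pt_const 0) p)
  have Utu := (pt_congr hW Uu hp).trans (partials_comp_x hW ha hp).1
  have Uuu := (pu_congr hW Uu hp).trans (partials_comp_x hW ha hp).2.2
  have Uxu := (px_congr hW Uu hp).trans (partials_comp_x hW ha hp).2.1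
  have Uxx := (px_congr hW Ux hp).trans (partials_comp_x_mul_u hW ha' hp).2.1
  simp only [lieJet, Tt, Tx, Tu, Xt, Xx, Xu, Utt, Utu, Uuu, Uxu, Uxx, Ux hp, Uu hp, pt_const,
    px_const, pu_const]
  simp only [cT, cX, cU, symField]
  ring

theorem InClass.differentiableAt_A (he : InClass W e) {x : ℝ} (hx : x ∈ projX W) :
    DifferentiableAt ℝ e.A x :=
  differentiableAt_of_smooth (isOpen_projX he.domain.isOpen) he.smooth_A hx

theorem InClass.differentiableAt_B (he : InClass W e) {x : ℝ} (hx : x ∈ projX W) :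
    DifferentiableAt ℝ e.B x :=
  differentiableAt_of_smooth (isOpen_projX he.domain.isOpen) he.smooth_B hx

theorem InClass.hasDerivAt_D (he : InClass W e) {t x : ℝ} (hx : (t, x) ∈ projTX W) :
    HasDerivAt (fun s => e.D s x) (dt e.D t x) t ∧ HasDerivAt (fun y => e.D t y) (dx e.D t x) x := by
  have h := (differentiableAt_of_smooth (isOpen_projTX he.domain.isOpen) he.smooth_D hx).hasFDerivAt
  have h1 := h.comp_hasDerivAt t ((hasDerivAt_id t).prodMk (hasDerivAt_const t x))
  have h2 := h.comp_hasDerivAt x ((hasDerivAt_const x t).prodMk (hasDerivAt_id x))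
  exact ⟨h1.differentiableAt.hasDerivAt, h2.differentiableAt.hasDerivAt⟩

/-- Partial derivatives of the right-hand side of an equation of the class. -/
theorem InClass.deriv_rhs (he : InClass W e) {t x u : ℝ} (hp : (t, x, u) ∈ W) (w : ℝ) :
    deriv (fun s => e.rhs s x u w) t = u * dt e.D t x ∧
    deriv (fun y => e.rhs t y u w) x
      = deriv e.A x * w + deriv e.B x * u * Real.log |u| + u * dx e.D t x ∧
    deriv (fun z => e.rhs t x z w) u
      = (u ^ 2)⁻¹ * w ^ 2 + e.B x * (Real.log |u| + 1) + e.D t x ∧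
    deriv (fun q => e.rhs t x u q) w = -2 * u⁻¹ * w + e.A x := by
  have hu : u ≠ 0 := he.domain.u_ne_zero _ hp
  obtain ⟨hDt, hDx⟩ := he.hasDerivAt_D (mem_projTX hp)
  have hA := (he.differentiableAt_A (mem_projX hp)).hasDerivAt
  have hB := (he.differentiableAt_B (mem_projX hp)).hasDerivAt
  simp only [WaveEq.rhs, Real.log_abs]
  refine ⟨?_, ?_, ?_, ?_⟩
  · exact ((hDt.const_mul u).const_add _).deriv
  · refine ((((hA.mul_const w).const_add _).add
      ((hB.mul_const u).mul_const (Real.log u))).add (hDx.const_mul u)).deriv.trans ?_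
    ring
  · refine ((((((hasDerivAt_inv hu).neg).mul_const (w ^ 2)).add_const (e.A x * w)).add
      (((hasDerivAt_id u).const_mul (e.B x)).mul (Real.hasDerivAt_log hu))).add
      ((hasDerivAt_id u).mul_const (e.D t x))).deriv.trans ?_
    simp only [id]
    field_simp
  · refine ((((((hasDerivAt_id w).pow 2).const_mul (-u⁻¹)).add
      ((hasDerivAt_id w).const_mul (e.A x))).add_const _).add_const _).deriv.trans ?_
    simp only [id]
    ring

/-- Lie's expression for the fields of the special form and the equations of the class: the
coefficients of `u_x`, `u ln|u|` and `u` are the left-hand sides of the determining equations. -/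
theorem InClass.lieJet_symField (he : InClass W e) (ha : ContDiffOn ℝ ∞ a (projX W)) {t x u : ℝ}
    (hp : (t, x, u) ∈ W) (v w r s : ℝ) :
    lieJet (symField c c₁ c₂ a) (t, x, u) (deriv (fun s => e.rhs s x u w) t)
      (deriv (fun y => e.rhs t y u w) x) (deriv (fun z => e.rhs t x z w) u)
      (deriv (fun q => e.rhs t x u q) w) v w (s + e.rhs t x u w) r s =
    -((c * e.A x + (c * x + c₂) * deriv e.A x) * w)
    - u * ((2 * c * e.B x + (c * x + c₂) * deriv e.B x) * Real.log |u|
      + (e.op a x + (c * t + c₁) * dt e.D t x + (c * x + c₂) * dx e.D t x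
        + 2 * c * e.D t x)) := by
  have hu : u ≠ 0 := he.domain.u_ne_zero _ hp
  obtain ⟨h1, h2, h3, h4⟩ := he.deriv_rhs hp w
  rw [WaveClass.lieJet_symField he.domain.isOpen ha hp, h1, h2, h3, h4]
  simp only [WaveEq.rhs, WaveEq.op]
  field_simp
  ring

theorem Determining.isSymmetry (he : InClass W e) (h : Determining W e c c₁ c₂ a) :
    IsSymmetry W e.rhs (symField c c₁ c₂ a) := by
  rw [isSymmetry_iff_lieJet he.domain.isOpen]
  refine ⟨contDiffOn_symField h.smooth, fun t x u hp v w r s => ?_⟩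
  rw [he.lieJet_symField h.smooth hp, h.eqA x (mem_projX hp), h.eqB x (mem_projX hp),
    h.eqD t x (mem_projTX hp)]
  ring

theorem lieJet_congr (hW : IsOpen W) {Q R : VF} (h : Set.EqOn Q R W) {p : Pt} (hp : p ∈ W)
    (Ft Fx Fu Fq v w F r s : ℝ) :
    lieJet Q p Ft Fx Fu Fq v w F r s = lieJet R p Ft Fx Fu Fq v w F r s := by
  have hT : Set.EqOn (cT Q) (cT R) W := fun q hq => by simp only [cT, h hq]
  have hX : Set.EqOn (cX Q) (cX R) W := fun q hq => by simp only [cX, h hq]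
  have hU : Set.EqOn (cU Q) (cU R) W := fun q hq => by simp only [cU, h hq]
  simp only [lieJet, pt_congr hW (pt_congr hW hT) hp, pt_congr hW (pt_congr hW hX) hp,
    pt_congr hW (pt_congr hW hU) hp, px_congr hW (px_congr hW hT) hp,
    px_congr hW (px_congr hW hX) hp, px_congr hW (px_congr hW hU) hp,
    pt_congr hW (pu_congr hW hT) hp, pt_congr hW (pu_congr hW hX) hp,
    pt_congr hW (pu_congr hW hU) hp, px_congr hW (pu_congr hW hT) hp,
    px_congr hW (pu_congr hW hX) hp, px_congr hW (pu_congr hW hU) hp,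
    pu_congr hW (pu_congr hW hT) hp, pu_congr hW (pu_congr hW hX) hp,
    pu_congr hW (pu_congr hW hU) hp, pt_congr hW hT hp, pt_congr hW hX hp,
    px_congr hW hT hp, px_congr hW hX hp, px_congr hW hU hp,
    pu_congr hW hT hp, pu_congr hW hX hp, pu_congr hW hU hp, hT hp, hX hp, hU hp]

/-- A symmetry of an equation of the class, as a field on the domain, has the special form: compare
coefficients of the polynomial in `u_t, u_x, u_tx, u_xx` to which Lie's criterion amounts, and
integrate the resulting equations for `τ`, `ξ`, `η`. -/
theorem IsSymmetry.eq_symField (he : InClass W e) {Q : VF} (hQ : IsSymmetry W e.rhs Q) :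
    ∃ (c c₁ c₂ : ℝ) (a : ℝ → ℝ), ContDiffOn ℝ ∞ a (projX W) ∧
      Set.EqOn Q (symField c c₁ c₂ a) W := by
  have hW := he.domain.isOpen
  have hWc := he.domain.isConnected.isPreconnected
  obtain ⟨hs, h⟩ := (isSymmetry_iff_lieJet hW).1 hQ
  have hT := contDiffOn_cT hs
  have hX := contDiffOn_cX hs
  have hU := contDiffOn_cU hs
  -- the coefficient of `u_tx`
  have tu : Set.EqOn (pu (cT Q)) (fun _ => 0) W := fun ⟨t, x, u⟩ hp => by
    linear_combination (norm := (simp only [lieJet]; ring))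
      (h t x u hp 0 1 1 0 - h t x u hp 0 1 0 0) / 2 - (h t x u hp 0 0 1 0 - h t x u hp 0 0 0 0) / 2
  have xu : Set.EqOn (pu (cX Q)) (fun _ => 0) W := fun ⟨t, x, u⟩ hp => by
    linear_combination (norm := (simp only [lieJet]; ring))
      -(h t x u hp 1 0 1 0 - h t x u hp 1 0 0 0) / 2 + (h t x u hp 0 0 1 0 - h t x u hp 0 0 0 0) / 2
  have txxt : Set.EqOn (px (cT Q)) (pt (cX Q)) W := fun ⟨t, x, u⟩ hp => by
    linear_combination (norm := (simp only [lieJet]; ring))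
      (h t x u hp 0 0 1 0 - h t x u hp 0 0 0 0) / 2
  -- the coefficient of `u_xx`
  have ttxx : Set.EqOn (pt (cT Q)) (px (cX Q)) W := fun ⟨t, x, u⟩ hp => by
    linear_combination (norm := (simp only [lieJet]; ring))
      -(h t x u hp 0 0 0 1 - h t x u hp 0 0 0 0) / 2
  have z : ∀ q : Pt, pt (fun _ => (0 : ℝ)) q = 0 ∧ px (fun _ => (0 : ℝ)) q = 0 ∧
    pu (fun _ => (0 : ℝ)) q = 0 := fun q => by simp
  have wT : Set.EqOn (pt (pt (cT Q))) (px (px (cT Q))) W := fun p hp => by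
    rw [pt_congr hW ttxx hp, pt_px hW hX hp, px_congr hW txxt hp]
  have wX : Set.EqOn (pt (pt (cX Q))) (px (px (cX Q))) W := fun p hp => by
    rw [← pt_congr hW txxt hp, pt_px hW hT hp, px_congr hW ttxx hp]
  -- the remaining condition, a polynomial in `u_t = v` and `u_x = w`
  have rem : ∀ t x u, (t, x, u) ∈ W → ∀ v w : ℝ,
      pt (pt (cU Q)) (t, x, u) + 2 * pt (pu (cU Q)) (t, x, u) * v
        + pu (pu (cU Q)) (t, x, u) * v ^ 2
        + (pu (cU Q) (t, x, u) - 2 * pt (cT Q) (t, x, u)) * e.rhs t x u w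
        - px (px (cU Q)) (t, x, u) - 2 * px (pu (cU Q)) (t, x, u) * w
        - pu (pu (cU Q)) (t, x, u) * w ^ 2 - cT Q (t, x, u) * (u * dt e.D t x)
        - cX Q (t, x, u) * (deriv e.A x * w + deriv e.B x * u * Real.log |u| + u * dx e.D t x)
        - cU Q (t, x, u) * ((u ^ 2)⁻¹ * w ^ 2 + e.B x * (Real.log |u| + 1) + e.D t x)
        - (px (cU Q) (t, x, u) + pu (cU Q) (t, x, u) * w - v * px (cT Q) (t, x, u)
          - w * pt (cT Q) (t, x, u)) * (-2 * u⁻¹ * w + e.A x) = 0 := by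
    intro t x u hp v w
    have h0 := h t x u hp v w 0 0
    obtain ⟨h1, h2, h3, h4⟩ := he.deriv_rhs hp w
    rw [h1, h2, h3, h4] at h0
    simp only [lieJet, tu hp, xu hp, pt_congr hW tu hp, pt_congr hW xu hp, px_congr hW tu hp,
      px_congr hW xu hp, pu_congr hW tu hp, pu_congr hW xu hp, z, wT hp, wX hp, ← ttxx hp,
      ← txxt hp] at h0
    linear_combination h0
  have uu : Set.EqOn (pu (pu (cU Q))) (fun _ => 0) W := fun ⟨t, x, u⟩ hp => by
    linear_combination (norm := (simp only [WaveEq.rhs]; ring))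
      (rem t x u hp 1 0 + rem t x u hp (-1) 0 - 2 * rem t x u hp 0 0) / 2
  have tx : Set.EqOn (px (cT Q)) (fun _ => 0) W := fun ⟨t, x, u⟩ hp => by
    have hu : u ≠ 0 := he.domain.u_ne_zero _ hp
    have : px (cT Q) (t, x, u) * u⁻¹ = 0 := by
      linear_combination (norm := (simp only [WaveEq.rhs]; ring))
        -((rem t x u hp 1 1 - rem t x u hp (-1) 1) / 2
          - (rem t x u hp 1 0 - rem t x u hp (-1) 0) / 2) / 2
    exact (mul_eq_zero.1 this).resolve_right (inv_ne_zero hu)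
  have utu : Set.EqOn (pt (pu (cU Q))) (fun _ => 0) W := fun ⟨t, x, u⟩ hp => by
    linear_combination (norm := (simp only [WaveEq.rhs]; ring))
      (rem t x u hp 1 0 - rem t x u hp (-1) 0) / 4 - e.A x / 2 * tx hp
  have lin : Set.EqOn (cU Q) (fun p => pu (cU Q) p * p.2.2) W := fun ⟨t, x, u⟩ hp => by
    have hu : u ≠ 0 := he.domain.u_ne_zero _ hp
    have h2 : pu (cU Q) (t, x, u) * u⁻¹ - cU Q (t, x, u) * (u ^ 2)⁻¹ = 0 := by
      linear_combination (norm := (simp only [WaveEq.rhs]; ring))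
        (rem t x u hp 0 1 + rem t x u hp 0 (-1) - 2 * rem t x u hp 0 0) / 2 + uu hp
    field_simp at h2
    simp only
    linarith
  have xt : Set.EqOn (pt (cX Q)) (fun _ => 0) W := fun p hp => (txxt hp).symm.trans (tx hp)
  -- integrate
  obtain ⟨c, hc⟩ := exists_const_of_partials hW hWc (contDiffOn_pt hW hT)
    (fun p hp => by rw [pt_congr hW ttxx hp, pt_px hW hX hp, px_congr hW xt hp, (z p).2.1])
    (fun p hp => by rw [← pt_px hW hT hp, pt_congr hW tx hp, (z p).1])
    (fun p hp => by rw [← pt_pu hW hT hp, pt_congr hW tu hp, (z p).1])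
  have lint : ∀ p : Pt, HasFDerivAt (fun q : Pt => c * q.1)
      (c • ContinuousLinearMap.fst ℝ ℝ (ℝ × ℝ)) p := fun p => hasFDerivAt_fst.const_mul c
  have linx : ∀ p : Pt, HasFDerivAt (fun q : Pt => c * q.2.1)
      (c • (ContinuousLinearMap.fst ℝ ℝ ℝ).comp (ContinuousLinearMap.snd ℝ ℝ (ℝ × ℝ))) p :=
    fun p => (hasFDerivAt_fst.comp p hasFDerivAt_snd).const_mul c
  have dT : ∀ p ∈ W, HasFDerivAt (cT Q) (fderiv ℝ (cT Q) p) p := fun p hp =>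
    (differentiableAt_of_smooth hW hT hp).hasFDerivAt
  have dX : ∀ p ∈ W, HasFDerivAt (cX Q) (fderiv ℝ (cX Q) p) p := fun p hp =>
    (differentiableAt_of_smooth hW hX hp).hasFDerivAt
  obtain ⟨c₁, hc₁⟩ := exists_const_of_partials hW hWc (G := fun p => cT Q p - c * p.1)
    (hT.sub (by fun_prop))
    (fun p hp => by
      rw [(partials_of_hasFDerivAt ((dT p hp).fun_sub (lint p))).1]
      simpa [sub_eq_zero, pt, px, pu] using hc p hp)
    (fun p hp => by
      rw [(partials_of_hasFDerivAt ((dT p hp).fun_sub (lint p))).2.1]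
      simpa [sub_eq_zero, pt, px, pu] using tx hp)
    (fun p hp => by
      rw [(partials_of_hasFDerivAt ((dT p hp).fun_sub (lint p))).2.2]
      simpa [sub_eq_zero, pt, px, pu] using tu hp)
  obtain ⟨c₂, hc₂⟩ := exists_const_of_partials hW hWc (G := fun p => cX Q p - c * p.2.1)
    (hX.sub (by fun_prop))
    (fun p hp => by
      rw [(partials_of_hasFDerivAt ((dX p hp).fun_sub (linx p))).1]
      simpa [sub_eq_zero, pt, px, pu] using xt hp)
    (fun p hp => by
      rw [(partials_of_hasFDerivAt ((dX p hp).fun_sub (linx p))).2.1]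
      simpa [sub_eq_zero, pt, px, pu] using (ttxx hp).symm.trans (hc p hp))
    (fun p hp => by
      rw [(partials_of_hasFDerivAt ((dX p hp).fun_sub (linx p))).2.2]
      simpa [sub_eq_zero, pt, px, pu] using xu hp)
  obtain ⟨a, ha, hGa⟩ := exists_fun_x he.domain (contDiffOn_pu hW hU) utu uu
  refine ⟨c, c₁, c₂, a, ha, fun p hp => ?_⟩
  have e1 : (Q p).1 = c * p.1 + c₁ := by linarith [hc₁ p hp]
  have e2 : (Q p).2.1 = c * p.2.1 + c₂ := by linarith [hc₂ p hp]
  have e3 : (Q p).2.2 = a p.2.1 * p.2.2 := by rw [← hGa p hp]; exact lin hp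
  exact Prod.ext e1 (Prod.ext e2 e3)

theorem exists_log_abs_ne {u : ℝ} (hu : u ≠ 0) {s : Set ℝ} (hs : s ∈ 𝓝 u) :
    ∃ u' ∈ s, Real.log |u'| ≠ Real.log |u| := by
  by_contra! h
  have h1 : (fun z => Real.log z) =ᶠ[𝓝 u] fun _ => Real.log u := by
    filter_upwards [hs] with z hz
    simpa using h z hz
  have h2 := h1.deriv_eq
  simp [hu] at h2

/-- The coefficients of `u_x`, of `u ln|u|` and of `u` in Lie's expression vanish separately. -/
theorem determining_of_eqOn (he : InClass W e) {Q : VF} (hQ : IsSymmetry W e.rhs Q)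
    (ha : ContDiffOn ℝ ∞ a (projX W)) (h : Set.EqOn Q (symField c c₁ c₂ a) W) :
    Determining W e c c₁ c₂ a := by
  have hW := he.domain.isOpen
  obtain ⟨-, hj⟩ := (isSymmetry_iff_lieJet hW).1 hQ
  have key : ∀ t x u, (t, x, u) ∈ W → ∀ w, -((c * e.A x + (c * x + c₂) * deriv e.A x) * w)
    - u * ((2 * c * e.B x + (c * x + c₂) * deriv e.B x) * Real.log |u|
      + (e.op a x + (c * t + c₁) * dt e.D t x + (c * x + c₂) * dx e.D t x
        + 2 * c * e.D t x)) = 0 := by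
    intro t x u hp w
    rw [← he.lieJet_symField ha hp 0 w 0 0, ← lieJet_congr hW h hp]
    exact hj t x u hp 0 w 0 0
  have hA : ∀ x ∈ projX W, c * e.A x + (c * x + c₂) * deriv e.A x = 0 := by
    rintro x ⟨⟨t, x, u⟩, hp, rfl⟩
    linarith [key t x u hp 0, key t x u hp 1]
  have key2 : ∀ t x u, (t, x, u) ∈ W →
      (2 * c * e.B x + (c * x + c₂) * deriv e.B x) * Real.log |u|
      + (e.op a x + (c * t + c₁) * dt e.D t x + (c * x + c₂) * dx e.D t x
        + 2 * c * e.D t x) = 0 := by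
    intro t x u hp
    have := key t x u hp 0
    have hu : u ≠ 0 := he.domain.u_ne_zero _ hp
    have h2 : u * ((2 * c * e.B x + (c * x + c₂) * deriv e.B x) * Real.log |u|
      + (e.op a x + (c * t + c₁) * dt e.D t x + (c * x + c₂) * dx e.D t x
        + 2 * c * e.D t x)) = 0 := by linear_combination -this
    exact (mul_eq_zero.1 h2).resolve_left hu
  have hB : ∀ x ∈ projX W, 2 * c * e.B x + (c * x + c₂) * deriv e.B x = 0 := by
    rintro x ⟨⟨t, x, u⟩, hp, rfl⟩
    have hu : u ≠ 0 := he.domain.u_ne_zero _ hp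
    have hcont : Continuous (fun z : ℝ => ((t, x, z) : Pt)) := by fun_prop
    obtain ⟨u', hu', hne⟩ := exists_log_abs_ne hu
      (hcont.continuousAt.preimage_mem_nhds (hW.mem_nhds hp))
    have h1 := key2 t x u hp
    have h2 := key2 t x u' hu'
    have h3 : (2 * c * e.B x + (c * x + c₂) * deriv e.B x)
        * (Real.log |u'| - Real.log |u|) = 0 := by linear_combination h2 - h1
    exact (mul_eq_zero.1 h3).resolve_right (sub_ne_zero.2 hne)
  refine ⟨ha, hA, hB, fun t x htx => ?_⟩
  obtain ⟨u, hp⟩ := exists_of_mem_projTX htx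
  have := key2 t x u hp
  rw [hB x (mem_projX hp)] at this
  linarith

/-- The symmetries of an equation of the class are the solutions of the determining equations. -/
theorem IsSymmetry.exists_determining (he : InClass W e) {Q : VF} (hQ : IsSymmetry W e.rhs Q) :
    ∃ (c c₁ c₂ : ℝ) (a : ℝ → ℝ), Determining W e c c₁ c₂ a ∧
      Set.EqOn Q (symField c c₁ c₂ a) W := by
  obtain ⟨c, c₁, c₂, a, ha, h⟩ := hQ.eq_symField he
  exact ⟨c, c₁, c₂, a, determining_of_eqOn he hQ ha h, h⟩

end Determining

/-! ### Linear second-order equations on an interval -/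

section LinearODE

variable {J : Set ℝ} {e : WaveEq}

/-- A smooth function on an open interval has a smooth antiderivative. -/
theorem exists_antideriv (hJ : IsOpen J) (hc : IsPreconnected J) {g : ℝ → ℝ}
    (hg : ContDiffOn ℝ ∞ g J) :
    ∃ G : ℝ → ℝ, ContDiffOn ℝ ∞ G J ∧ ∀ x ∈ J, HasDerivAt G (g x) x := by
  rcases J.eq_empty_or_nonempty with rfl | ⟨x₀, hx₀⟩
  · exact ⟨0, contDiffOn_empty, by simp⟩
  have hd : ∀ x ∈ J, HasDerivAt (fun x => ∫ s in x₀..x, g s) (g x) x := fun x hx => by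
    have hsub : Set.uIcc x₀ x ⊆ J := hc.ordConnected.uIcc_subset hx₀ hx
    exact intervalIntegral.integral_hasDerivAt_right
      (hg.continuousOn.mono hsub).intervalIntegrable
      (hg.continuousOn.stronglyMeasurableAtFilter hJ x hx)
      (hg.continuousOn.continuousAt (hJ.mem_nhds hx))
  refine ⟨_, ?_, hd⟩
  rw [contDiffOn_infty_iff_deriv_of_isOpen hJ]
  exact ⟨fun x hx => (hd x hx).differentiableAt.differentiableWithinAt,
    hg.congr fun x hx => (hd x hx).deriv⟩

theorem op_eq (hJ : IsOpen J) {h h' : ℝ → ℝ} (h1 : ∀ x ∈ J, HasDerivAt h (h' x) x) {x : ℝ}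
    (hx : x ∈ J) {d : ℝ} (h2 : HasDerivAt h' d x) :
    e.op h x = d + e.A x * h' x + e.B x * h x := by
  have e1 : deriv h =ᶠ[𝓝 x] h' := by
    filter_upwards [hJ.mem_nhds hx] with y hy using (h1 y hy).deriv
  rw [WaveEq.op, e1.deriv_eq, h2.deriv, e1.eq_of_nhds]

theorem op_congr (hJ : IsOpen J) {a b : ℝ → ℝ} (h : Set.EqOn a b J) {x : ℝ} (hx : x ∈ J) :
    e.op a x = e.op b x := by
  have h1 : a =ᶠ[𝓝 x] b := h.eventuallyEq_of_mem (hJ.mem_nhds hx)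
  rw [WaveEq.op, WaveEq.op, h1.deriv.deriv_eq, h1.deriv_eq, h1.eq_of_nhds]

theorem hasDerivAt_of_smooth (hJ : IsOpen J) {a : ℝ → ℝ} (ha : ContDiffOn ℝ ∞ a J) {x : ℝ}
    (hx : x ∈ J) : HasDerivAt a (deriv a x) x ∧ HasDerivAt (deriv a) (deriv (deriv a) x) x :=
  ⟨(differentiableAt_of_smooth hJ ha hx).hasDerivAt,
    (differentiableAt_of_smooth hJ (contDiffOn_deriv' hJ ha) hx).hasDerivAt⟩

theorem op_add (hJ : IsOpen J) {a b : ℝ → ℝ} (ha : ContDiffOn ℝ ∞ a J) (hb : ContDiffOn ℝ ∞ b J)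
    {x : ℝ} (hx : x ∈ J) : e.op (a + b) x = e.op a x + e.op b x := by
  rw [op_eq (e := e) hJ (h := a + b)
    (fun y hy => (hasDerivAt_of_smooth hJ ha hy).1.add (hasDerivAt_of_smooth hJ hb hy).1) hx
    ((hasDerivAt_of_smooth hJ ha hx).2.add (hasDerivAt_of_smooth hJ hb hx).2)]
  simp only [WaveEq.op, Pi.add_apply]
  ring

theorem op_const_smul (hJ : IsOpen J) {a : ℝ → ℝ} (k : ℝ) (ha : ContDiffOn ℝ ∞ a J)
    {x : ℝ} (hx : x ∈ J) : e.op (k • a) x = k * e.op a x := by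
  rw [op_eq (e := e) hJ (h := k • a)
    (fun y hy => (hasDerivAt_of_smooth hJ ha hy).1.const_smul k) hx
    ((hasDerivAt_of_smooth hJ ha hx).2.const_smul k)]
  simp only [WaveEq.op, Pi.smul_apply, smul_eq_mul]
  ring

/-- Solutions with vanishing initial data vanish, to the right of the initial point. -/
theorem eq_zero_of_op_right {A B a a' : ℝ → ℝ} {x₀ x : ℝ} (hx : x₀ ≤ x)
    (hA : ContinuousOn A (Set.Icc x₀ x)) (hB : ContinuousOn B (Set.Icc x₀ x))
    (h1 : ∀ y ∈ Set.Icc x₀ x, HasDerivAt a (a' y) y)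
    (h2 : ∀ y ∈ Set.Icc x₀ x, HasDerivAt a' (-(A y * a' y) - B y * a y) y)
    (h0 : a x₀ = 0) (h0' : a' x₀ = 0) : a x = 0 := by
  obtain ⟨CA, hCA⟩ := isCompact_Icc.exists_bound_of_continuousOn hA
  obtain ⟨CB, hCB⟩ := isCompact_Icc.exists_bound_of_continuousOn hB
  have h := eq_zero_of_abs_deriv_le_mul_abs_self_of_eq_zero_right
    (f := fun y => (a y, a' y)) (f' := fun y => (a' y, -(A y * a' y) - B y * a y))
    (K := 1 + CA + CB) (a := x₀) (b := x)
    (fun y hy => ((h1 y hy).prodMk (h2 y hy)).continuousAt.continuousWithinAt)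
    (fun y hy => ((h1 y ⟨hy.1, hy.2.le⟩).prodMk (h2 y ⟨hy.1, hy.2.le⟩)).hasDerivWithinAt)
    (by simp [h0, h0']) (fun y hy => ?_) x ⟨hx, le_rfl⟩
  · exact congrArg Prod.fst h
  · have hy' : y ∈ Set.Icc x₀ x := ⟨hy.1, hy.2.le⟩
    have b1 := hCA y hy'
    have b2 := hCB y hy'
    have n1 : ‖a y‖ ≤ ‖(a y, a' y)‖ := norm_fst_le (a y, a' y)
    have n2 : ‖a' y‖ ≤ ‖(a y, a' y)‖ := norm_snd_le (a y, a' y)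
    have nn := norm_nonneg (a y, a' y)
    have p1 : 0 ≤ CA := (norm_nonneg _).trans b1
    have p2 : 0 ≤ CB := (norm_nonneg _).trans b2
    refine max_le ?_ ?_
    · refine n2.trans ?_
      nlinarith
    · calc ‖-(A y * a' y) - B y * a y‖ ≤ ‖A y * a' y‖ + ‖B y * a y‖ := by
            refine (norm_sub_le _ _).trans ?_
            rw [norm_neg]
        _ = ‖A y‖ * ‖a' y‖ + ‖B y‖ * ‖a y‖ := by rw [norm_mul, norm_mul]
        _ ≤ CA * ‖(a y, a' y)‖ + CB * ‖(a y, a' y)‖ := by gcongr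
        _ ≤ _ := by nlinarith

/-- Uniqueness for the initial value problem of `a'' + A a' + B a = 0`. -/
theorem eq_zero_of_op (hJ : IsOpen J) (hc : IsPreconnected J) (hA : ContinuousOn e.A J)
    (hB : ContinuousOn e.B J) {a : ℝ → ℝ} (ha : ContDiffOn ℝ ∞ a J)
    (h : ∀ x ∈ J, e.op a x = 0) {x₀ : ℝ} (hx₀ : x₀ ∈ J) (h0 : a x₀ = 0) (h0' : deriv a x₀ = 0) :
    ∀ x ∈ J, a x = 0 := by
  intro x hx
  have hsub := hc.ordConnected.uIcc_subset hx₀ hx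
  have hd2 : ∀ y ∈ J, HasDerivAt (deriv a) (-(e.A y * deriv a y) - e.B y * a y) y := fun y hy =>
    (hasDerivAt_of_smooth hJ ha hy).2.congr_deriv (by have := h y hy; rw [WaveEq.op] at this; linarith)
  rcases le_total x₀ x with hle | hle
  · rw [Set.uIcc_of_le hle] at hsub
    exact eq_zero_of_op_right hle (hA.mono hsub) (hB.mono hsub)
      (fun y hy => (hasDerivAt_of_smooth hJ ha (hsub hy)).1) (fun y hy => hd2 y (hsub hy)) h0 h0'
  · rw [Set.uIcc_of_ge hle] at hsub
    have hneg : ∀ y ∈ Set.Icc (-x₀) (-x), -y ∈ J := fun y hy =>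
      hsub ⟨by linarith [hy.2], by linarith [hy.1]⟩
    have := eq_zero_of_op_right (A := fun y => -e.A (-y)) (B := fun y => e.B (-y))
      (a := fun y => a (-y)) (a' := fun y => -deriv a (-y)) (neg_le_neg hle)
      ((hA.comp continuousOn_neg hneg).neg) (hB.comp continuousOn_neg hneg)
      (fun y hy => by
        have := (hasDerivAt_of_smooth hJ ha (hneg y hy)).1.comp y (hasDerivAt_neg y)
        exact this.congr_deriv (by ring))
      (fun y hy => by
        have := ((hd2 _ (hneg y hy)).comp y (hasDerivAt_neg y)).neg
        exact this.congr_deriv (by ring))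
      (by simpa using h0) (by simpa using h0')
    simpa using this

/-- A fundamental pair of solutions of `a'' + A a' + B a = 0` on `J`. -/
structure FundPair (J : Set ℝ) (e : WaveEq) (h₁ h₂ : ℝ → ℝ) : Prop where
  smooth₁ : ContDiffOn ℝ ∞ h₁ J
  smooth₂ : ContDiffOn ℝ ∞ h₂ J
  op₁ : ∀ x ∈ J, e.op h₁ x = 0
  op₂ : ∀ x ∈ J, e.op h₂ x = 0
  wronskian : ∀ x ∈ J, h₁ x * deriv h₂ x - deriv h₁ x * h₂ x ≠ 0

variable {h₁ h₂ : ℝ → ℝ}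

/-- Every solution is a combination of a fundamental pair. -/
theorem FundPair.exists_comb (H : FundPair J e h₁ h₂) (hJ : IsOpen J) (hc : IsPreconnected J)
    {a : ℝ → ℝ} (ha : ContDiffOn ℝ ∞ a J) (h : ∀ x ∈ J, e.op a x = 0) :
    ∃ α β : ℝ, ∀ x ∈ J, a x = α * h₁ x + β * h₂ x := by
  have D1 := fun {x} (hx : x ∈ J) => hasDerivAt_of_smooth hJ H.smooth₁ hx
  have D2 := fun {x} (hx : x ∈ J) => hasDerivAt_of_smooth hJ H.smooth₂ hx
  have Da := fun {x} (hx : x ∈ J) => hasDerivAt_of_smooth hJ ha hx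
  -- Cramer's rule for `a = α h₁ + β h₂`, `a' = α h₁' + β h₂'`
  have key : ∀ g : ℝ → ℝ, ContDiffOn ℝ ∞ g J → (∀ x ∈ J, e.op g x = 0) → ∃ k, ∀ x ∈ J,
      (a x * deriv g x - deriv a x * g x) / (h₁ x * deriv h₂ x - deriv h₁ x * h₂ x) = k := by
    intro g hg hgo
    have hd : ∀ x ∈ J, HasDerivAt (fun x => (a x * deriv g x - deriv a x * g x) /
        (h₁ x * deriv h₂ x - deriv h₁ x * h₂ x)) 0 x := fun x hx => by
      have Dg := hasDerivAt_of_smooth hJ hg hx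
      have := ((((Da hx).1.mul Dg.2).sub ((Da hx).2.mul Dg.1)).fun_div
        (((D1 hx).1.mul (D2 hx).2).sub ((D1 hx).2.mul (D2 hx).1)) (H.wronskian x hx))
      refine this.congr_deriv ?_
      rw [div_eq_zero_iff]
      left
      have e1 := H.op₁ x hx
      have e2 := H.op₂ x hx
      have e3 := h x hx
      have e4 := hgo x hx
      simp only [WaveEq.op] at e1 e2 e3 e4
      simp only [Pi.sub_apply, Pi.mul_apply]
      linear_combination (h₁ x * deriv h₂ x - deriv h₁ x * h₂ x) * (a x * e4 - g x * e3)
        - (a x * deriv g x - deriv a x * g x) * (h₁ x * e2 - h₂ x * e1)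
    exact hJ.exists_is_const_of_deriv_eq_zero hc
      (fun x hx => (hd x hx).differentiableAt.differentiableWithinAt) fun x hx => (hd x hx).deriv
  obtain ⟨α, hα⟩ := key h₂ H.smooth₂ H.op₂
  obtain ⟨β, hβ⟩ := key h₁ H.smooth₁ H.op₁
  refine ⟨α, -β, fun x hx => ?_⟩
  rw [← hα x hx, ← hβ x hx]
  have := H.wronskian x hx
  generalize hw : h₁ x * deriv h₂ x - deriv h₁ x * h₂ x = w at *
  field_simp
  rw [← hw]
  ring

/-- A fundamental pair is linearly independent on every nonempty interval. -/
theorem FundPair.eq_zero_of_comb (H : FundPair J e h₁ h₂) (hJ : IsOpen J) (hne : J.Nonempty)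
    {α β : ℝ} (h : ∀ x ∈ J, α * h₁ x + β * h₂ x = 0) : α = 0 ∧ β = 0 := by
  obtain ⟨x, hx⟩ := hne
  have h0 := h x hx
  have h1 : α * deriv h₁ x + β * deriv h₂ x = 0 := by
    have hd := ((hasDerivAt_of_smooth hJ H.smooth₁ hx).1.const_mul α).fun_add
      ((hasDerivAt_of_smooth hJ H.smooth₂ hx).1.const_mul β)
    have hz : (fun x => α * h₁ x + β * h₂ x) =ᶠ[𝓝 x] fun _ => 0 := by
      filter_upwards [hJ.mem_nhds hx] with y hy using h y hy
    rw [← hd.deriv, hz.deriv_eq, deriv_const]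
  have hw := H.wronskian x hx
  constructor
  · refine (mul_eq_zero.1 (?_ : α * (h₁ x * deriv h₂ x - deriv h₁ x * h₂ x) = 0)).resolve_right hw
    linear_combination deriv h₂ x * h0 - h₂ x * h1
  · refine (mul_eq_zero.1 (?_ : β * (h₁ x * deriv h₂ x - deriv h₁ x * h₂ x) = 0)).resolve_right hw
    linear_combination h₁ x * h1 - deriv h₁ x * h0

/-- Variation of constants. -/
theorem FundPair.exists_particular (H : FundPair J e h₁ h₂) (hJ : IsOpen J)
    (hc : IsPreconnected J) {g : ℝ → ℝ} (hg : ContDiffOn ℝ ∞ g J) :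
    ∃ θ : ℝ → ℝ, ContDiffOn ℝ ∞ θ J ∧ ∀ x ∈ J, e.op θ x = g x := by
  have D1 := fun {x} (hx : x ∈ J) => hasDerivAt_of_smooth hJ H.smooth₁ hx
  have D2 := fun {x} (hx : x ∈ J) => hasDerivAt_of_smooth hJ H.smooth₂ hx
  have hw : ContDiffOn ℝ ∞ (fun x => h₁ x * deriv h₂ x - deriv h₁ x * h₂ x) J :=
    (H.smooth₁.mul (contDiffOn_deriv' hJ H.smooth₂)).sub
      ((contDiffOn_deriv' hJ H.smooth₁).mul H.smooth₂)
  obtain ⟨I1, sI1, dI1⟩ := exists_antideriv hJ hc ((H.smooth₁.mul hg).div hw H.wronskian)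
  obtain ⟨I2, sI2, dI2⟩ := exists_antideriv hJ hc ((H.smooth₂.mul hg).div hw H.wronskian)
  refine ⟨fun x => h₂ x * I1 x - h₁ x * I2 x, (H.smooth₂.mul sI1).sub (H.smooth₁.mul sI2),
    fun x hx => ?_⟩
  have hd1 : ∀ y ∈ J, HasDerivAt (fun x => h₂ x * I1 x - h₁ x * I2 x)
      (deriv h₂ y * I1 y - deriv h₁ y * I2 y) y := fun y hy => by
    refine (((D2 hy).1.fun_mul (dI1 y hy)).fun_sub ((D1 hy).1.fun_mul (dI2 y hy))).congr_deriv ?_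
    simp only [Pi.div_apply]
    ring
  have hd2 := ((D2 hx).2.fun_mul (dI1 x hx)).fun_sub ((D1 hx).2.fun_mul (dI2 x hx))
  rw [op_eq hJ hd1 hx hd2]
  have e1 := H.op₁ x hx
  have e2 := H.op₂ x hx
  have e3 := H.wronskian x hx
  simp only [WaveEq.op] at e1 e2
  have e4 : deriv h₂ x * (h₁ x * g x / (h₁ x * deriv h₂ x - deriv h₁ x * h₂ x))
      - deriv h₁ x * (h₂ x * g x / (h₁ x * deriv h₂ x - deriv h₁ x * h₂ x)) = g x := by
    generalize hw : h₁ x * deriv h₂ x - deriv h₁ x * h₂ x = w at *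
    field_simp
    rw [← hw]
    ring
  simp only [Pi.div_apply]
  linear_combination I1 x * e2 - I2 x * e1 + e4

end LinearODE

/-! ### The dimension of the symmetry algebra -/

section Dimension

variable {W : Set Pt} {e : WaveEq}

theorem Determining.add (hW : IsOpen W) {c c₁ c₂ c' c₁' c₂' : ℝ} {a a' : ℝ → ℝ}
    (h : Determining W e c c₁ c₂ a) (h' : Determining W e c' c₁' c₂' a') :
    Determining W e (c + c') (c₁ + c₁') (c₂ + c₂') (a + a') where
  smooth := h.smooth.add h'.smooth
  eqA x hx := by linear_combination h.eqA x hx + h'.eqA x hx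
  eqB x hx := by linear_combination h.eqB x hx + h'.eqB x hx
  eqD t x htx := by
    rw [op_add (isOpen_projX hW) h.smooth h'.smooth (mem_projX_of_projTX htx)]
    linear_combination h.eqD t x htx + h'.eqD t x htx

theorem Determining.smul (hW : IsOpen W) (k : ℝ) {c c₁ c₂ : ℝ} {a : ℝ → ℝ}
    (h : Determining W e c c₁ c₂ a) : Determining W e (k * c) (k * c₁) (k * c₂) (k • a) where
  smooth := h.smooth.const_smul k
  eqA x hx := by linear_combination k * h.eqA x hx
  eqB x hx := by linear_combination k * h.eqB x hx
  eqD t x htx := by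
    rw [op_const_smul (isOpen_projX hW) k h.smooth (mem_projX_of_projTX htx)]
    linear_combination k * h.eqD t x htx

theorem Determining.congr (hW : IsOpen W) {c c₁ c₂ : ℝ} {a b : ℝ → ℝ}
    (h : Determining W e c c₁ c₂ a) (hab : Set.EqOn a b (projX W)) :
    Determining W e c c₁ c₂ b where
  smooth := h.smooth.congr hab.symm
  eqA := h.eqA
  eqB := h.eqB
  eqD t x htx := by
    rw [← op_congr (isOpen_projX hW) hab (mem_projX_of_projTX htx)]
    exact h.eqD t x htx

theorem Determining.zero : Determining W e 0 0 0 0 where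
  smooth := contDiffOn_const
  eqA x hx := by ring
  eqB x hx := by ring
  eqD t x htx := by
    have : deriv (0 : ℝ → ℝ) = 0 := deriv_const' 0
    rw [WaveEq.op, this, this]
    simp

/-- The solutions `(c, c₁, c₂, a)` of the determining equations, with `a` normalized to vanish
outside of the projection of the domain. -/
def detSpace (he : InClass W e) : Submodule ℝ (ℝ × ℝ × ℝ × (ℝ → ℝ)) where
  carrier := {q | Determining W e q.1 q.2.1 q.2.2.1 q.2.2.2 ∧ ∀ x ∉ projX W, q.2.2.2 x = 0}
  add_mem' {q q'} h h' := ⟨h.1.add he.domain.isOpen h'.1, fun x hx => by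
    simp [h.2 x hx, h'.2 x hx]⟩
  zero_mem' := ⟨Determining.zero, fun _ _ => rfl⟩
  smul_mem' k q h := ⟨h.1.smul he.domain.isOpen k, fun x hx => by simp [h.2 x hx]⟩

/-- The vector field on the domain given by a solution of the determining equations. -/
def detField (he : InClass W e) : detSpace he →ₗ[ℝ] (W → Pt) where
  toFun q := restr W (symField q.1.1 q.1.2.1 q.1.2.2.1 q.1.2.2.2)
  map_add' q q' := by
    funext p
    simp only [restr, symField, Pi.add_apply, Submodule.coe_add, Prod.fst_add, Prod.snd_add,
      Prod.mk_add_mk]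
    refine Prod.ext ?_ (Prod.ext ?_ ?_) <;> simp only <;> ring
  map_smul' k q := by
    funext p
    simp only [restr, symField, Pi.smul_apply, Submodule.coe_smul, Prod.smul_fst, Prod.smul_snd,
      Prod.smul_mk, smul_eq_mul, RingHom.id_apply]
    refine Prod.ext ?_ (Prod.ext ?_ ?_) <;> simp only <;> ring

theorem exists_shift_t (hW : IsOpen W) {t x u : ℝ} (hp : (t, x, u) ∈ W) :
    ∃ δ ≠ 0, (t + δ, x, u) ∈ W := by
  have hc : Continuous (fun δ : ℝ => ((t + δ, x, u) : Pt)) := by fun_prop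
  have h := hc.continuousAt.preimage_mem_nhds (x := 0) (hW.mem_nhds (by simpa using hp))
  obtain ⟨ε, hε, hb⟩ := Metric.mem_nhds_iff.1 h
  exact ⟨ε / 2, by positivity, hb (by simp [abs_of_pos hε, hε])⟩

/-- The coefficients `c, c₁, c₂` and the values of `a` are determined by the vector field. -/
theorem symField_eq_zero (hW : IsAdmissible W) {c c₁ c₂ : ℝ} {a : ℝ → ℝ}
    (h : ∀ p ∈ W, symField c c₁ c₂ a p = 0) :
    c = 0 ∧ c₁ = 0 ∧ c₂ = 0 ∧ ∀ x ∈ projX W, a x = 0 := by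
  obtain ⟨⟨t, x, u⟩, hp⟩ := hW.isConnected.nonempty
  obtain ⟨δ, hδ, hp'⟩ := exists_shift_t hW.isOpen hp
  have h1 := h _ hp
  have h2 := h _ hp'
  simp only [symField, Prod.mk_eq_zero] at h1 h2
  have hc : c = 0 := by
    refine (mul_eq_zero.1 (?_ : c * δ = 0)).resolve_right hδ
    linarith [h1.1, h2.1]
  subst hc
  refine ⟨rfl, by linarith [h1.1], by linarith [h1.2.1], ?_⟩
  rintro y ⟨p, hp, rfl⟩
  have h3 := h p hp
  simp only [symField, Prod.mk_eq_zero] at h3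
  exact (mul_eq_zero.1 h3.2.2).resolve_right (hW.u_ne_zero p hp)

theorem detField_injective (he : InClass W e) : Function.Injective (detField he) := by
  rw [← LinearMap.ker_eq_bot, LinearMap.ker_eq_bot']
  rintro ⟨⟨c, c₁, c₂, a⟩, h1, h2⟩ h
  obtain ⟨h3, h4, h5, h6⟩ := symField_eq_zero (c := c) (c₁ := c₁) (c₂ := c₂) (a := a) he.domain
    fun p hp => congrFun h ⟨p, hp⟩
  refine Subtype.ext (Prod.ext h3 (Prod.ext h4 (Prod.ext h5 (funext fun x => ?_))))
  by_cases hx : x ∈ projX W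
  · exact h6 x hx
  · exact h2 x hx

theorem exists_mem_detSpace (he : InClass W e) {c c₁ c₂ : ℝ} {a : ℝ → ℝ}
    (h : Determining W e c c₁ c₂ a) :
    ∃ b : ℝ → ℝ, (c, c₁, c₂, b) ∈ detSpace he ∧ Set.EqOn a b (projX W) := by
  classical
  have hab : Set.EqOn a ((projX W).indicator a) (projX W) := fun x hx =>
    (Set.indicator_of_mem hx a).symm
  exact ⟨(projX W).indicator a, ⟨h.congr he.domain.isOpen hab,
    fun x hx => Set.indicator_of_notMem hx a⟩, hab⟩

theorem range_detField (he : InClass W e) :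
    LinearMap.range (detField he) = symmetryAlgebra W e.rhs := by
  apply le_antisymm
  · rintro _ ⟨q, rfl⟩
    exact Submodule.subset_span ⟨_, q.2.1.isSymmetry he, rfl⟩
  · refine Submodule.span_le.2 ?_
    rintro _ ⟨Q, hQ, rfl⟩
    obtain ⟨c, c₁, c₂, a, hd, hE⟩ := hQ.exists_determining he
    obtain ⟨b, hb, hab⟩ := exists_mem_detSpace he hd
    refine ⟨⟨_, hb⟩, ?_⟩
    funext p
    simp only [detField, LinearMap.coe_mk, AddHom.coe_mk, restr, symField]
    rw [hE p.2, ← hab (mem_projX p.2)]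
    rfl

theorem symDim_eq_rank (he : InClass W e) : symDim W e.rhs = Module.rank ℝ (detSpace he) := by
  rw [symDim, ← range_detField he]
  exact (LinearEquiv.ofInjective _ (detField_injective he)).rank_eq.symm

/-- The parameters `(c, c₁, c₂)` of a solution of the determining equations. -/
def detParam (he : InClass W e) : detSpace he →ₗ[ℝ] ℝ × ℝ × ℝ where
  toFun q := (q.1.1, q.1.2.1, q.1.2.2.1)
  map_add' _ _ := rfl
  map_smul' _ _ := rfl

/-- The triples `(c, c₁, c₂)` for which `(c t + c₁) ∂_t + (c x + c₂) ∂_x` extends to a symmetry. -/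
def genSpace (he : InClass W e) : Submodule ℝ (ℝ × ℝ × ℝ) := LinearMap.range (detParam he)

theorem mem_genSpace (he : InClass W e) {c c₁ c₂ : ℝ} :
    (c, c₁, c₂) ∈ genSpace he ↔ ∃ a, Determining W e c c₁ c₂ a := by
  constructor
  · rintro ⟨⟨⟨c', c₁', c₂', a⟩, h, h'⟩, hq⟩
    obtain ⟨rfl, hq'⟩ := Prod.ext_iff.1 hq
    obtain ⟨rfl, rfl⟩ := Prod.ext_iff.1 hq'
    exact ⟨a, h⟩
  · rintro ⟨a, h⟩
    obtain ⟨b, hb, -⟩ := exists_mem_detSpace he h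
    exact ⟨⟨_, hb⟩, rfl⟩

theorem symDim_eq_add (he : InClass W e) : symDim W e.rhs =
    (Module.finrank ℝ (genSpace he) : Cardinal) +
      Module.rank ℝ (LinearMap.ker (detParam he)) := by
  rw [symDim_eq_rank he, ← LinearMap.rank_range_add_rank_ker (detParam he), genSpace,
    Module.finrank_eq_rank]

theorem finrank_genSpace_le (he : InClass W e) : Module.finrank ℝ (genSpace he) ≤ 3 :=
  (Submodule.finrank_le _).trans (by simp)

theorem op_of_mem_ker (he : InClass W e) {q : detSpace he}
    (hq : q ∈ LinearMap.ker (detParam he)) : ∀ x ∈ projX W, e.op q.1.2.2.2 x = 0 := by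
  obtain ⟨h1, h2⟩ := Prod.ext_iff.1 (LinearMap.mem_ker.1 hq)
  obtain ⟨h2, h3⟩ := Prod.ext_iff.1 h2
  replace h1 : q.1.1 = 0 := h1
  replace h2 : q.1.2.1 = 0 := h2
  replace h3 : q.1.2.2.1 = 0 := h3
  intro x hx
  obtain ⟨t, ht⟩ := exists_of_mem_projX hx
  have := q.2.1.eqD t x ht
  rw [h1, h2, h3] at this
  linarith

theorem rank_le_two_of_injOn {V : Type} [AddCommGroup V] [Module ℝ V] (K : Submodule ℝ V)
    (ev : V →ₗ[ℝ] ℝ × ℝ) (h : ∀ q ∈ K, ev q = 0 → q = 0) : Module.rank ℝ K ≤ 2 := by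
  have hinj : Function.Injective (ev ∘ₗ K.subtype) := by
    rw [← LinearMap.ker_eq_bot, LinearMap.ker_eq_bot']
    exact fun q hq => Subtype.ext (h q q.2 hq)
  refine (LinearMap.rank_le_of_injective _ hinj).trans ?_
  rw [← Module.finrank_eq_rank]
  simp

theorem two_le_rank_of_pair {V : Type} [AddCommGroup V] [Module ℝ V] (K : Submodule ℝ V)
    {v w : V} (hv : v ∈ K) (hw : w ∈ K) (h : ∀ s t : ℝ, s • v + t • w = 0 → s = 0 ∧ t = 0) :
    2 ≤ Module.rank ℝ K := by
  have hli : LinearIndependent ℝ ![(⟨v, hv⟩ : K), ⟨w, hw⟩] :=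
    LinearIndependent.pair_iff.2 fun s t hst => h s t (congrArg Subtype.val hst)
  simpa using hli.cardinal_le_rank

/-- The symmetries `a(x) u ∂_u` form a space of dimension at most two. -/
theorem rank_ker_le (he : InClass W e) : Module.rank ℝ (LinearMap.ker (detParam he)) ≤ 2 := by
  have hW := he.domain.isOpen
  have hJ := isOpen_projX hW
  obtain ⟨x₀, hx₀⟩ : (projX W).Nonempty := he.domain.isConnected.nonempty.image _
  have D := fun q : detSpace he => (hasDerivAt_of_smooth hJ q.2.1.smooth hx₀).1
  let ev : detSpace he →ₗ[ℝ] ℝ × ℝ :=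
    { toFun := fun q => (q.1.2.2.2 x₀, deriv q.1.2.2.2 x₀)
      map_add' := fun q q' => Prod.ext rfl ((D q).add (D q')).deriv
      map_smul' := fun k q => Prod.ext rfl ((D q).const_smul k).deriv }
  refine rank_le_two_of_injOn _ ev fun q hq h => ?_
  obtain ⟨h1, h2⟩ := Prod.ext_iff.1 h
  have h3 := eq_zero_of_op hJ (isPreconnected_projX he.domain.isConnected.isPreconnected)
    he.smooth_A.continuousOn he.smooth_B.continuousOn q.2.1.smooth (op_of_mem_ker he hq)
    hx₀ h1 h2
  obtain ⟨e1, e2⟩ := Prod.ext_iff.1 (LinearMap.mem_ker.1 hq)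
  obtain ⟨e2, e3⟩ := Prod.ext_iff.1 e2
  refine Subtype.ext (Prod.ext e1 (Prod.ext e2 (Prod.ext e3 (funext fun x => ?_))))
  by_cases hx : x ∈ projX W
  · exact h3 x hx
  · exact q.2.2 x hx

theorem symDim_le_five (he : InClass W e) : symDim W e.rhs ≤ 5 := by
  rw [symDim_eq_add he]
  have h : ((Module.finrank ℝ (genSpace he) : ℕ) : Cardinal) ≤ (3 : ℕ) :=
    Nat.cast_le.2 (finrank_genSpace_le he)
  refine (add_le_add h (rank_ker_le he)).trans ?_
  norm_num

theorem two_le_finrank_genSpace (he : InClass W e) (h : symDim W e.rhs = 4) :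
    2 ≤ Module.finrank ℝ (genSpace he) := by
  by_contra! hlt
  have h1 : ((Module.finrank ℝ (genSpace he) : ℕ) : Cardinal) ≤ (1 : ℕ) :=
    Nat.cast_le.2 (by omega)
  have := add_le_add h1 (rank_ker_le he)
  rw [← symDim_eq_add he, h] at this
  norm_num at this

theorem genSpace_eq_top (he : InClass W e) (h : 4 < symDim W e.rhs) : genSpace he = ⊤ := by
  apply Submodule.eq_top_of_finrank_eq
  by_contra hne
  have h3 := finrank_genSpace_le he
  have e3 : Module.finrank ℝ (ℝ × ℝ × ℝ) = 3 := by simp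
  have h1 : ((Module.finrank ℝ (genSpace he) : ℕ) : Cardinal) ≤ (2 : ℕ) :=
    Nat.cast_le.2 (by omega)
  have := add_le_add h1 (rank_ker_le he)
  rw [← symDim_eq_add he] at this
  exact absurd (h.trans_le this) (by norm_num)

/-- If the equation `a'' + A a' + B a = 0` has a fundamental pair, then the symmetries `a(x) u ∂_u`
form a space of dimension two. -/
theorem two_le_rank_ker (he : InClass W e) {h₁ h₂ : ℝ → ℝ} (H : FundPair (projX W) e h₁ h₂) :
    2 ≤ Module.rank ℝ (LinearMap.ker (detParam he)) := by
  have hJ := isOpen_projX he.domain.isOpen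
  have hne : (projX W).Nonempty := he.domain.isConnected.nonempty.image _
  have hd : ∀ h : ℝ → ℝ, ContDiffOn ℝ ∞ h (projX W) → (∀ x ∈ projX W, e.op h x = 0) →
      Determining W e 0 0 0 h := fun h hs ho =>
    ⟨hs, fun x _ => by ring, fun x _ => by ring, fun t x htx => by
      rw [ho x (mem_projX_of_projTX htx)]; ring⟩
  obtain ⟨b₁, hb₁, e₁⟩ := exists_mem_detSpace he (hd h₁ H.smooth₁ H.op₁)
  obtain ⟨b₂, hb₂, e₂⟩ := exists_mem_detSpace he (hd h₂ H.smooth₂ H.op₂)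
  refine two_le_rank_of_pair (LinearMap.ker (detParam he)) (v := ⟨_, hb₁⟩) (w := ⟨_, hb₂⟩)
    (LinearMap.mem_ker.2 rfl) (LinearMap.mem_ker.2 rfl) fun s t hst => ?_
  refine H.eq_zero_of_comb hJ hne fun x hx => ?_
  have := congrFun (congrArg (fun q : detSpace he => q.1.2.2.2) hst) x
  rw [e₁ hx, e₂ hx]
  exact this

theorem symDim_eq_five (he : InClass W e) (hS : genSpace he = ⊤) {h₁ h₂ : ℝ → ℝ}
    (H : FundPair (projX W) e h₁ h₂) : symDim W e.rhs = 5 := by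
  rw [symDim_eq_add he, hS, le_antisymm (rank_ker_le he) (two_le_rank_ker he H)]
  simp only [finrank_top, Module.finrank_prod, Module.finrank_self]
  norm_num

theorem IsMaximalAlgebra.symDim_eq {F : Rhs} {n : ℕ} {Q : Fin n → VF}
    (h : IsMaximalAlgebra W F Q) : symDim W F = n := by
  have : symmetryAlgebra W F = Submodule.span ℝ (Set.range fun i => restr W (Q i)) := by
    apply le_antisymm
    · refine Submodule.span_le.2 ?_
      rintro _ ⟨R, hR, rfl⟩
      exact h.maximal R hR
    · refine Submodule.span_le.2 ?_
      rintro _ ⟨i, rfl⟩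
      exact Submodule.subset_span ⟨_, h.symmetry i, rfl⟩
  rw [symDim, this, rank_span h.indep, Cardinal.mk_range_eq _ h.indep.injective]
  simp

end Dimension

/-! ### The equivalence criterion -/

section Equivalence

/-- Iterated partial derivatives of a smooth function on an open set of the plane. -/
theorem hasDerivAt_of_smoothOn₂ {U : Set (ℝ × ℝ)} (hU : IsOpen U) {Y : ℝ → ℝ → ℝ}
    (hY : ContDiffOn ℝ ∞ (fun p : ℝ × ℝ => Y p.1 p.2) U) {t x : ℝ} (h : (t, x) ∈ U) :
    HasDerivAt (fun s => Y s x) (dt Y t x) t ∧ HasDerivAt (fun y => Y t y) (dx Y t x) x := by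
  have hd := (differentiableAt_of_smooth hU hY h).hasFDerivAt
  have h1 := hd.comp_hasDerivAt t ((hasDerivAt_id t).prodMk (hasDerivAt_const t x))
  have h2 := hd.comp_hasDerivAt x ((hasDerivAt_const x t).prodMk (hasDerivAt_id x))
  exact ⟨h1.differentiableAt.hasDerivAt, h2.differentiableAt.hasDerivAt⟩

theorem contDiffOn_dt_dx {U : Set (ℝ × ℝ)} (hU : IsOpen U) {Y : ℝ → ℝ → ℝ}
    (hY : ContDiffOn ℝ ∞ (fun p : ℝ × ℝ => Y p.1 p.2) U) :
    ContDiffOn ℝ ∞ (fun p : ℝ × ℝ => dt Y p.1 p.2) U ∧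
      ContDiffOn ℝ ∞ (fun p : ℝ × ℝ => dx Y p.1 p.2) U := by
  constructor
  · refine (contDiffOn_fderiv_apply hU hY (1, 0)).congr fun p hp => ?_
    have hd := (differentiableAt_of_smooth hU hY hp).hasFDerivAt
    exact (hd.comp_hasDerivAt p.1 ((hasDerivAt_id p.1).prodMk (hasDerivAt_const p.1 p.2))).deriv
  · refine (contDiffOn_fderiv_apply hU hY (0, 1)).congr fun p hp => ?_
    have hd := (differentiableAt_of_smooth hU hY hp).hasFDerivAt
    exact (hd.comp_hasDerivAt p.2 ((hasDerivAt_const p.2 p.1).prodMk (hasDerivAt_id p.2))).deriv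

theorem deriv_comp_affine (h : ℝ → ℝ) (k k₁ s : ℝ) :
    deriv (fun s => h ((s - k₁) / k)) s = k⁻¹ * deriv h ((s - k₁) / k) := by
  have h1 := deriv_comp_sub_const (f := fun z => h (z / k)) (x := s) k₁
  have h2 := deriv_comp_mul_left (𝕜 := ℝ) k⁻¹ h (s - k₁)
  simp only [div_eq_inv_mul, smul_eq_mul] at h1 h2 ⊢
  rw [h1, h2]

variable {k k₁ k₂ ε : ℝ} {X : ℝ → ℝ} {Y f : ℝ → ℝ → ℝ}

theorem dt_comp_affine (G : ℝ → ℝ → ℝ) :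
    dt (fun s y => G ((s - k₁) / k) ((y - k₂) / (ε * k)))
      = fun s y => k⁻¹ * dt G ((s - k₁) / k) ((y - k₂) / (ε * k)) := by
  funext s y
  exact deriv_comp_affine (fun z => G z ((y - k₂) / (ε * k))) k k₁ s

theorem dx_comp_affine (G : ℝ → ℝ → ℝ) :
    dx (fun s y => G ((s - k₁) / k) ((y - k₂) / (ε * k)))
      = fun s y => (ε * k)⁻¹ * dx G ((s - k₁) / k) ((y - k₂) / (ε * k)) := by
  funext s y
  exact deriv_comp_affine (fun z => G ((s - k₁) / k) z) (ε * k) k₂ y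

theorem dt_const_mul (c : ℝ) (G : ℝ → ℝ → ℝ) : dt (fun s y => c * G s y) =
    fun s y => c * dt G s y := by
  funext s y
  exact deriv_const_mul_field c

theorem dx_const_mul (c : ℝ) (G : ℝ → ℝ → ℝ) : dx (fun s y => c * G s y) =
    fun s y => c * dx G s y := by
  funext s y
  exact deriv_const_mul_field c

/-- The 2-jet of the transformed function. -/
theorem jet_transformed {W : Set Pt} (hW : IsOpen W) (hk : k ≠ 0) (hε : ε = 1 ∨ ε = -1)
    (hX : ContDiffOn ℝ ∞ X (projX W)) (hY : ContDiffOn ℝ ∞ (fun p : ℝ × ℝ => Y p.1 p.2) (projTX W))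
    (hf : Smooth₂ f) {t x : ℝ} (hp : (t, x, f t x) ∈ W) :
    let g := transformed k k₁ k₂ ε X Y f
    let s := k * t + k₁
    let y := ε * k * x + k₂
    g s y = X x * f t x + Y t x ∧
    dx g s y = (deriv X x * f t x + X x * dx f t x + dx Y t x) * (ε * k)⁻¹ ∧
    dt (dt g) s y = (X x * dt (dt f) t x + dt (dt Y) t x) * (k ^ 2)⁻¹ ∧
    dx (dx g) s y = (deriv (deriv X) x * f t x + 2 * deriv X x * dx f t x + X x * dx (dx f) t x
      + dx (dx Y) t x) * (k ^ 2)⁻¹ := by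
  intro g s y
  have hε0 : ε ≠ 0 := by rcases hε with rfl | rfl <;> norm_num
  have hε2 : ε ^ 2 = 1 := by rcases hε with rfl | rfl <;> norm_num
  have es : (s - k₁) / k = t := by simp only [s]; field_simp; ring
  have ey : (y - k₂) / (ε * k) = x := by simp only [y]; field_simp; ring
  let G : ℝ → ℝ → ℝ := fun t x => X x * f t x + Y t x
  have hg : g = fun s y => G ((s - k₁) / k) ((y - k₂) / (ε * k)) := rfl
  have hU := isOpen_projTX hW
  have hJ := isOpen_projX hW
  obtain ⟨hYt, hYx⟩ := contDiffOn_dt_dx hU hY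
  have htx : (t, x) ∈ projTX W := mem_projTX hp
  have dxG : ∀ y ∈ projX W, (t, y) ∈ projTX W →
      HasDerivAt (fun y => G t y) (deriv X y * f t y + X y * dx f t y + dx Y t y) y :=
    fun y hy hty => ((hasDerivAt_of_smooth hJ hX hy).1.mul (hf.hasDerivAt_dx t y)).add
      (hasDerivAt_of_smoothOn₂ hU hY hty).2
  have dtG : ∀ s, (s, x) ∈ projTX W →
      HasDerivAt (fun s => G s x) (X x * dt f s x + dt Y s x) s :=
    fun s hs => ((hf.hasDerivAt_dt s x).const_mul (X x)).add (hasDerivAt_of_smoothOn₂ hU hY hs).1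
  have ht : ∀ᶠ s in 𝓝 t, (s, x) ∈ projTX W :=
    (continuous_id.prodMk continuous_const).continuousAt.preimage_mem_nhds (hU.mem_nhds htx)
  have hx : ∀ᶠ y in 𝓝 x, (t, y) ∈ projTX W :=
    (continuous_const.prodMk continuous_id).continuousAt.preimage_mem_nhds (hU.mem_nhds htx)
  have dttG : dt (dt G) t x = X x * dt (dt f) t x + dt (dt Y) t x := by
    refine HasDerivAt.deriv ((((hf.dt.hasDerivAt_dt t x).const_mul (X x)).add
      (hasDerivAt_of_smoothOn₂ hU hYt htx).1).congr_of_eventuallyEq ?_)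
    filter_upwards [ht] with s hs using (dtG s hs).deriv
  have dxxG : dx (dx G) t x = deriv (deriv X) x * f t x + 2 * deriv X x * dx f t x
      + X x * dx (dx f) t x + dx (dx Y) t x := by
    have hX2 := hasDerivAt_of_smooth hJ hX (mem_projX_of_projTX htx)
    have := (((hX2.2.mul (hf.hasDerivAt_dx t x)).add (hX2.1.mul (hf.dx.hasDerivAt_dx t x))).add
      (hasDerivAt_of_smoothOn₂ hU hYx htx).2)
    refine (HasDerivAt.deriv (this.congr_of_eventuallyEq ?_)).trans (by ring)
    filter_upwards [hx] with y hy using (dxG y (mem_projX_of_projTX hy) hy).deriv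
  refine ⟨?_, ?_, ?_, ?_⟩
  · rw [hg]
    simp only [es, ey, G]
  · rw [hg, dx_comp_affine]
    simp only [es, ey]
    rw [show dx G t x = _ from (dxG x (mem_projX_of_projTX htx) htx).deriv, mul_comm]
  · rw [hg, dt_comp_affine, dt_const_mul, dt_comp_affine]
    simp only [es, ey, dttG]
    field_simp
  · rw [hg, dx_comp_affine, dx_const_mul, dx_comp_affine]
    simp only [es, ey, dxxG]
    rw [← one_mul (k ^ 2), ← hε2]
    field_simp

/-- The relations between the coefficients of two equations of the class under which
`t' = k t + k₁, x' = ε k x + k₂, v = ± exp(θ(x)) u` carries one into the other. -/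
structure Related (W : Set Pt) (e e' : WaveEq) (k k₁ k₂ ε : ℝ) (θ : ℝ → ℝ) : Prop where
  k_ne : k ≠ 0
  sign : ε = 1 ∨ ε = -1
  smooth : ContDiffOn ℝ ∞ θ (projX W)
  eqA : ∀ x ∈ projX W, e.A x = ε * k * e'.A (ε * k * x + k₂)
  eqB : ∀ x ∈ projX W, e.B x = k ^ 2 * e'.B (ε * k * x + k₂)
  eqD : ∀ t x, (t, x) ∈ projTX W →
    e.D t x = e.op θ x + k ^ 2 * e'.D (k * t + k₁) (ε * k * x + k₂)

/-- Equivalent equations have related coefficients: the terms quadratic in `u_x` force `Y = 0`, the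
others compare coefficients, with `θ = ln |X|`. -/
theorem Equivalent.exists_related {W W' : Set Pt} {e e' : WaveEq} (hW : IsAdmissible W)
    (hW' : IsAdmissible W') (h : Equivalent W e.rhs W' e'.rhs) :
    ∃ (k k₁ k₂ ε : ℝ) (θ : ℝ → ℝ), Related W e e' k k₁ k₂ ε θ ∧
      ∀ t x, (t, x) ∈ projTX W → (k * t + k₁, ε * k * x + k₂) ∈ projTX W' := by
  obtain ⟨k, k₁, k₂, ε, X, Y, hk, hε, hX, hX0, hY, himg, heq⟩ := h
  have hWo := hW.isOpen
  have hJ := isOpen_projX hWo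
  have hU := isOpen_projTX hWo
  have hε0 : ε ≠ 0 := by rcases hε with rfl | rfl <;> norm_num
  have hε2 : ε ^ 2 = 1 := by rcases hε with rfl | rfl <;> norm_num
  have hmap : ∀ p ∈ W, pointMap k k₁ k₂ ε X Y p ∈ W' := fun p hp => himg ▸ ⟨p, hp, rfl⟩
  -- the transformed equation at the jets with `u_t = u_tx = u_xx = 0`, `u_x = w`
  have main : ∀ t x u, (t, x, u) ∈ W → ∀ w : ℝ,
      (X x * e.rhs t x u w + dt (dt Y) t x) * (k ^ 2)⁻¹ =
      (deriv (deriv X) x * u + 2 * deriv X x * w + dx (dx Y) t x) * (k ^ 2)⁻¹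
      + e'.rhs (k * t + k₁) (ε * k * x + k₂) (X x * u + Y t x)
        ((deriv X x * u + X x * w + dx Y t x) * (ε * k)⁻¹) := by
    intro t x u hp w
    have hj := smooth_jetPoly t x u 0 w (0 + e.rhs t x u w) 0 0
    have hp' : (t, x, jetPoly t x u 0 w (0 + e.rhs t x u w) 0 0 t x) ∈ W := by
      rwa [jetPoly_self]
    have hs : SolvesAt e.rhs (jetPoly t x u 0 w (0 + e.rhs t x u w) 0 0) t x := by
      simp only [SolvesAt, dt_jetPoly, dx_jetPoly, jetPoly_self]
    have hs' := (heq _ hj t x hp').1 hs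
    obtain ⟨h1, h2, h3, h4⟩ := jet_transformed (k₁ := k₁) (k₂ := k₂) hWo hk hε hX hY hj hp'
    simp only [SolvesAt, h1, h2, h3, h4, dt_jetPoly, dx_jetPoly, jetPoly_self] at hs'
    simpa using hs'
  have hY0 : ∀ t x, (t, x) ∈ projTX W → Y t x = 0 := by
    intro t x htx
    obtain ⟨u, hp⟩ := exists_of_mem_projTX htx
    have hu := hW.u_ne_zero _ hp
    have hv : X x * u + Y t x ≠ 0 := hW'.u_ne_zero _ (hmap _ hp)
    have hx0 := hX0 x (mem_projX hp)
    have h1 := main t x u hp 1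
    have h2 := main t x u hp (-1)
    have h3 := main t x u hp 0
    simp only [WaveEq.rhs] at h1 h2 h3
    have h4 : X x * u⁻¹ * (k ^ 2)⁻¹ = (X x * u + Y t x)⁻¹ * (X x * (ε * k)⁻¹) ^ 2 := by
      linear_combination -(h1 + h2 - 2 * h3) / 2
    rw [mul_pow, inv_pow, mul_pow, hε2, one_mul] at h4
    field_simp at h4
    linarith
  have hYd : ∀ t x, (t, x) ∈ projTX W → dx Y t x = 0 ∧ dx (dx Y) t x = 0 ∧ dt (dt Y) t x = 0 := by
    have hdx : ∀ t x, (t, x) ∈ projTX W → dx Y t x = 0 := fun t x htx => by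
      have : (fun y => Y t y) =ᶠ[𝓝 x] fun _ => 0 := by
        filter_upwards [(continuous_const.prodMk continuous_id).continuousAt.preimage_mem_nhds
          (hU.mem_nhds htx)] with y hy using hY0 t y hy
      exact this.deriv_eq.trans (deriv_const x 0)
    have hdt : ∀ t x, (t, x) ∈ projTX W → dt Y t x = 0 := fun t x htx => by
      have : (fun s => Y s x) =ᶠ[𝓝 t] fun _ => 0 := by
        filter_upwards [(continuous_id.prodMk continuous_const).continuousAt.preimage_mem_nhds
          (hU.mem_nhds htx)] with s hs using hY0 s x hs
      exact this.deriv_eq.trans (deriv_const t 0)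
    intro t x htx
    refine ⟨hdx t x htx, ?_, ?_⟩
    · have : (fun y => dx Y t y) =ᶠ[𝓝 x] fun _ => 0 := by
        filter_upwards [(continuous_const.prodMk continuous_id).continuousAt.preimage_mem_nhds
          (hU.mem_nhds htx)] with y hy using hdx t y hy
      exact this.deriv_eq.trans (deriv_const x 0)
    · have : (fun s => dt Y s x) =ᶠ[𝓝 t] fun _ => 0 := by
        filter_upwards [(continuous_id.prodMk continuous_const).continuousAt.preimage_mem_nhds
          (hU.mem_nhds htx)] with s hs using hdt s x hs
      exact this.deriv_eq.trans (deriv_const t 0)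
  have hA : ∀ x ∈ projX W, e.A x = ε * k * e'.A (ε * k * x + k₂) := by
    rintro x ⟨⟨t, x, u⟩, hp, rfl⟩
    simp only
    have hu := hW.u_ne_zero _ hp
    have hx0 := hX0 x (mem_projX hp)
    obtain ⟨d1, d2, d3⟩ := hYd t x (mem_projTX hp)
    have h1 := main t x u hp 1
    have h2 := main t x u hp (-1)
    simp only [WaveEq.rhs, d1, d2, d3, hY0 t x (mem_projTX hp), add_zero] at h1 h2
    have h3 : X x * e.A x * (k ^ 2)⁻¹ = 2 * deriv X x * (k ^ 2)⁻¹
        - 2 * (X x * u)⁻¹ * deriv X x * u * X x * ((ε * k) ^ 2)⁻¹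
        + e'.A (ε * k * x + k₂) * X x * (ε * k)⁻¹ := by
      rw [← inv_pow (ε * k)]
      linear_combination (h1 - h2) / 2
    have hεi : ε⁻¹ = ε := by rcases hε with rfl | rfl <;> norm_num
    rw [mul_pow, hε2, one_mul, mul_inv ε k, hεi] at h3
    generalize e'.A (ε * k * x + k₂) = A' at *
    field_simp at h3
    exact mul_left_cancel₀ hx0 (by linear_combination h3)
  -- the terms without `u_x`
  have hBD : ∀ t x u, (t, x, u) ∈ W → e.B x * Real.log u + e.D t x =
      deriv (deriv X) x / X x - (deriv X x / X x) ^ 2 + e.A x * (deriv X x / X x)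
      + k ^ 2 * e'.B (ε * k * x + k₂) * (Real.log (X x) + Real.log u)
      + k ^ 2 * e'.D (k * t + k₁) (ε * k * x + k₂) := by
    intro t x u hp
    have hu : u ≠ 0 := hW.u_ne_zero _ hp
    have hx0 := hX0 x (mem_projX hp)
    obtain ⟨d1, d2, d3⟩ := hYd t x (mem_projTX hp)
    have h1 := main t x u hp 0
    simp only [WaveEq.rhs, d1, d2, d3, hY0 t x (mem_projTX hp), add_zero, Real.log_abs,
      Real.log_mul hx0 hu] at h1
    rw [hA x (mem_projX hp)]
    generalize Real.log u = L at *
    generalize Real.log (X x) = L' at *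
    have hεi : ε⁻¹ = ε := by rcases hε with rfl | rfl <;> norm_num
    have h2 : (ε * k)⁻¹ = ε * k⁻¹ := by rw [mul_inv, hεi]
    rw [h2, mul_pow _ (ε * k⁻¹), mul_pow, hε2, one_mul] at h1
    field_simp at h1 ⊢
    exact mul_left_cancel₀ (pow_ne_zero 2 hu) (by linear_combination h1)
  have hB : ∀ x ∈ projX W, e.B x = k ^ 2 * e'.B (ε * k * x + k₂) := by
    rintro x ⟨⟨t, x, u⟩, hp, rfl⟩
    have hu := hW.u_ne_zero _ hp
    have hcont : Continuous (fun z : ℝ => ((t, x, z) : Pt)) := by fun_prop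
    obtain ⟨u', hu', hne⟩ := exists_log_abs_ne hu
      (hcont.continuousAt.preimage_mem_nhds (hWo.mem_nhds hp))
    have h1 := hBD t x u hp
    have h2 := hBD t x u' hu'
    simp only [Real.log_abs] at hne
    have h3 : (e.B x - k ^ 2 * e'.B (ε * k * x + k₂)) * (Real.log u' - Real.log u) = 0 := by
      linear_combination h2 - h1
    have := (mul_eq_zero.1 h3).resolve_right (sub_ne_zero.2 hne)
    simp only
    linarith
  refine ⟨k, k₁, k₂, ε, fun x => Real.log (X x), ⟨hk, hε, hX.log hX0, hA, hB, ?_⟩, ?_⟩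
  · intro t x htx
    obtain ⟨u, hp⟩ := exists_of_mem_projTX htx
    have hx := mem_projX hp
    have D := hasDerivAt_of_smooth hJ hX hx
    have h1 := hBD t x u hp
    rw [op_eq hJ (h' := fun y => deriv X y / X y)
      (fun y hy => (hasDerivAt_of_smooth hJ hX hy).1.log (hX0 y hy)) hx
      (D.2.fun_div D.1 (hX0 x hx))]
    rw [← hB x hx] at h1
    have h3 : (deriv (deriv X) x * X x - deriv X x * deriv X x) / X x ^ 2 =
        deriv (deriv X) x / X x - (deriv X x / X x) ^ 2 := by
      have hx0 := hX0 x hx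
      field_simp
    rw [h3]
    linear_combination h1
  · intro t x htx
    obtain ⟨u, hp⟩ := exists_of_mem_projTX htx
    exact ⟨_, hmap _ hp, rfl⟩

/-- The image of an admissible domain under a transformation `v = exp(θ(x)) u`. -/
theorem IsAdmissible.image_pointMap {W : Set Pt} (hW : IsAdmissible W) {θ : ℝ → ℝ} (hk : k ≠ 0)
    (hε : ε = 1 ∨ ε = -1) (hθ : ContDiffOn ℝ ∞ θ (projX W)) :
    IsAdmissible (pointMap k k₁ k₂ ε (fun x => Real.exp (θ x)) (fun _ _ => 0) '' W) := by
  have hε0 : ε ≠ 0 := by rcases hε with rfl | rfl <;> norm_num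
  have hJ := isOpen_projX hW.isOpen
  have hcont : ContinuousOn (pointMap k k₁ k₂ ε (fun x => Real.exp (θ x)) (fun _ _ => 0)) W := by
    have hx : ContinuousOn (fun p : Pt => Real.exp (θ p.2.1)) W :=
      Real.continuous_exp.comp_continuousOn
        (hθ.continuousOn.comp (by fun_prop) fun p hp => mem_projX hp)
    exact ContinuousOn.prodMk (by fun_prop) (ContinuousOn.prodMk (by fun_prop)
      ((hx.mul (by fun_prop)).add continuousOn_const))
  refine ⟨?_, hW.isConnected.image _ hcont, ?_, ?_⟩
  · let inv : Pt → Pt := fun p => ((p.1 - k₁) / k, (p.2.1 - k₂) / (ε * k),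
      p.2.2 * Real.exp (-θ ((p.2.1 - k₂) / (ε * k))))
    let V : Set Pt := (fun p : Pt => (p.2.1 - k₂) / (ε * k)) ⁻¹' projX W
    have hV : IsOpen V := hJ.preimage (by fun_prop)
    have hinv : ContinuousOn inv V := by
      have hx : ContinuousOn (fun p : Pt => Real.exp (-θ ((p.2.1 - k₂) / (ε * k)))) V :=
        Real.continuous_exp.comp_continuousOn
          (ContinuousOn.neg (hθ.continuousOn.comp (by fun_prop) fun p hp => hp))
      exact ContinuousOn.prodMk (by fun_prop) (ContinuousOn.prodMk (by fun_prop)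
        (ContinuousOn.mul (by fun_prop) hx))
    convert hinv.isOpen_inter_preimage hV hW.isOpen using 1
    ext ⟨s, y, v⟩
    constructor
    · rintro ⟨⟨t, x, u⟩, hp, heq⟩
      simp only [pointMap, Prod.mk.injEq] at heq
      obtain ⟨rfl, rfl, rfl⟩ := heq
      have ex : (ε * k * x + k₂ - k₂) / (ε * k) = x := by field_simp; ring
      have et : (k * t + k₁ - k₁) / k = t := by field_simp; ring
      have hu : (Real.exp (θ x) * u + 0) * Real.exp (-θ x) = u := by
        rw [Real.exp_neg]
        have := Real.exp_ne_zero (θ x)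
        field_simp
        ring
      refine ⟨?_, ?_⟩
      · simp only [V, Set.mem_preimage, ex]
        exact mem_projX hp
      · simp only [inv, Set.mem_preimage, ex, et, hu]
        exact hp
    · rintro ⟨hy, hp⟩
      refine ⟨_, hp, ?_⟩
      simp only [pointMap, inv]
      refine Prod.ext ?_ (Prod.ext ?_ ?_)
      · simp only
        field_simp
        ring
      · simp only
        field_simp
        ring
      · simp only
        rw [Real.exp_neg]
        have := Real.exp_ne_zero (θ ((y - k₂) / (ε * k)))
        field_simp
        ring
  · rintro _ ⟨p, hp, rfl⟩
    simp only [pointMap, add_zero]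
    exact mul_ne_zero (Real.exp_ne_zero _) (hW.u_ne_zero p hp)
  · intro y
    convert (hW.slice ((y - k₂) / (ε * k))).image _ (hcont.mono fun p hp => hp.1) using 1
    ext q
    constructor
    · rintro ⟨⟨p, hp, rfl⟩, hy⟩
      refine ⟨p, ⟨hp, ?_⟩, rfl⟩
      rw [← hy]
      simp only [pointMap]
      field_simp
      ring
    · rintro ⟨p, ⟨hp, hy⟩, rfl⟩
      refine ⟨⟨p, hp, rfl⟩, ?_⟩
      simp only [pointMap, hy]
      field_simp
      ring

/-- Equations with related coefficients are equivalent. -/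
theorem Related.equivalent {W : Set Pt} {e e' : WaveEq} (hW : IsAdmissible W) {θ : ℝ → ℝ}
    (h : Related W e e' k k₁ k₂ ε θ) :
    ∃ W', IsAdmissible W' ∧ Equivalent W e.rhs W' e'.rhs ∧
      ∀ s y, (s, y) ∈ projTX W' → ∃ t x, (t, x) ∈ projTX W ∧ s = k * t + k₁ ∧
        y = ε * k * x + k₂ := by
  have hk := h.k_ne
  have hε := h.sign
  have hε0 : ε ≠ 0 := by rcases hε with rfl | rfl <;> norm_num
  have hε2 : ε ^ 2 = 1 := by rcases hε with rfl | rfl <;> norm_num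
  have hJ := isOpen_projX hW.isOpen
  have hX : ContDiffOn ℝ ∞ (fun x => Real.exp (θ x)) (projX W) := h.smooth.exp
  refine ⟨_, hW.image_pointMap (k₁ := k₁) (k₂ := k₂) hk hε h.smooth, ⟨k, k₁, k₂, ε, _, _, hk, hε,
    hX, fun x _ => Real.exp_ne_zero _, contDiffOn_const, rfl, ?_⟩, ?_⟩
  · intro f hf t x hp
    have hx := mem_projX hp
    have hu : f t x ≠ 0 := hW.u_ne_zero _ hp
    obtain ⟨h1, h2, h3, h4⟩ := jet_transformed (k₁ := k₁) (k₂ := k₂) (Y := fun _ _ => 0)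
      hW.isOpen hk hε hX contDiffOn_const hf hp
    have D := hasDerivAt_of_smooth hJ h.smooth hx
    have d1 : ∀ y ∈ projX W, HasDerivAt (fun x => Real.exp (θ x)) (Real.exp (θ y) * deriv θ y) y :=
      fun y hy => (hasDerivAt_of_smooth hJ h.smooth hy).1.exp
    have e1 : deriv (fun x => Real.exp (θ x)) x = Real.exp (θ x) * deriv θ x := (d1 x hx).deriv
    have e2 : deriv (deriv fun x => Real.exp (θ x)) x =
        Real.exp (θ x) * (deriv θ x ^ 2 + deriv (deriv θ) x) := by
      have : deriv (fun x => Real.exp (θ x)) =ᶠ[𝓝 x] fun y => Real.exp (θ y) * deriv θ y := by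
        filter_upwards [hJ.mem_nhds hx] with y hy using (d1 y hy).deriv
      rw [this.deriv_eq, (D.1.exp.fun_mul D.2).deriv]
      ring
    have z1 : dt (fun _ _ => (0 : ℝ)) = fun _ _ => 0 := by funext; simp [dt]
    have z2 : dx (fun _ _ => (0 : ℝ)) = fun _ _ => 0 := by funext; simp [dx]
    -- the two residuals are proportional
    have key : dt (dt (transformed k k₁ k₂ ε (fun x => Real.exp (θ x)) (fun _ _ => 0) f))
          (k * t + k₁) (ε * k * x + k₂)
        - (dx (dx (transformed k k₁ k₂ ε (fun x => Real.exp (θ x)) (fun _ _ => 0) f))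
          (k * t + k₁) (ε * k * x + k₂) + e'.rhs (k * t + k₁) (ε * k * x + k₂)
          (transformed k k₁ k₂ ε (fun x => Real.exp (θ x)) (fun _ _ => 0) f
            (k * t + k₁) (ε * k * x + k₂))
          (dx (transformed k k₁ k₂ ε (fun x => Real.exp (θ x)) (fun _ _ => 0) f)
            (k * t + k₁) (ε * k * x + k₂)))
        = Real.exp (θ x) * (k ^ 2)⁻¹ *
          (dt (dt f) t x - (dx (dx f) t x + e.rhs t x (f t x) (dx f t x))) := by
      rw [h1, h2, h3, h4, e1, e2, z1, z2, z1, z2]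
      simp only [WaveEq.rhs, add_zero, Real.log_abs, Real.log_mul (Real.exp_ne_zero _) hu,
        Real.log_exp]
      rw [h.eqA x hx, h.eqD t x (mem_projTX hp), WaveEq.op, h.eqA x hx, h.eqB x hx]
      generalize e'.A (ε * k * x + k₂) = A'
      generalize e'.B (ε * k * x + k₂) = B'
      generalize e'.D (k * t + k₁) (ε * k * x + k₂) = D'
      generalize Real.log (f t x) = L
      have hE := Real.exp_ne_zero (θ x)
      generalize Real.exp (θ x) = E at *
      have hεi : ε⁻¹ = ε := by rcases hε with rfl | rfl <;> norm_num
      have h2 : (ε * k)⁻¹ = ε * k⁻¹ := by rw [mul_inv, hεi]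
      rw [h2, mul_pow _ (ε * k⁻¹), mul_pow, hε2, one_mul]
      field_simp
      ring
    have hne : Real.exp (θ x) * (k ^ 2)⁻¹ ≠ 0 :=
      mul_ne_zero (Real.exp_ne_zero _) (inv_ne_zero (pow_ne_zero _ hk))
    unfold SolvesAt
    rw [← sub_eq_zero, ← sub_eq_zero (b := dx (dx (transformed _ _ _ _ _ _ _)) _ _ + _), key,
      mul_eq_zero, or_iff_right hne]
  · rintro s y ⟨_, ⟨p, hp, rfl⟩, hq⟩
    obtain ⟨rfl, rfl⟩ := Prod.ext_iff.1 hq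
    exact ⟨p.1, p.2.1, mem_projTX hp, rfl, rfl⟩

end Equivalence

/-! ### Fundamental pairs for constant and Euler coefficients -/

/-- A pair of functions whose span is preserved by `(c x + c₂) d/dx`, which acts by the matrix with
rows `(p, q)` and `(r, s)`; the last condition says that the Wronskian does not vanish. -/
structure SpanPair (J : Set ℝ) (c c₂ p q r s : ℝ) (h₁ h₂ : ℝ → ℝ) : Prop where
  ne : ∀ x ∈ J, c * x + c₂ ≠ 0
  deriv₁ : ∀ x ∈ J, HasDerivAt h₁ ((p * h₁ x + q * h₂ x) / (c * x + c₂)) x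
  deriv₂ : ∀ x ∈ J, HasDerivAt h₂ ((r * h₁ x + s * h₂ x) / (c * x + c₂)) x
  wronskian : ∀ x ∈ J, h₁ x * (r * h₁ x + s * h₂ x) - (p * h₁ x + q * h₂ x) * h₂ x ≠ 0

section SpanPair

variable {J : Set ℝ} {c c₂ p q r s : ℝ} {h₁ h₂ : ℝ → ℝ}

theorem SpanPair.smooth (H : SpanPair J c c₂ p q r s h₁ h₂) (hJ : IsOpen J) :
    ContDiffOn ℝ ∞ h₁ J ∧ ContDiffOn ℝ ∞ h₂ J := by
  have key : ∀ n : ℕ, ContDiffOn ℝ n h₁ J ∧ ContDiffOn ℝ n h₂ J := by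
    intro n
    induction n with
    | zero =>
      simp only [Nat.cast_zero, contDiffOn_zero]
      exact ⟨fun x hx => (H.deriv₁ x hx).continuousAt.continuousWithinAt,
        fun x hx => (H.deriv₂ x hx).continuousAt.continuousWithinAt⟩
    | succ n ih =>
      have hz : ContDiffOn ℝ n (fun x => c * x + c₂) J := by fun_prop
      rw [Nat.cast_add, Nat.cast_one, contDiffOn_succ_iff_deriv_of_isOpen hJ,
        contDiffOn_succ_iff_deriv_of_isOpen hJ]
      refine ⟨⟨fun x hx => (H.deriv₁ x hx).differentiableAt.differentiableWithinAt, by simp, ?_⟩,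
        ⟨fun x hx => (H.deriv₂ x hx).differentiableAt.differentiableWithinAt, by simp, ?_⟩⟩
      · exact (((contDiffOn_const.mul ih.1).add (contDiffOn_const.mul ih.2)).div hz H.ne).congr
          fun x hx => (H.deriv₁ x hx).deriv
      · exact (((contDiffOn_const.mul ih.1).add (contDiffOn_const.mul ih.2)).div hz H.ne).congr
          fun x hx => (H.deriv₂ x hx).deriv
  exact ⟨contDiffOn_infty.2 fun n => (key n).1, contDiffOn_infty.2 fun n => (key n).2⟩

/-- By the Cayley–Hamilton theorem, the pair solves `a'' + A a' + B a = 0` for the coefficients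
`A = n / (c x + c₂)` and `B = m / (c x + c₂)²` if `n` and `m` fit the trace and the determinant. -/
theorem SpanPair.fundPair (H : SpanPair J c c₂ p q r s h₁ h₂) (hJ : IsOpen J) {e : WaveEq}
    {n m : ℝ} (hA : ∀ x ∈ J, e.A x = n * (c * x + c₂)⁻¹)
    (hB : ∀ x ∈ J, e.B x = m * ((c * x + c₂) ^ 2)⁻¹) (htr : p + s = c - n)
    (hdet : p * s - q * r = m) : FundPair J e h₁ h₂ := by
  obtain ⟨s1, s2⟩ := H.smooth hJ
  have hz : ∀ x : ℝ, HasDerivAt (fun x => c * x + c₂) c x := fun x => by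
    simpa using ((hasDerivAt_id x).const_mul c).add_const c₂
  refine ⟨s1, s2, fun x hx => ?_, fun x hx => ?_, fun x hx => ?_⟩
  · have h1 := H.deriv₁ x hx
    have h2 := H.deriv₂ x hx
    have hne := H.ne x hx
    rw [op_eq hJ H.deriv₁ hx (((h1.const_mul p).fun_add (h2.const_mul q)).fun_div (hz x) hne),
      hA x hx, hB x hx]
    have hn : n = c - p - s := by linarith
    subst hn hdet
    field_simp
    ring
  · have h1 := H.deriv₁ x hx
    have h2 := H.deriv₂ x hx
    have hne := H.ne x hx
    rw [op_eq hJ H.deriv₂ hx (((h1.const_mul r).fun_add (h2.const_mul s)).fun_div (hz x) hne),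
      hA x hx, hB x hx]
    have hn : n = c - p - s := by linarith
    subst hn hdet
    field_simp
    ring
  · have hne := H.ne x hx
    have := H.wronskian x hx
    rw [(H.deriv₁ x hx).deriv, (H.deriv₂ x hx).deriv]
    have e1 : h₁ x * ((r * h₁ x + s * h₂ x) / (c * x + c₂))
        - (p * h₁ x + q * h₂ x) / (c * x + c₂) * h₂ x
        = (h₁ x * (r * h₁ x + s * h₂ x) - (p * h₁ x + q * h₂ x) * h₂ x) / (c * x + c₂) := by
      ring
    rw [e1]
    exact div_ne_zero this hne

variable {E y : ℝ → ℝ} {a b : ℝ}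

/-- Two eigenfunctions. -/
theorem spanPair_diag (hne : ∀ x ∈ J, c * x + c₂ ≠ 0) {E₁ E₂ : ℝ → ℝ}
    (hE₁ : ∀ x ∈ J, HasDerivAt E₁ (a * E₁ x / (c * x + c₂)) x) (h₁ : ∀ x ∈ J, E₁ x ≠ 0)
    (hE₂ : ∀ x ∈ J, HasDerivAt E₂ (b * E₂ x / (c * x + c₂)) x) (h₂ : ∀ x ∈ J, E₂ x ≠ 0)
    (hab : a ≠ b) : SpanPair J c c₂ a 0 0 b E₁ E₂ where
  ne := hne
  deriv₁ x hx := (hE₁ x hx).congr_deriv (by ring)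
  deriv₂ x hx := (hE₂ x hx).congr_deriv (by ring)
  wronskian x hx := by
    have e1 : E₁ x * (0 * E₁ x + b * E₂ x) - (a * E₁ x + 0 * E₂ x) * E₂ x
      = (b - a) * (E₁ x * E₂ x) := by ring
    rw [e1]
    exact mul_ne_zero (sub_ne_zero.2 hab.symm) (mul_ne_zero (h₁ x hx) (h₂ x hx))

/-- An eigenfunction and a generalized eigenfunction. -/
theorem spanPair_jordan (hne : ∀ x ∈ J, c * x + c₂ ≠ 0)
    (hE : ∀ x ∈ J, HasDerivAt E (a * E x / (c * x + c₂)) x) (h0 : ∀ x ∈ J, E x ≠ 0)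
    (hy : ∀ x ∈ J, HasDerivAt y (c * x + c₂)⁻¹ x) :
    SpanPair J c c₂ a 0 1 a E (fun x => E x * y x) where
  ne := hne
  deriv₁ x hx := (hE x hx).congr_deriv (by ring)
  deriv₂ x hx := ((hE x hx).fun_mul (hy x hx)).congr_deriv (by ring)
  wronskian x hx := by
    have e1 : E x * (1 * E x + a * (E x * y x)) - (a * E x + 0 * (E x * y x)) * (E x * y x)
      = E x ^ 2 := by ring
    rw [e1]
    exact pow_ne_zero 2 (h0 x hx)

/-- A pair of complex conjugate eigenvalues. -/
theorem spanPair_cos_sin (hne : ∀ x ∈ J, c * x + c₂ ≠ 0)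
    (hE : ∀ x ∈ J, HasDerivAt E (a * E x / (c * x + c₂)) x) (h0 : ∀ x ∈ J, E x ≠ 0)
    (hy : ∀ x ∈ J, HasDerivAt y (c * x + c₂)⁻¹ x) (hb : b ≠ 0) :
    SpanPair J c c₂ a (-b) b a (fun x => E x * Real.cos (b * y x))
      (fun x => E x * Real.sin (b * y x)) where
  ne := hne
  deriv₁ x hx := ((hE x hx).fun_mul ((hy x hx).const_mul b).cos).congr_deriv (by ring)
  deriv₂ x hx := ((hE x hx).fun_mul ((hy x hx).const_mul b).sin).congr_deriv (by ring)
  wronskian x hx := by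
    have e1 : ∀ E C S : ℝ, E * C * (b * (E * C) + a * (E * S))
      - (a * (E * C) + -b * (E * S)) * (E * S) = b * E ^ 2 * (S ^ 2 + C ^ 2) := by intros; ring
    rw [e1, Real.sin_sq_add_cos_sq, mul_one]
    exact mul_ne_zero hb (pow_ne_zero 2 (h0 x hx))

/-- Two real eigenvalues, in terms of hyperbolic functions. -/
theorem spanPair_cosh_sinh (hne : ∀ x ∈ J, c * x + c₂ ≠ 0)
    (hE : ∀ x ∈ J, HasDerivAt E (a * E x / (c * x + c₂)) x) (h0 : ∀ x ∈ J, E x ≠ 0)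
    (hy : ∀ x ∈ J, HasDerivAt y (c * x + c₂)⁻¹ x) (hb : b ≠ 0) :
    SpanPair J c c₂ a b b a (fun x => E x * Real.cosh (b * y x))
      (fun x => E x * Real.sinh (b * y x)) where
  ne := hne
  deriv₁ x hx := ((hE x hx).fun_mul ((hy x hx).const_mul b).cosh).congr_deriv (by ring)
  deriv₂ x hx := ((hE x hx).fun_mul ((hy x hx).const_mul b).sinh).congr_deriv (by ring)
  wronskian x hx := by
    have e1 : ∀ E C S : ℝ, E * C * (b * (E * C) + a * (E * S))
      - (a * (E * C) + b * (E * S)) * (E * S) = b * E ^ 2 * (C ^ 2 - S ^ 2) := by intros; ring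
    rw [e1, Real.cosh_sq_sub_sinh_sq, mul_one]
    exact mul_ne_zero hb (pow_ne_zero 2 (h0 x hx))

/-- Every trace `T` and determinant `D` is realized. -/
theorem exists_spanPair (hne : ∀ x ∈ J, c * x + c₂ ≠ 0)
    (hy : ∀ x ∈ J, HasDerivAt y (c * x + c₂)⁻¹ x) (T D : ℝ) : ∃ (p q r s : ℝ) (h₁ h₂ : ℝ → ℝ),
    SpanPair J c c₂ p q r s h₁ h₂ ∧ p + s = T ∧ p * s - q * r = D := by
  have hE : ∀ a : ℝ, ∀ x ∈ J, HasDerivAt (fun x => Real.exp (a * y x))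
      (a * Real.exp (a * y x) / (c * x + c₂)) x := fun a x hx =>
    ((hy x hx).const_mul a).exp.congr_deriv (by ring)
  have h0 : ∀ a : ℝ, ∀ x ∈ J, Real.exp (a * y x) ≠ 0 := fun a x _ => Real.exp_ne_zero _
  rcases lt_trichotomy (T ^ 2) (4 * D) with h | h | h
  · have h2 : 0 < D - T ^ 2 / 4 := by linarith
    refine ⟨_, _, _, _, _, _, spanPair_cos_sin hne (hE (T / 2)) (h0 _) hy
      (Real.sqrt_pos.2 h2).ne', by ring, ?_⟩
    linear_combination Real.sq_sqrt h2.le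
  · refine ⟨_, _, _, _, _, _, spanPair_jordan hne (hE (T / 2)) (h0 _) hy, by ring, ?_⟩
    linear_combination h / 4
  · have h2 : 0 < T ^ 2 - 4 * D := by linarith
    have h3 := Real.sqrt_pos.2 h2
    refine ⟨_, _, _, _, _, _, spanPair_diag hne (hE ((T + √(T ^ 2 - 4 * D)) / 2)) (h0 _)
      (hE ((T - √(T ^ 2 - 4 * D)) / 2)) (h0 _) (fun h => by linarith), by ring, ?_⟩
    linear_combination -(Real.sq_sqrt h2.le) / 4

/-- Constant coefficients. -/
theorem exists_fundPair_const (hJ : IsOpen J) {e : WaveEq} {n m : ℝ} (hA : ∀ x ∈ J, e.A x = n)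
    (hB : ∀ x ∈ J, e.B x = m) : ∃ h₁ h₂, FundPair J e h₁ h₂ := by
  obtain ⟨p, q, r, s, h₁, h₂, H, h1, h2⟩ := exists_spanPair (J := J) (c := 0) (c₂ := 1)
    (y := fun x => x) (by simp) (fun x _ => by simpa using hasDerivAt_id' x) (-n) m
  exact ⟨_, _, H.fundPair hJ (n := n) (m := m) (by simpa using hA) (by simpa using hB)
    (by linarith) h2⟩

/-- Euler coefficients. -/
theorem exists_fundPair_euler (hJ : IsOpen J) {e : WaveEq} {n m c₂ : ℝ}
    (hA : ∀ x ∈ J, e.A x = n * (x + c₂)⁻¹) (hB : ∀ x ∈ J, e.B x = m * ((x + c₂) ^ 2)⁻¹)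
    (hne : ∀ x ∈ J, x + c₂ ≠ 0) : ∃ h₁ h₂, FundPair J e h₁ h₂ := by
  obtain ⟨p, q, r, s, h₁, h₂, H, h1, h2⟩ := exists_spanPair (J := J) (c := 1) (c₂ := c₂)
    (y := fun x => Real.log (x + c₂)) (by simpa using hne)
    (fun x hx => by simpa using ((hasDerivAt_id x).add_const c₂).log (hne x hx)) (1 - n) m
  exact ⟨_, _, H.fundPair hJ (n := n) (m := m) (by simpa using hA) (by simpa using hB) h1 h2⟩

end SpanPair

/-! ### Solving the determining equations for the coefficients -/

section Normal

variable {W : Set Pt} {e : WaveEq}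

/-- The free equation up to a potential that depends on `x` only. -/
theorem symDim_of_free (he : InClass W e) (hA : ∀ x ∈ projX W, e.A x = 0)
    (hB : ∀ x ∈ projX W, e.B x = 0) {h : ℝ → ℝ} (hh : ContDiffOn ℝ ∞ h (projX W))
    (hD : ∀ t x, (t, x) ∈ projTX W → e.D t x = h x) : symDim W e.rhs = 5 := by
  have hJ := isOpen_projX he.domain.isOpen
  have hJc := isPreconnected_projX he.domain.isConnected.isPreconnected
  obtain ⟨h₁, h₂, H⟩ := exists_fundPair_const hJ hA hB
  refine symDim_eq_five he ?_ H
  have hA' : ∀ x ∈ projX W, deriv e.A x = 0 := fun x hx => by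
    have : e.A =ᶠ[𝓝 x] fun _ => 0 := by
      filter_upwards [hJ.mem_nhds hx] with y hy using hA y hy
    rw [this.deriv_eq, deriv_const]
  have hB' : ∀ x ∈ projX W, deriv e.B x = 0 := fun x hx => by
    have : e.B =ᶠ[𝓝 x] fun _ => 0 := by
      filter_upwards [hJ.mem_nhds hx] with y hy using hB y hy
    rw [this.deriv_eq, deriv_const]
  have hU := isOpen_projTX he.domain.isOpen
  have hDt : ∀ t x, (t, x) ∈ projTX W → dt e.D t x = 0 := fun t x htx => by
    have : (fun s => e.D s x) =ᶠ[𝓝 t] fun _ => h x := by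
      filter_upwards [(continuous_id.prodMk continuous_const).continuousAt.preimage_mem_nhds
        (hU.mem_nhds htx)] with s hs using hD s x hs
    exact this.deriv_eq.trans (deriv_const t _)
  have hDx : ∀ t x, (t, x) ∈ projTX W → dx e.D t x = deriv h x := fun t x htx => by
    have : (fun y => e.D t y) =ᶠ[𝓝 x] h := by
      filter_upwards [(continuous_const.prodMk continuous_id).continuousAt.preimage_mem_nhds
        (hU.mem_nhds htx)] with y hy using hD t y hy
    exact this.deriv_eq
  rw [eq_top_iff]
  rintro ⟨c, c₁, c₂⟩ -
  have hh' := contDiffOn_deriv' hJ hh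
  obtain ⟨a, ha, hop⟩ := H.exists_particular hJ hJc
    (g := fun x => -((c * x + c₂) * deriv h x + 2 * c * h x))
    ((ContDiffOn.mul (by fun_prop) hh').add (contDiffOn_const.mul hh)).neg
  rw [mem_genSpace he]
  refine ⟨a, ha, fun x hx => ?_, fun x hx => ?_, fun t x htx => ?_⟩
  · rw [hA x hx, hA' x hx]; ring
  · rw [hB x hx, hB' x hx]; ring
  · rw [hop x (mem_projX_of_projTX htx), hDt t x htx, hDx t x htx, hD t x htx]; ring

/-- The function `D` on the domain. -/
theorem InClass.partials_D (he : InClass W e) :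
    ContDiffOn ℝ ∞ (fun p : Pt => e.D p.1 p.2.1) W ∧ ∀ p ∈ W,
      pt (fun p : Pt => e.D p.1 p.2.1) p = dt e.D p.1 p.2.1 ∧
      px (fun p : Pt => e.D p.1 p.2.1) p = dx e.D p.1 p.2.1 ∧
      pu (fun p : Pt => e.D p.1 p.2.1) p = 0 := by
  have hs : ContDiffOn ℝ ∞ (fun p : Pt => e.D p.1 p.2.1) W :=
    he.smooth_D.comp (g := fun p : ℝ × ℝ => e.D p.1 p.2) (f := fun p : Pt => (p.1, p.2.1))
      (by fun_prop) fun p hp => mem_projTX hp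
  refine ⟨hs, ?_⟩
  rintro ⟨t, x, u⟩ hp
  have hd := (differentiableAt_of_smooth he.domain.isOpen hs hp).hasFDerivAt
  have h1 := hd.comp_hasDerivAt t ((hasDerivAt_id t).prodMk (hasDerivAt_const t (x, u)))
  have h2 := hd.comp_hasDerivAt x ((hasDerivAt_const x t).prodMk
    ((hasDerivAt_id x).prodMk (hasDerivAt_const x u)))
  have h3 := hd.comp_hasDerivAt u ((hasDerivAt_const u t).prodMk
    ((hasDerivAt_const u x).prodMk (hasDerivAt_id u)))
  exact ⟨h1.deriv.symm, h2.deriv.symm, h3.unique (hasDerivAt_const u (e.D t x))⟩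

/-- If `∂_t` extends to a symmetry, then `D` is affine in `t`. -/
theorem exists_affine (he : InClass W e) (h : (0, 1, 0) ∈ genSpace he) :
    ∃ q h : ℝ → ℝ, ContDiffOn ℝ ∞ q (projX W) ∧ ContDiffOn ℝ ∞ h (projX W) ∧
      ∀ t x, (t, x) ∈ projTX W → e.D t x = q x * t + h x ∧ dt e.D t x = q x ∧
        dx e.D t x = deriv q x * t + deriv h x := by
  obtain ⟨a, ha⟩ := (mem_genSpace he).1 h
  have hW := he.domain.isOpen
  have hJ := isOpen_projX hW
  obtain ⟨sD, pD⟩ := he.partials_D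
  have hq : ContDiffOn ℝ ∞ (fun x => -e.op a x) (projX W) :=
    (((contDiffOn_deriv' hJ (contDiffOn_deriv' hJ ha.smooth)).add
      (he.smooth_A.mul (contDiffOn_deriv' hJ ha.smooth))).add (he.smooth_B.mul ha.smooth)).neg
  have hDt : ∀ t x, (t, x) ∈ projTX W → dt e.D t x = -e.op a x := fun t x htx => by
    linear_combination ha.eqD t x htx
  have key : ∀ p ∈ W, HasFDerivAt (fun p : Pt => e.D p.1 p.2.1 - -e.op a p.2.1 * p.1) _ p :=
    fun p hp => (differentiableAt_of_smooth hW sD hp).hasFDerivAt.fun_sub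
      ((hasFDerivAt_comp_x (differentiableAt_of_smooth hJ hq (mem_projX hp))).mul hasFDerivAt_fst)
  obtain ⟨h, hh, hG⟩ := exists_fun_x (G := fun p : Pt => e.D p.1 p.2.1 - -e.op a p.2.1 * p.1)
    he.domain (sD.sub ((contDiffOn_comp_x hq).mul (by fun_prop)))
    (fun p hp => by
      rw [(partials_of_hasFDerivAt (key p hp)).1]
      have := (pD p hp).1
      rw [hDt _ _ (mem_projTX hp), pt] at this
      simp [this])
    (fun p hp => by
      rw [(partials_of_hasFDerivAt (key p hp)).2.2]
      have := (pD p hp).2.2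
      rw [pu] at this
      simp [this])
  have hD : ∀ t x, (t, x) ∈ projTX W → e.D t x = -e.op a x * t + h x := fun t x htx => by
    obtain ⟨u, hp⟩ := exists_of_mem_projTX htx
    have := hG _ hp
    simp only at this
    linarith
  refine ⟨_, h, hq, hh, fun t x htx => ⟨hD t x htx, hDt t x htx, ?_⟩⟩
  have hx := mem_projX_of_projTX htx
  have h1 : (fun y => e.D t y) =ᶠ[𝓝 x] fun y => -e.op a y * t + h y := by
    filter_upwards [(continuous_const.prodMk continuous_id).continuousAt.preimage_mem_nhds
      ((isOpen_projTX hW).mem_nhds htx)] with y hy using hD t y hy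
  exact h1.deriv_eq.trans (((hasDerivAt_of_smooth hJ hq hx).1.mul_const t).add
    (hasDerivAt_of_smooth hJ hh hx).1).deriv

/-- An identity that is affine in `t` holds coefficientwise. -/
theorem affine_eq_zero (hW : IsOpen W) {α β : ℝ → ℝ}
    (h : ∀ t x, (t, x) ∈ projTX W → α x * t + β x = 0) : ∀ x ∈ projX W, α x = 0 := by
  intro x hx
  obtain ⟨t, htx⟩ := exists_of_mem_projX hx
  obtain ⟨u, hp⟩ := exists_of_mem_projTX htx
  obtain ⟨δ, hδ, hp'⟩ := exists_shift_t hW hp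
  have h1 := h t x htx
  have h2 := h _ x (mem_projTX hp')
  exact (mul_eq_zero.1 (show α x * δ = 0 by linarith)).resolve_right hδ

/-- The solutions of `j f + (x + c₂) f' = 0` on an interval; a solution that is not zero forces
`x + c₂ ≠ 0` on the interval. -/
theorem euler_first_order {J : Set ℝ} (hJ : IsOpen J) (hJc : IsPreconnected J) {f : ℝ → ℝ}
    (hf : ContDiffOn ℝ ∞ f J) {j : ℕ} (hj : j ≠ 0) {c₂ : ℝ}
    (h : ∀ x ∈ J, j * f x + (x + c₂) * deriv f x = 0) :
    ∃ κ : ℝ, (∀ x ∈ J, f x = κ * ((x + c₂) ^ j)⁻¹) ∧ (κ ≠ 0 → ∀ x ∈ J, x + c₂ ≠ 0) := by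
  obtain ⟨i, rfl⟩ := Nat.exists_eq_succ_of_ne_zero hj
  have hd : ∀ x ∈ J, HasDerivAt (fun x => (x + c₂) ^ (i + 1) * f x) 0 x := fun x hx => by
    have := (((hasDerivAt_id x).add_const c₂).fun_pow (i + 1)).fun_mul (hasDerivAt_of_smooth hJ hf hx).1
    refine this.congr_deriv ?_
    have h1 := h x hx
    simp only [id, Nat.add_sub_cancel] at h1 ⊢
    push_cast at h1 ⊢
    linear_combination (x + c₂) ^ i * h1
  obtain ⟨κ, hκ⟩ := hJ.exists_is_const_of_deriv_eq_zero hJc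
    (fun x hx => (hd x hx).differentiableAt.differentiableWithinAt) fun x hx => (hd x hx).deriv
  refine ⟨κ, fun x hx => ?_, fun h0 x hx hz => h0 ?_⟩
  · by_cases hz : x + c₂ = 0
    · have h1 := h x hx
      rw [hz, zero_mul, add_zero] at h1
      rw [hz]
      have : ((i + 1 : ℕ) : ℝ) ≠ 0 := by positivity
      simp [(mul_eq_zero.1 h1).resolve_left this]
    · rw [← hκ x hx]
      field_simp
  · rw [← hκ x hx, hz]
    simp

/-- Both translations extend: constant coefficients, up to a potential in `x`. -/
theorem normal_const (he : InClass W e) (ht : (0, 1, 0) ∈ genSpace he)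
    (hx : (0, 0, 1) ∈ genSpace he) :
    ∃ (n m k : ℝ) (h : ℝ → ℝ), ContDiffOn ℝ ∞ h (projX W) ∧ (∀ x ∈ projX W, e.A x = n) ∧
      (∀ x ∈ projX W, e.B x = m) ∧ ∀ t x, (t, x) ∈ projTX W → e.D t x = k * t + h x ∧
        dt e.D t x = k ∧ dx e.D t x = deriv h x := by
  have hW := he.domain.isOpen
  have hJ := isOpen_projX hW
  have hJc := isPreconnected_projX he.domain.isConnected.isPreconnected
  obtain ⟨q, h, hq, hh, hD⟩ := exists_affine he ht
  obtain ⟨a, ha⟩ := (mem_genSpace he).1 hx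
  have hconst : ∀ f : ℝ → ℝ, ContDiffOn ℝ ∞ f (projX W) → (∀ x ∈ projX W, deriv f x = 0) →
      ∃ k, ∀ x ∈ projX W, f x = k := fun f hf h0 =>
    hJ.exists_is_const_of_deriv_eq_zero hJc (hf.differentiableOn (by simp)) h0
  obtain ⟨n, hn⟩ := hconst e.A he.smooth_A fun x hx => by simpa using ha.eqA x hx
  obtain ⟨m, hm⟩ := hconst e.B he.smooth_B fun x hx => by simpa using ha.eqB x hx
  have hq' : ∀ x ∈ projX W, deriv q x = 0 :=
    affine_eq_zero hW (β := fun x => e.op a x + deriv h x) fun t x htx => by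
      have := ha.eqD t x htx
      rw [(hD t x htx).2.2] at this
      linear_combination this
  obtain ⟨k, hk⟩ := hconst q hq hq'
  refine ⟨n, m, k, h, hh, hn, hm, fun t x htx => ?_⟩
  obtain ⟨h1, h2, h3⟩ := hD t x htx
  have hx := mem_projX_of_projTX htx
  rw [h1, h2, h3, hk x hx, hq' x hx]
  exact ⟨rfl, rfl, by ring⟩

/-- `∂_t` and a dilation extend: Euler coefficients, up to a potential in `x`. -/
theorem normal_pow (he : InClass W e) (ht : (0, 1, 0) ∈ genSpace he) {c₁ c₂ : ℝ}
    (hx : (1, c₁, c₂) ∈ genSpace he) :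
    ∃ (n m k : ℝ) (h : ℝ → ℝ), ContDiffOn ℝ ∞ h (projX W) ∧
      (∀ x ∈ projX W, e.A x = n * (x + c₂)⁻¹) ∧
      (∀ x ∈ projX W, e.B x = m * ((x + c₂) ^ 2)⁻¹) ∧
      (∀ t x, (t, x) ∈ projTX W → e.D t x = k * (t + c₁) * ((x + c₂) ^ 3)⁻¹ + h x) ∧
      (n ≠ 0 ∨ m ≠ 0 ∨ k ≠ 0 → ∀ x ∈ projX W, x + c₂ ≠ 0) := by
  have hW := he.domain.isOpen
  have hJ := isOpen_projX hW
  have hJc := isPreconnected_projX he.domain.isConnected.isPreconnected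
  obtain ⟨q, h, hq, hh, hD⟩ := exists_affine he ht
  obtain ⟨a, ha⟩ := (mem_genSpace he).1 hx
  obtain ⟨n, hn, hn0⟩ := euler_first_order hJ hJc he.smooth_A one_ne_zero (c₂ := c₂) fun x hx => by
    have := ha.eqA x hx
    push_cast
    linear_combination this
  obtain ⟨m, hm, hm0⟩ := euler_first_order hJ hJc he.smooth_B two_ne_zero (c₂ := c₂) fun x hx => by
    have := ha.eqB x hx
    push_cast
    linear_combination this
  have hq' : ∀ x ∈ projX W, 3 * q x + (x + c₂) * deriv q x = 0 :=
    affine_eq_zero hW (β := fun x => e.op a x + c₁ * q x + (x + c₂) * deriv h x + 2 * h x)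
    fun t x htx => by
      have := ha.eqD t x htx
      rw [(hD t x htx).1, (hD t x htx).2.1, (hD t x htx).2.2] at this
      linear_combination this
  obtain ⟨k, hk, hk0⟩ := euler_first_order hJ hJc hq three_ne_zero (c₂ := c₂) fun x hx => by
    have := hq' x hx
    push_cast
    linear_combination this
  refine ⟨n, m, k, fun x => h x - c₁ * q x, hh.sub (contDiffOn_const.mul hq),
    by simpa using hn, hm, fun t x htx => ?_, ?_⟩
  · rw [(hD t x htx).1]
    linear_combination (t + c₁) * hk x (mem_projX_of_projTX htx)
  · rintro (h0 | h0 | h0)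
    exacts [hn0 h0, hm0 h0, hk0 h0]

/-- A dilation and a translation with a component along `∂_x` extend: the wave equation with the
potential `K z⁻²`, where `z` is an affine function of `(t,x)`, up to a potential in `x`. -/
theorem normal_wave (he : InClass W e) {c₁ c₂ α : ℝ} (hd : (1, c₁, c₂) ∈ genSpace he)
    (hx : (0, α, 1) ∈ genSpace he) :
    (∀ x ∈ projX W, e.A x = 0) ∧ (∀ x ∈ projX W, e.B x = 0) ∧
    ∃ (K : ℝ) (h : ℝ → ℝ), ContDiffOn ℝ ∞ h (projX W) ∧
      (∀ t x, (t, x) ∈ projTX W → e.D t x = K * ((t + c₁ - α * (x + c₂)) ^ 2)⁻¹ + h x) ∧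
      (K ≠ 0 → ∀ t x, (t, x) ∈ projTX W → t + c₁ - α * (x + c₂) ≠ 0) := by
  have hW := he.domain.isOpen
  have hJ := isOpen_projX hW
  have hWc := he.domain.isConnected.isPreconnected
  have hJc := isPreconnected_projX hWc
  obtain ⟨a, ha⟩ := (mem_genSpace he).1 hd
  obtain ⟨b, hb⟩ := (mem_genSpace he).1 hx
  have hA : ∀ x ∈ projX W, e.A x = 0 := fun x hx => by
    linear_combination ha.eqA x hx - (x + c₂) * hb.eqA x hx
  have hB : ∀ x ∈ projX W, e.B x = 0 := fun x hx => by
    linear_combination (ha.eqB x hx - (x + c₂) * hb.eqB x hx) / 2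
  have sop : ∀ {f : ℝ → ℝ}, ContDiffOn ℝ ∞ f (projX W) →
      ContDiffOn ℝ ∞ (fun x => e.op f x) (projX W) := fun hf =>
    (((contDiffOn_deriv' hJ (contDiffOn_deriv' hJ hf)).add
      (he.smooth_A.mul (contDiffOn_deriv' hJ hf))).add (he.smooth_B.mul hf))
  obtain ⟨Q, sQ, dQ⟩ := exists_antideriv hJ hJc (sop hb.smooth).neg
  obtain ⟨sD, pD⟩ := he.partials_D
  -- `E = D - Q(x)` is constant along the translation
  let E : Pt → ℝ := fun p => e.D p.1 p.2.1 - Q p.2.1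
  have sE : ContDiffOn ℝ ∞ E W := sD.sub (contDiffOn_comp_x sQ)
  have dE : ∀ p ∈ W, HasFDerivAt E (fderiv ℝ E p) p := fun p hp =>
    (differentiableAt_of_smooth hW sE hp).hasFDerivAt
  have kE : ∀ p ∈ W, pt E p = dt e.D p.1 p.2.1 ∧ px E p = dx e.D p.1 p.2.1 + e.op b p.2.1 ∧
      pu E p = 0 := fun p hp => by
    obtain ⟨h1, h2, h3⟩ := pD p hp
    have k1 : HasFDerivAt E _ p := (differentiableAt_of_smooth hW sD hp).hasFDerivAt.fun_sub
      (hasFDerivAt_comp_x (dQ _ (mem_projX hp)).differentiableAt)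
    obtain ⟨h4, h5, h6⟩ := partials_of_hasFDerivAt k1
    rw [pt] at h1
    rw [px] at h2
    rw [pu] at h3
    rw [h4, h5, h6]
    simp [h1, h2, h3, (dQ _ (mem_projX hp)).deriv]
  have xE : Set.EqOn (px E) (fun p => -α * pt E p) W := fun p hp => by
    simp only
    rw [(kE p hp).1, (kE p hp).2.1]
    linear_combination hb.eqD _ _ (mem_projTX hp)
  let z : Pt → ℝ := fun p => p.1 + c₁ - α * (p.2.1 + c₂)
  have dz : ∀ p : Pt, HasFDerivAt z (ContinuousLinearMap.fst ℝ ℝ (ℝ × ℝ) -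
      α • (ContinuousLinearMap.fst ℝ ℝ ℝ).comp (ContinuousLinearMap.snd ℝ ℝ (ℝ × ℝ))) p :=
    fun p => (hasFDerivAt_fst.add_const c₁).fun_sub
      (((hasFDerivAt_fst.comp p hasFDerivAt_snd).add_const c₂).const_mul α)
  -- the dilation gives `z E_t + 2 E = r(x)`
  let r : ℝ → ℝ := fun x => -e.op a x + (x + c₂) * e.op b x - 2 * Q x
  have sr : ContDiffOn ℝ ∞ r (projX W) :=
    (((sop ha.smooth).neg).add (ContDiffOn.mul (by fun_prop) (sop hb.smooth))).sub
      (contDiffOn_const.mul sQ)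
  have hr : ∀ p ∈ W, z p * pt E p + 2 * E p = r p.2.1 := fun p hp => by
    have h1 := ha.eqD _ _ (mem_projTX hp)
    have h2 := hb.eqD _ _ (mem_projTX hp)
    simp only [z, E, r]
    rw [(kE p hp).1]
    linear_combination h1 - (p.2.1 + c₂) * h2
  have stE := contDiffOn_pt hW sE
  have hr' : ∀ x ∈ projX W, deriv r x = 0 := by
    rintro x ⟨p, hp, rfl⟩
    have d1 := (((dz p).fun_mul (differentiableAt_of_smooth hW stE hp).hasFDerivAt).fun_add
      ((dE p hp).const_mul 2))
    obtain ⟨p1, p2, -⟩ := partials_of_hasFDerivAt d1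
    obtain ⟨q1, q2, -⟩ := partials_comp_x hW sr hp
    have c1 := pt_congr hW hr hp
    have c2 := px_congr hW hr hp
    rw [p1, q1] at c1
    rw [p2, q2] at c2
    have m1 : (fderiv ℝ (pt E) p) (0, 1, 0) = -α * (fderiv ℝ (pt E) p) (1, 0, 0) := by
      have h1 : px (pt E) p = pt (px E) p := (pt_px hW sE hp).symm
      rw [pt_congr hW xE hp] at h1
      have h2 := ((differentiableAt_of_smooth hW stE hp).hasFDerivAt.const_mul (-α))
      rw [(partials_of_hasFDerivAt h2).1] at h1
      simpa [px] using h1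
    have m2 : (fderiv ℝ E p) (0, 1, 0) = -α * (fderiv ℝ E p) (1, 0, 0) := xE hp
    have m3 : pt E p = (fderiv ℝ E p) (1, 0, 0) := rfl
    simp [m1, m2, m3] at c1 c2
    linear_combination -α * c1 - c2
  obtain ⟨r₀, hr₀⟩ := hJ.exists_is_const_of_deriv_eq_zero hJc
    (sr.differentiableOn (by simp)) hr'
  obtain ⟨K, hK⟩ := exists_const_of_partials hW hWc (G := fun p => z p * z p * (E p - r₀ / 2))
    (ContDiffOn.mul (by fun_prop) (sE.sub contDiffOn_const))
    (fun p hp => by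
      rw [(partials_of_hasFDerivAt (((dz p).fun_mul (dz p)).fun_mul ((dE p hp).sub_const _))).1]
      have h1 := hr p hp
      rw [hr₀ _ (mem_projX hp), pt] at h1
      simp
      linear_combination z p * h1)
    (fun p hp => by
      rw [(partials_of_hasFDerivAt (((dz p).fun_mul (dz p)).fun_mul ((dE p hp).sub_const _))).2.1]
      have h1 := hr p hp
      have m2 : (fderiv ℝ E p) (0, 1, 0) = -α * (fderiv ℝ E p) (1, 0, 0) := xE hp
      rw [hr₀ _ (mem_projX hp), pt] at h1
      simp [m2]
      linear_combination (-α) * z p * h1)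
    (fun p hp => by
      rw [(partials_of_hasFDerivAt (((dz p).fun_mul (dz p)).fun_mul ((dE p hp).sub_const _))).2.2]
      have h1 := (kE p hp).2.2
      rw [pu] at h1
      simp [h1])
  refine ⟨hA, hB, K, fun x => Q x + r₀ / 2, sQ.add contDiffOn_const, fun t x htx => ?_,
    fun hK0 t x htx hz => hK0 ?_⟩
  · obtain ⟨u, hp⟩ := exists_of_mem_projTX htx
    by_cases hz : t + c₁ - α * (x + c₂) = 0
    · have h1 := hr _ hp
      rw [hr₀ _ (mem_projX hp)] at h1
      simp only [z, E, hz] at h1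
      rw [hz]
      simp
      linarith
    · have h1 := hK _ hp
      simp only [z, E] at h1
      rw [← h1]
      field_simp
      ring
  · obtain ⟨u, hp⟩ := exists_of_mem_projTX htx
    rw [← hK _ hp]
    simp only [z, hz]
    ring

end Normal

/-! ### Names of the normal forms -/

open Classical in
/-- The listed equation with constant coefficients `A = n`, `B = m`, `D = k t`, where `k ≥ 0`, and
where a nonzero `n` is normalized to `2` or `1`. -/
def constLabel (n m k : ℝ) : Listed :=
  if k = 0 then
    if n = 0 then (if m < 0 then .I1 √(-m) else .I2 √m)
    else if m = 0 then .I3 else if m = 1 then .I4 else if 1 < m then .I5 m else .I6 m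
  else
    if n = 0 then (if m = 0 then .III1 k else if 0 < m then .III3 k √m else .III4 k √(-m))
    else if m = 0 then .III2 k else if m = 1 / 4 then .III5 k
    else if m < 1 / 4 then .III6 k m else .III7 k m

open Classical in
/-- The listed equation with coefficients `A = n x⁻¹`, `B = m x⁻²`, `D = k t x⁻³`, where `k ≥ 0`. -/
def powLabel (n m k : ℝ) : Listed :=
  if k = 0 then
    if n = 0 then (if m = 1 / 4 then .I7 else if m < 1 / 4 then .I8 m else .I9 m)
    else if m = 0 then (if n = 1 then .I10 else .I11 n)
    else if m = (n - 1) ^ 2 / 4 then .I12 n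
    else if m < (n - 1) ^ 2 / 4 then .I13 n m else .I14 n m
  else
    if n = 0 then
      (if m = 0 then .II1 k else if m = 1 / 4 then .II2 k else if m = -2 then .II4 k
      else if m < 1 / 4 then .II3 k m else .II5 k m)
    else if m = 0 then (if n = 1 then .II6 k else if n = 2 then .II7 k else .II8 k n)
    else if m = (n - 1) ^ 2 / 4 then (if n = 3 then .II9 k else .II10 k n)
    else if m = n - 2 then .II12 k n
    else if m < (n - 1) ^ 2 / 4 then .II11 k n m else .II13 k n m

theorem powLabel_spec {n m k : ℝ} (hk : 0 ≤ k) (h0 : n ≠ 0 ∨ m ≠ 0 ∨ k ≠ 0) :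
    (entry (powLabel n m k)).valid ∧ (entry (powLabel n m k)).eqn = powEq n m k ∧
      (entry (powLabel n m k)).regular = xNonzero := by
  unfold powLabel
  split_ifs <;> simp only [entry] <;> grind

/-- The parameters that occur in the list of equations with constant coefficients. -/
theorem constLabel_spec {n m k : ℝ} (hk : 0 ≤ k) (h0 : n ≠ 0 ∨ m ≠ 0 ∨ k ≠ 0)
    (hn : n = 0 ∨ (k = 0 ∧ m = 0 ∧ n = 1) ∨ (k = 0 ∧ m ≠ 0 ∧ n = 2) ∨ (k ≠ 0 ∧ n = 1)) :
    (entry (constLabel n m k)).valid ∧ (entry (constLabel n m k)).eqn = constEq n m k ∧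
      (entry (constLabel n m k)).regular = Set.univ := by
  unfold constLabel
  split_ifs <;> simp only [entry] <;> grind [Real.sq_sqrt, Real.sqrt_pos]

/-! ### Normalization -/

section Normalize

variable {W : Set Pt} {e : WaveEq}

/-- An equation that is related to a listed one is equivalent to it. -/
theorem Related.exists_listed (hW : IsAdmissible W) {k k₁ k₂ ε : ℝ} {θ : ℝ → ℝ} {a : Listed}
    (hv : (entry a).valid) (h : Related W e (entry a).eqn k k₁ k₂ ε θ)
    (hreg : ∀ t x, (t, x) ∈ projTX W → (k * t + k₁, ε * k * x + k₂) ∈ (entry a).regular) :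
    ∃ (a : Listed) (W' : Set Pt), (entry a).valid ∧ IsAdmissible W' ∧
      projTX W' ⊆ (entry a).regular ∧ Equivalent W e.rhs W' (entry a).eqn.rhs := by
  obtain ⟨W', h1, h2, h3⟩ := h.equivalent hW
  refine ⟨a, W', hv, h1, ?_, h2⟩
  rintro ⟨s, y⟩ hsy
  obtain ⟨t, x, htx, rfl, rfl⟩ := h3 s y hsy
  exact hreg t x htx

/-- The parameters of an equation with constant coefficients can be normalized by a scaling of
`t` and `x`. -/
theorem exists_scaling {n m k : ℝ} (h0 : n ≠ 0 ∨ m ≠ 0 ∨ k ≠ 0) :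
    ∃ κ ε n' m' k' : ℝ, κ ≠ 0 ∧ (ε = 1 ∨ ε = -1) ∧ n = ε * κ * n' ∧ m = κ ^ 2 * m' ∧
      k = κ ^ 3 * k' ∧ 0 ≤ k' ∧ (n' ≠ 0 ∨ m' ≠ 0 ∨ k' ≠ 0) ∧
      (n' = 0 ∨ (k' = 0 ∧ m' = 0 ∧ n' = 1) ∨ (k' = 0 ∧ m' ≠ 0 ∧ n' = 2) ∨
        (k' ≠ 0 ∧ n' = 1)) := by
  by_cases hk : k = 0
  · subst hk
    by_cases hn : n = 0
    · exact ⟨1, 1, 0, m, 0, by norm_num, by norm_num, by simpa using hn, by ring, by ring, le_rfl,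
        by subst hn; simpa using h0, by simp⟩
    · by_cases hm : m = 0
      · exact ⟨n, 1, 1, 0, 0, hn, by norm_num, by ring, by simpa using hm, by ring, le_rfl,
          by norm_num, by simp⟩
      · refine ⟨n / 2, 1, 2, m / (n / 2) ^ 2, 0, by positivity, by norm_num, by ring, ?_, by ring,
          le_rfl, by norm_num, ?_⟩
        · field_simp
        · right; right; left
          exact ⟨rfl, by positivity, rfl⟩
  · by_cases hn : n = 0
    · rcases lt_or_gt_of_ne hk with hk' | hk'
      · exact ⟨-1, 1, 0, m, -k, by norm_num, by norm_num, by simpa using hn, by ring, by ring,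
          by linarith, by simp [hk], by simp⟩
      · exact ⟨1, 1, 0, m, k, by norm_num, by norm_num, by simpa using hn, by ring, by ring,
          hk'.le, by simp [hk], by simp⟩
    · -- the sign of `κ` is chosen such that `k / κ ^ 3 > 0`
      have hex : ∃ κ ε : ℝ, κ ≠ 0 ∧ (ε = 1 ∨ ε = -1) ∧ n = ε * κ ∧ 0 < k / κ ^ 3 := by
        rcases lt_or_gt_of_ne (div_ne_zero hk (pow_ne_zero 3 hn)) with h | h
        · refine ⟨-n, -1, neg_ne_zero.2 hn, by norm_num, by ring, ?_⟩
          rw [Odd.neg_pow (by decide), div_neg]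
          linarith
        · exact ⟨n, 1, hn, by norm_num, by ring, h⟩
      obtain ⟨κ, ε, hκ, hε, hn', hk'⟩ := hex
      refine ⟨κ, ε, 1, m / κ ^ 2, k / κ ^ 3, hκ, hε, by rw [hn']; ring, ?_, ?_, hk'.le,
        by norm_num, ?_⟩
      · field_simp
      · field_simp
      · right; right; right
        exact ⟨hk'.ne', rfl⟩

/-- If the algebra is larger than four-dimensional, then both translations and the dilation extend
to symmetries, so that the coefficients are constant and homogeneous, hence `A = B = 0` and `D_t = 0`;
what remains of `D` is removed by a solution of `θ'' = D`. -/
theorem equivalent_free (he : InClass W e) (h : 4 < symDim W e.rhs) :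
    ∃ W', IsAdmissible W' ∧ Equivalent W e.rhs W' freeEq.rhs := by
  have hJ := isOpen_projX he.domain.isOpen
  have hJc := isPreconnected_projX he.domain.isConnected.isPreconnected
  have hS := genSpace_eq_top he h
  have mem : ∀ q, q ∈ genSpace he := fun q => hS ▸ Submodule.mem_top
  obtain ⟨n, m, k, g, hg, hA, hB, hD⟩ := normal_const he (mem _) (mem _)
  obtain ⟨a, ha⟩ := (mem_genSpace he).1 (mem (1, 0, 0))
  have zero_deriv : ∀ {f : ℝ → ℝ} {c : ℝ}, (∀ x ∈ projX W, f x = c) →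
      ∀ x ∈ projX W, deriv f x = 0 := fun {f c} hf x hx => by
    have : f =ᶠ[𝓝 x] fun _ => c := by
      filter_upwards [hJ.mem_nhds hx] with y hy using hf y hy
    rw [this.deriv_eq, deriv_const]
  have hA0 : ∀ x ∈ projX W, e.A x = 0 := fun x hx => by
    have := ha.eqA x hx
    rw [zero_deriv hA x hx] at this
    linarith
  have hB0 : ∀ x ∈ projX W, e.B x = 0 := fun x hx => by
    have := ha.eqB x hx
    rw [zero_deriv hB x hx] at this
    linarith
  have hk : ∀ x ∈ projX W, 3 * k = 0 :=
    affine_eq_zero he.domain.isOpen (α := fun _ => 3 * k)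
      (β := fun x => e.op a x + x * deriv g x + 2 * g x) fun t x htx => by
        have := ha.eqD t x htx
        rw [(hD t x htx).1, (hD t x htx).2.1, (hD t x htx).2.2] at this
        linear_combination this
  obtain ⟨h₁, h₂, H⟩ := exists_fundPair_const hJ hA hB
  obtain ⟨θ, hθ, hop⟩ := H.exists_particular hJ hJc hg
  have hrel : Related W e freeEq 1 0 0 1 θ := by
    refine ⟨one_ne_zero, Or.inl rfl, hθ, fun x hx => ?_, fun x hx => ?_, fun t x htx => ?_⟩
    · rw [hA0 x hx]; simp [freeEq]
    · rw [hB0 x hx]; simp [freeEq]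
    · rw [(hD t x htx).1, hop x (mem_projX_of_projTX htx)]
      simp only [freeEq]
      linear_combination (t / 3) * hk x (mem_projX_of_projTX htx)
  obtain ⟨W', h1, h2, -⟩ := hrel.equivalent he.domain
  exact ⟨W', h1, h2⟩

/-- If the algebra is four-dimensional, then the admissible triples `(c, c₁, c₂)` form a space of
dimension at least two. Without dilations it contains both translations, which gives constant
coefficients. Otherwise it contains a dilation and a translation: along `t` this gives Euler
coefficients, in any other direction a travelling wave potential. -/
theorem equivalent_listed (he : InClass W e) (h4 : symDim W e.rhs = 4) :
    ∃ (a : Listed) (W' : Set Pt), (entry a).valid ∧ IsAdmissible W' ∧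
      projTX W' ⊆ (entry a).regular ∧ Equivalent W e.rhs W' (entry a).eqn.rhs := by
  have hJ := isOpen_projX he.domain.isOpen
  have hJc := isPreconnected_projX he.domain.isConnected.isPreconnected
  have not_free : ∀ h : ℝ → ℝ, ContDiffOn ℝ ∞ h (projX W) → (∀ x ∈ projX W, e.A x = 0) →
      (∀ x ∈ projX W, e.B x = 0) → ¬ ∀ t x, (t, x) ∈ projTX W → e.D t x = h x := by
    intro h hh hA hB hD
    have := symDim_of_free he hA hB hh hD
    rw [h4] at this
    norm_num at this
  have h2 := two_le_finrank_genSpace he h4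
  by_cases hc : ∃ c c₁ c₂ : ℝ, (c, c₁, c₂) ∈ genSpace he ∧ c ≠ 0
  · -- normalize the dilation, and find a translation in the complement
    obtain ⟨c, c₁, c₂, hm, hc⟩ := hc
    have hd : ((1, c⁻¹ * c₁, c⁻¹ * c₂) : ℝ × ℝ × ℝ) ∈ genSpace he := by
      have := (genSpace he).smul_mem c⁻¹ hm
      simpa [hc] using this
    generalize c⁻¹ * c₁ = d₁ at hd
    generalize c⁻¹ * c₂ = d₂ at hd
    have htr : ∃ α β : ℝ, ((0, α, β) : ℝ × ℝ × ℝ) ∈ genSpace he ∧ (α, β) ≠ 0 := by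
      by_contra! hno
      have hle : genSpace he ≤ Submodule.span ℝ {((1, d₁, d₂) : ℝ × ℝ × ℝ)} := by
        rintro ⟨b, b₁, b₂⟩ hb
        have h1 := (genSpace he).sub_mem hb ((genSpace he).smul_mem b hd)
        have h1' : ((0, b₁ - b * d₁, b₂ - b * d₂) : ℝ × ℝ × ℝ) ∈ genSpace he := by
          simpa using h1
        have h3 := hno _ _ h1'
        simp only [Prod.mk_eq_zero] at h3
        rw [Submodule.mem_span_singleton]
        exact ⟨b, by simp only [Prod.smul_mk, smul_eq_mul, mul_one, Prod.mk.injEq, true_and]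
                     exact ⟨by linarith, by linarith⟩⟩
      have h3 : ((1, d₁, d₂) : ℝ × ℝ × ℝ) ≠ 0 := fun h => one_ne_zero (congrArg Prod.fst h)
      have := (Submodule.finrank_mono hle).trans (finrank_span_singleton h3).le
      omega
    obtain ⟨α, β, hαβ, hne⟩ := htr
    by_cases hβ : β = 0
    · subst hβ
      have hα : α ≠ 0 := fun h => hne (by simp [h])
      have ht : ((0, 1, 0) : ℝ × ℝ × ℝ) ∈ genSpace he := by
        have := (genSpace he).smul_mem α⁻¹ hαβ
        simpa [hα] using this
      obtain ⟨n, m, k, h, hh, hA, hB, hD, hne⟩ := normal_pow he ht hd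
      have h0 : n ≠ 0 ∨ m ≠ 0 ∨ k ≠ 0 := by
        by_contra! h0
        obtain ⟨rfl, rfl, rfl⟩ := h0
        exact not_free h hh (by simpa using hA) (by simpa using hB) (by simpa using hD)
      obtain ⟨κ, hκ, hκ2, hk⟩ : ∃ κ : ℝ, (κ = 1 ∨ κ = -1) ∧ κ * κ = 1 ∧ 0 ≤ κ * k := by
        rcases le_total 0 k with hk | hk
        · exact ⟨1, by simp, by simp, by simpa using hk⟩
        · exact ⟨-1, by simp, by simp, by linarith⟩
      have hκ0 : κ ≠ 0 := by rintro rfl; norm_num at hκ2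
      have h0' : n ≠ 0 ∨ m ≠ 0 ∨ κ * k ≠ 0 := by
        simpa [hκ0] using h0
      obtain ⟨v1, v2, v3⟩ := powLabel_spec hk h0'
      obtain ⟨h₁, h₂, H⟩ := exists_fundPair_euler hJ hA hB (hne h0)
      obtain ⟨θ, hθ, hop⟩ := H.exists_particular hJ hJc hh
      have hrel : Related W e (powEq n m (κ * k)) κ (κ * d₁) d₂ κ θ := by
        refine ⟨hκ0, hκ, hθ, fun x hx => ?_, fun x hx => ?_, fun t x htx => ?_⟩
        · rw [hA x hx]; simp only [powEq, hκ2, one_mul]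
        · rw [hB x hx]; simp only [powEq, hκ2, one_mul, pow_two κ]
        · rw [hD t x htx, hop x (mem_projX_of_projTX htx)]
          simp only [powEq, hκ2, one_mul, pow_two κ]
          linear_combination -k * (t + d₁) * ((x + d₂) ^ 3)⁻¹ * hκ2
      rw [← v2] at hrel
      refine hrel.exists_listed he.domain v1 fun t x htx => ?_
      rw [v3]
      simp only [xNonzero, Set.mem_ofPred_eq, hκ2, one_mul]
      exact hne h0 x (mem_projX_of_projTX htx)
    · have hx : ((0, β⁻¹ * α, 1) : ℝ × ℝ × ℝ) ∈ genSpace he := by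
        have := (genSpace he).smul_mem β⁻¹ hαβ
        simpa [hβ] using this
      generalize β⁻¹ * α = γ at hx
      obtain ⟨hA, hB, K, h, hh, hD, hne⟩ := normal_wave he hd hx
      have hK : K ≠ 0 := by
        rintro rfl
        exact not_free h hh hA hB (by simpa using hD)
      obtain ⟨h₁, h₂, H⟩ := exists_fundPair_const hJ hA hB
      obtain ⟨θ, hθ, hop⟩ := H.exists_particular hJ hJc hh
      by_cases hγ : γ = 0
      · subst hγ
        have hrel : Related W e (entry (.IV K)).eqn 1 d₁ 0 1 θ := by
          refine ⟨one_ne_zero, Or.inl rfl, hθ, fun x hx => ?_, fun x hx => ?_, fun t x htx => ?_⟩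
          · rw [hA x hx]; simp [entry]
          · rw [hB x hx]; simp [entry]
          · rw [hD t x htx, hop x (mem_projX_of_projTX htx)]
            simp only [entry]
            ring
        refine hrel.exists_listed (a := .IV K) he.domain hK fun t x htx => ?_
        simpa [entry] using hne hK t x htx
      · -- the sign of `t` is chosen such that the speed is positive
        obtain ⟨κ, hκ, hκ2, hg⟩ : ∃ κ : ℝ, (κ = 1 ∨ κ = -1) ∧ κ * κ = 1 ∧ 0 < κ / γ := by
          rcases lt_or_gt_of_ne hγ with hg | hg
          · exact ⟨-1, by simp, by simp, div_pos_of_neg_of_neg (by norm_num) hg⟩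
          · exact ⟨1, by simp, by simp, by positivity⟩
        have hκ0 : κ ≠ 0 := by rintro rfl; norm_num at hκ2
        have ez : ∀ t x, 1 * x + d₂ - κ / γ * (κ * t + κ * d₁) = -(t + d₁ - γ * (x + d₂)) / γ := by
          intro t x
          field_simp
          linear_combination -(t + d₁) * hκ2
        have hrel : Related W e (entry (.V (κ / γ) (K / γ ^ 2))).eqn κ (κ * d₁) d₂ κ θ := by
          refine ⟨hκ0, hκ, hθ, fun x hx => ?_, fun x hx => ?_, fun t x htx => ?_⟩
          · rw [hA x hx]; simp [entry]
          · rw [hB x hx]; simp [entry]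
          · rw [hD t x htx, hop x (mem_projX_of_projTX htx)]
            simp only [entry]
            rw [hκ2, ez, pow_two κ, hκ2]
            have := hne hK t x htx
            generalize t + d₁ - γ * (x + d₂) = z at *
            field_simp
            ring
        refine hrel.exists_listed (a := .V (κ / γ) (K / γ ^ 2)) he.domain ⟨hg, by positivity⟩ fun t x htx => ?_
        simp only [entry, Set.mem_ofPred_eq]
        rw [hκ2, ez]
        exact div_ne_zero (neg_ne_zero.2 (hne hK t x htx)) hγ
  · -- no dilation: both translations extend
    have hle : genSpace he ≤ LinearMap.ker (LinearMap.fst ℝ ℝ (ℝ × ℝ)) := by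
      rintro ⟨c, c₁, c₂⟩ hm
      by_contra hne
      exact hc ⟨c, c₁, c₂, hm, hne⟩
    have hker : Module.finrank ℝ (LinearMap.ker (LinearMap.fst ℝ ℝ (ℝ × ℝ))) = 2 := by
      have h1 := LinearMap.finrank_range_add_finrank_ker (LinearMap.fst ℝ ℝ (ℝ × ℝ))
      rw [LinearMap.range_eq_top.2 Prod.fst_surjective] at h1
      simp at h1
      omega
    have heq := Submodule.eq_of_le_of_finrank_le hle (hker.trans_le h2)
    have ht : ((0, 1, 0) : ℝ × ℝ × ℝ) ∈ genSpace he := by rw [heq]; rfl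
    have hx : ((0, 0, 1) : ℝ × ℝ × ℝ) ∈ genSpace he := by rw [heq]; rfl
    obtain ⟨n, m, k, h, hh, hA, hB, hD⟩ := normal_const he ht hx
    have h0 : n ≠ 0 ∨ m ≠ 0 ∨ k ≠ 0 := by
      by_contra! h0
      obtain ⟨rfl, rfl, rfl⟩ := h0
      exact not_free h hh hA hB fun t x htx => by simpa using (hD t x htx).1
    obtain ⟨κ, ε, n', m', k', hκ, hε, e1, e2, e3, hk', h0', hn'⟩ := exists_scaling h0
    obtain ⟨v1, v2, v3⟩ := constLabel_spec hk' h0' hn'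
    obtain ⟨h₁, h₂, H⟩ := exists_fundPair_const hJ hA hB
    obtain ⟨θ, hθ, hop⟩ := H.exists_particular hJ hJc hh
    have hrel : Related W e (constEq n' m' k') κ 0 0 ε θ := by
      refine ⟨hκ, hε, hθ, fun x hx => ?_, fun x hx => ?_, fun t x htx => ?_⟩
      · rw [hA x hx, e1]; rfl
      · rw [hB x hx, e2]; rfl
      · rw [(hD t x htx).1, hop x (mem_projX_of_projTX htx), e3]
        simp only [constEq]
        ring
    rw [← v2] at hrel
    exact hrel.exists_listed he.domain v1 fun t x _ => by rw [v3]; trivial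

end Normalize

/-! ### Parametrized algebras of symmetries -/

section Param

variable {W : Set Pt} {F : Rhs} {n : ℕ}

/-- The linear map `Φ` identifies `ℝⁿ`, with the bracket `br`, with the algebra of all symmetries
on `W`. -/
structure IsParam (W : Set Pt) (F : Rhs) (Φ : (Fin n → ℝ) →ₗ[ℝ] VF)
    (br : (Fin n → ℝ) → (Fin n → ℝ) → Fin n → ℝ) : Prop where
  symmetry : ∀ v, IsSymmetry W F (Φ v)
  inj : ∀ v, (∀ p ∈ W, Φ v p = 0) → v = 0
  maximal : ∀ R, IsSymmetry W F R → ∃ v, Set.EqOn R (Φ v) W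
  bracket : ∀ v w, Set.EqOn (VectorField.lieBracket ℝ (Φ v) (Φ w)) (Φ (br v w)) W

variable {Φ : (Fin n → ℝ) →ₗ[ℝ] VF} {br : (Fin n → ℝ) → (Fin n → ℝ) → Fin n → ℝ}

/-- Restriction to `W` as a linear map. -/
def restrₗ (W : Set Pt) : VF →ₗ[ℝ] (W → Pt) where
  toFun := restr W
  map_add' _ _ := rfl
  map_smul' _ _ := rfl

theorem IsParam.linearIndependent (h : IsParam W F Φ br) {E : Fin n → Fin n → ℝ}
    (hE : LinearIndependent ℝ E) : LinearIndependent ℝ (fun i => restr W (Φ (E i))) := by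
  refine hE.map' (restrₗ W ∘ₗ Φ) (LinearMap.ker_eq_bot'.2 fun v hv => ?_)
  exact h.inj v fun p hp => congrFun hv ⟨p, hp⟩

theorem span_restr {E : Fin n → Fin n → ℝ} (hE : LinearIndependent ℝ E) :
    Submodule.span ℝ (Set.range fun i => restr W (Φ (E i))) = LinearMap.range (restrₗ W ∘ₗ Φ) := by
  have h1 := hE.span_eq_top_of_card_eq_finrank' (by simp)
  have h2 := congrArg (Submodule.map (restrₗ W ∘ₗ Φ)) h1
  rw [Submodule.map_span, Submodule.map_top, ← Set.range_comp] at h2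
  exact h2

theorem IsParam.isMaximalAlgebra (h : IsParam W F Φ br)
    {E : Fin n → Fin n → ℝ} (hE : LinearIndependent ℝ E) {Q : Fin n → VF}
    (hQ : ∀ i, Q i = Φ (E i)) : IsMaximalAlgebra W F Q := by
  obtain rfl : Q = fun i => Φ (E i) := funext hQ
  refine ⟨fun i => h.symmetry _, h.linearIndependent hE, fun R hR => ?_, fun i j => ?_⟩
  · rw [span_restr hE]
    obtain ⟨v, hv⟩ := h.maximal R hR
    exact ⟨v, funext fun p => (hv p.2).symm⟩
  · rw [span_restr hE]
    exact ⟨br (E i) (E j), funext fun p => (h.bracket (E i) (E j) p.2).symm⟩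

theorem IsParam.hasStructConst {Φ : (Fin 4 → ℝ) →ₗ[ℝ] VF}
    {br : (Fin 4 → ℝ) → (Fin 4 → ℝ) → Fin 4 → ℝ} (h : IsParam W F Φ br)
    {E : Fin 4 → Fin 4 → ℝ} (hE : LinearIndependent ℝ E) {Q : Fin 4 → VF}
    (hQ : ∀ i, Q i = Φ (E i)) {E' : Fin 4 → Fin 4 → ℝ} (hE' : LinearIndependent ℝ E')
    {C : StructConst} (hC : ∀ i j, br (E' i) (E' j) = ∑ l, C i j l • E' l) :
    HasStructConst W Q C := by
  obtain rfl : Q = fun i => Φ (E i) := funext hQ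
  refine ⟨fun i => Φ (E' i), h.linearIndependent hE', ?_, fun i j p hp => ?_⟩
  · rw [span_restr hE, span_restr hE']
  · rw [h.bracket _ _ hp, hC]
    simp [map_sum]

theorem lieBracket_symField {c c₁ c₂ d d₁ d₂ : ℝ} {a b : ℝ → ℝ} {p : Pt}
    (ha : DifferentiableAt ℝ a p.2.1) (hb : DifferentiableAt ℝ b p.2.1) :
    VectorField.lieBracket ℝ (symField c c₁ c₂ a) (symField d d₁ d₂ b) p =
      symField 0 (d * c₁ - c * d₁) (d * c₂ - c * d₂)
        (fun x => (c * x + c₂) * deriv b x - (d * x + d₂) * deriv a x) p := by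
  have key : ∀ {c c₁ c₂ : ℝ} {a : ℝ → ℝ}, DifferentiableAt ℝ a p.2.1 → ∀ v : Pt,
      fderiv ℝ (symField c c₁ c₂ a) p v =
        (c * v.1, c * v.2.1, deriv a p.2.1 * v.2.1 * p.2.2 + a p.2.1 * v.2.2) := by
    intro c c₁ c₂ a ha v
    have h1 : HasFDerivAt (fun p : Pt => c * p.1 + c₁) _ p :=
      ((hasFDerivAt_fst (𝕜 := ℝ) (p := p)).const_mul c).add_const c₁
    have h2 : HasFDerivAt (fun p : Pt => c * p.2.1 + c₂) _ p :=
      (((hasFDerivAt_fst (𝕜 := ℝ) (p := p.2)).comp p hasFDerivAt_snd).const_mul c).add_const c₂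
    have h3 : HasFDerivAt (fun p : Pt => a p.2.1 * p.2.2) _ p :=
      (hasFDerivAt_comp_x ha).mul ((hasFDerivAt_snd (𝕜 := ℝ) (p := p.2)).comp p hasFDerivAt_snd)
    have h4 : HasFDerivAt (symField c c₁ c₂ a) _ p := h1.prodMk (h2.prodMk h3)
    rw [h4.fderiv]
    simp
    ring
  rw [VectorField.lieBracket, key ha, key hb]
  simp only [symField, Prod.mk_sub_mk]
  refine Prod.ext ?_ (Prod.ext ?_ ?_) <;> simp only <;> ring

end Param

/-! ### The algebra of the free equation -/

section Free

variable {W : Set Pt}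

theorem inClass_freeEq (hW : IsAdmissible W) : InClass W freeEq :=
  ⟨hW, contDiffOn_const, contDiffOn_const, contDiffOn_const⟩

theorem op_freeEq (a : ℝ → ℝ) (x : ℝ) : freeEq.op a x = deriv (deriv a) x := by
  simp [WaveEq.op, freeEq]

theorem fundPair_freeEq (J : Set ℝ) : FundPair J freeEq (fun x => x) (fun _ => 1) where
  smooth₁ := contDiffOn_id
  smooth₂ := contDiffOn_const
  op₁ x _ := by
    have : deriv (fun x : ℝ => x) = fun _ => 1 := funext fun x => deriv_id x
    rw [op_freeEq, this, deriv_const]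
  op₂ x _ := by simp [op_freeEq]
  wronskian x _ := by simp

theorem determining_freeEq {c c₁ c₂ : ℝ} {a : ℝ → ℝ} :
    Determining W freeEq c c₁ c₂ a ↔
      ContDiffOn ℝ ∞ a (projX W) ∧ ∀ x ∈ projX W, freeEq.op a x = 0 := by
  have e1 : ∀ x, deriv freeEq.A x = 0 := fun x => deriv_const x 0
  have e2 : ∀ x, deriv freeEq.B x = 0 := fun x => deriv_const x 0
  have e3 : ∀ t x, dt freeEq.D t x = 0 := fun t x => deriv_const t 0
  have e4 : ∀ t x, dx freeEq.D t x = 0 := fun t x => deriv_const x 0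
  constructor
  · rintro ⟨h1, -, -, h4⟩
    refine ⟨h1, fun x hx => ?_⟩
    obtain ⟨t, ht⟩ := exists_of_mem_projX hx
    have := h4 t x ht
    rw [e3, e4] at this
    simpa [freeEq] using this
  · rintro ⟨h1, h2⟩
    refine ⟨h1, fun x _ => by rw [e1]; simp [freeEq], fun x _ => by rw [e2]; simp [freeEq],
      fun t x htx => ?_⟩
    rw [h2 x (mem_projX_of_projTX htx), e3, e4]
    simp [freeEq]

/-- The vector field with coordinates `v` in the basis `freeBasis`. -/
def freeField : (Fin 5 → ℝ) →ₗ[ℝ] VF where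
  toFun v := symField (v 2) (v 0) (v 1) (fun x => v 3 * x + v 4 * 1)
  map_add' v w := by
    funext p
    refine Prod.ext ?_ (Prod.ext ?_ ?_) <;>
      simp only [symField, Pi.add_apply, Prod.fst_add, Prod.snd_add] <;> ring
  map_smul' k v := by
    funext p
    refine Prod.ext ?_ (Prod.ext ?_ ?_) <;>
      simp only [symField, Pi.smul_apply, Prod.smul_fst, Prod.smul_snd, smul_eq_mul,
        RingHom.id_apply] <;> ring

theorem isParam_freeEq (hW : IsAdmissible W) : IsParam W freeEq.rhs freeField fun v w =>
    ![w 2 * v 0 - v 2 * w 0, w 2 * v 1 - v 2 * w 1, 0, v 2 * w 3 - w 2 * v 3,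
      v 1 * w 3 - w 1 * v 3] := by
  have he := inClass_freeEq hW
  have hJ := isOpen_projX hW.isOpen
  have hd : ∀ (k l x : ℝ), HasDerivAt (fun x => k * x + l * 1) k x := fun k l x => by
    simpa using ((hasDerivAt_id x).const_mul k).add_const (l * 1)
  refine ⟨fun v => ?_, fun v hv => ?_, fun R hR => ?_, fun v w p hp => ?_⟩
  · refine Determining.isSymmetry (a := fun x => v 3 * x + v 4 * 1) he
      (determining_freeEq.2 ⟨by fun_prop, fun x hx => ?_⟩)
    rw [op_eq (J := Set.univ) isOpen_univ (fun x _ => hd (v 3) (v 4) x) trivial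
      (hasDerivAt_const x (v 3))]
    simp [freeEq]
  · obtain ⟨h2, h0, h1, h⟩ := symField_eq_zero (c := v 2) (c₁ := v 0) (c₂ := v 1)
      (a := fun x => v 3 * x + v 4 * 1) hW hv
    obtain ⟨h3, h4⟩ := (fundPair_freeEq (projX W)).eq_zero_of_comb hJ
      (hW.isConnected.nonempty.image _) h
    funext i
    fin_cases i <;> assumption
  · obtain ⟨c, c₁, c₂, a, h, hE⟩ := hR.exists_determining he
    obtain ⟨h1, h2⟩ := determining_freeEq.1 h
    obtain ⟨α, β, hab⟩ := (fundPair_freeEq (projX W)).exists_comb hJ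
      (isPreconnected_projX hW.isConnected.isPreconnected) h1 h2
    refine ⟨![c₁, c₂, c, α, β], fun p hp => ?_⟩
    rw [hE hp, symField, hab _ (mem_projX hp)]
    rfl
  · refine (lieBracket_symField (hd _ _ _).differentiableAt (hd _ _ _).differentiableAt).trans ?_
    rw [freeField]
    simp only [symField, (hd _ _ _).deriv, LinearMap.coe_mk, AddHom.coe_mk]
    refine Prod.ext (by simp) (Prod.ext (by simp) ?_)
    simp [-mul_eq_mul_right_iff]
    ring

theorem isMaximalAlgebra_freeEq (hW : IsAdmissible W) :
    IsMaximalAlgebra W freeEq.rhs freeBasis := by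
  refine (isParam_freeEq hW).isMaximalAlgebra (E := fun i => Pi.single i 1)
    (Pi.linearIndependent_single_one (Fin 5) ℝ) fun i => ?_
  funext p
  fin_cases i <;> simp [freeBasis, freeField, symField, dT, dX, dil, uU]

end Free

/-! ### Four-dimensional algebras with a basis `T, X, h₁ u ∂_u, h₂ u ∂_u` -/

/-- Structure constants of a Lie algebra with basis `T, X, H₁, H₂` and brackets
`[T, X] = c T - ρ₁ H₁ - ρ₂ H₂`, `[T, H₁] = ν H₂`, `[X, H₁] = p H₁ + q H₂`,
`[X, H₂] = r H₁ + s H₂`, the others being zero. -/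
structure Table where
  c : ℝ
  ρ₁ : ℝ
  ρ₂ : ℝ
  p : ℝ
  q : ℝ
  r : ℝ
  s : ℝ
  ν : ℝ

/-- The bracket in coordinates. -/
def Table.br (M : Table) (v w : Fin 4 → ℝ) : Fin 4 → ℝ :=
  ![M.c * (v 0 * w 1 - v 1 * w 0), 0,
    -M.ρ₁ * (v 0 * w 1 - v 1 * w 0) + M.p * (v 1 * w 2 - v 2 * w 1)
      + M.r * (v 1 * w 3 - v 3 * w 1),
    -M.ρ₂ * (v 0 * w 1 - v 1 * w 0) + M.q * (v 1 * w 2 - v 2 * w 1)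
      + M.s * (v 1 * w 3 - v 3 * w 1) + M.ν * (v 0 * w 2 - v 2 * w 0)]

/-- A basis of the algebra has structure constants in the given set. -/
def Table.HasType (M : Table) (S : Set StructConst) : Prop :=
  ∃ C ∈ S, ∃ E : Fin 4 → Fin 4 → ℝ, LinearIndependent ℝ E ∧
    ∀ i j, M.br (E i) (E j) = ∑ l, C i j l • E l

/-- The symmetry algebra on `W` has the basis `T = τ ∂_t + ξ ∂_x + g(x) u ∂_u`,
`X = c t ∂_t + (c x + c₂) ∂_x`, `h₁(x) u ∂_u`, `h₂(x) u ∂_u` with the brackets of `M`. -/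
structure IsFrame (W : Set Pt) (e : WaveEq) (M : Table) (τ ξ c₂ : ℝ) (g h₁ h₂ : ℝ → ℝ) :
    Prop where
  pair : FundPair (projX W) e h₁ h₂
  detT : Determining W e 0 τ ξ g
  detX : Determining W e M.c 0 c₂ 0
  indep : ∀ v w : ℝ, w * M.c = 0 → v * τ = 0 → v * ξ + w * c₂ = 0 → v = 0 ∧ w = 0
  maximal : ∀ b b₁ b₂ a, Determining W e b b₁ b₂ a →
    ∃ v w : ℝ, b = w * M.c ∧ b₁ = v * τ ∧ b₂ = v * ξ + w * c₂
  bracket_TX : ∀ x ∈ projX W, M.c * g x + (M.c * x + c₂) * deriv g x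
    = M.ρ₁ * h₁ x + M.ρ₂ * h₂ x
  bracket_XH₁ : ∀ x ∈ projX W, (M.c * x + c₂) * deriv h₁ x = M.p * h₁ x + M.q * h₂ x
  bracket_XH₂ : ∀ x ∈ projX W, (M.c * x + c₂) * deriv h₂ x = M.r * h₁ x + M.s * h₂ x
  bracket_TH₁ : ∀ x ∈ projX W, ξ * deriv h₁ x = M.ν * h₂ x
  bracket_TH₂ : ∀ x ∈ projX W, ξ * deriv h₂ x = 0

/-- The vector field with coordinates `v`. -/
def frameField (c τ ξ c₂ : ℝ) (g h₁ h₂ : ℝ → ℝ) : (Fin 4 → ℝ) →ₗ[ℝ] VF where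
  toFun v := symField (v 1 * c) (v 0 * τ) (v 0 * ξ + v 1 * c₂)
    (fun x => v 0 * g x + (v 2 * h₁ x + v 3 * h₂ x))
  map_add' v w := by
    funext p
    refine Prod.ext ?_ (Prod.ext ?_ ?_) <;>
      simp only [symField, Pi.add_apply, Prod.fst_add, Prod.snd_add] <;> ring
  map_smul' k v := by
    funext p
    refine Prod.ext ?_ (Prod.ext ?_ ?_) <;>
      simp only [symField, Pi.smul_apply, Prod.smul_fst, Prod.smul_snd, smul_eq_mul,
        RingHom.id_apply] <;> ring

section Frame

variable {W : Set Pt} {e : WaveEq} {M : Table} {τ ξ c₂ : ℝ} {g h₁ h₂ : ℝ → ℝ}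

theorem IsFrame.isParam (h : IsFrame W e M τ ξ c₂ g h₁ h₂) (he : InClass W e) :
    IsParam W e.rhs (frameField M.c τ ξ c₂ g h₁ h₂) M.br := by
  have hW := he.domain.isOpen
  have hJ := isOpen_projX hW
  have hne : (projX W).Nonempty := he.domain.isConnected.nonempty.image _
  have hH : ∀ {f : ℝ → ℝ}, ContDiffOn ℝ ∞ f (projX W) → (∀ x ∈ projX W, e.op f x = 0) →
      Determining W e 0 0 0 f := fun hs ho =>
    ⟨hs, fun x _ => by ring, fun x _ => by ring, fun t x htx => by
      rw [ho x (mem_projX_of_projTX htx)]; ring⟩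
  have dg : ∀ x ∈ projX W, HasDerivAt g (deriv g x) x := fun x hx =>
    (hasDerivAt_of_smooth hJ h.detT.smooth hx).1
  have hd : ∀ (v : Fin 4 → ℝ), ∀ x ∈ projX W,
      HasDerivAt (fun x => v 0 * g x + (v 2 * h₁ x + v 3 * h₂ x))
        (v 0 * deriv g x + (v 2 * deriv h₁ x + v 3 * deriv h₂ x)) x := fun v x hx =>
    ((dg x hx).const_mul _).fun_add
      (((hasDerivAt_of_smooth hJ h.pair.smooth₁ hx).1.const_mul _).fun_add
        ((hasDerivAt_of_smooth hJ h.pair.smooth₂ hx).1.const_mul _))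
  refine ⟨fun v => ?_, fun v hv => ?_, fun R hR => ?_, fun v w y hy => ?_⟩
  · have h1 := ((h.detT.smul hW (v 0)).add hW (h.detX.smul hW (v 1))).add hW
      (((hH h.pair.smooth₁ h.pair.op₁).smul hW (v 2)).add hW
        ((hH h.pair.smooth₂ h.pair.op₂).smul hW (v 3)))
    convert h1.isSymmetry he using 1
    funext p
    refine Prod.ext ?_ (Prod.ext ?_ ?_) <;> simp [frameField, symField]
  · obtain ⟨e1, e0, e2, e3⟩ := symField_eq_zero (c := v 1 * M.c) (c₁ := v 0 * τ)
      (c₂ := v 0 * ξ + v 1 * c₂) (a := fun x => v 0 * g x + (v 2 * h₁ x + v 3 * h₂ x))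
      he.domain hv
    obtain ⟨z0, z1⟩ := h.indep _ _ e1 e0 e2
    obtain ⟨z2, z3⟩ := h.pair.eq_zero_of_comb hJ hne (α := v 2) (β := v 3)
      fun x hx => by simpa [z0] using e3 x hx
    funext i
    fin_cases i <;> assumption
  · obtain ⟨b, b₁, b₂, a, hdet, hE⟩ := hR.exists_determining he
    obtain ⟨v, w, rfl, rfl, rfl⟩ := h.maximal _ _ _ _ hdet
    have h1 := hdet.add hW ((h.detT.smul hW (-v)).add hW (h.detX.smul hW (-w)))
    obtain ⟨α, β, hab⟩ := h.pair.exists_comb hJ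
      (isPreconnected_projX he.domain.isConnected.isPreconnected) h1.smooth fun x hx => by
        obtain ⟨t, ht⟩ := exists_of_mem_projX hx
        linear_combination h1.eqD t x ht
    refine ⟨![v, w, α, β], fun p hp => ?_⟩
    have h2 := hab _ (mem_projX hp)
    simp only [Pi.add_apply, Pi.smul_apply, smul_eq_mul, Pi.zero_apply] at h2
    have h3 : a p.2.1 = v * g p.2.1 + (α * h₁ p.2.1 + β * h₂ p.2.1) := by linarith
    rw [hE hp, symField, h3]
    rfl
  · have hy' := mem_projX hy
    refine (lieBracket_symField (hd v _ hy').differentiableAt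
      (hd w _ hy').differentiableAt).trans ?_
    have d1 := h.bracket_XH₁ _ hy'
    have d2 := h.bracket_XH₂ _ hy'
    have b1 := h.bracket_TX _ hy'
    have b2 := h.bracket_TH₁ _ hy'
    have b3 := h.bracket_TH₂ _ hy'
    rw [frameField]
    simp only [symField, (hd _ _ hy').deriv, LinearMap.coe_mk, AddHom.coe_mk, Table.br]
    refine Prod.ext ?_ (Prod.ext ?_ ?_)
    · simp; ring
    · simp; ring
    · simp [-mul_eq_mul_right_iff]
      linear_combination y.2.2 * ((v 1 * w 0 - v 0 * w 1) * b1 + (v 1 * w 2 - v 2 * w 1) * d1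
        + (v 1 * w 3 - v 3 * w 1) * d2 + (v 0 * w 2 - v 2 * w 0) * b2
        + (v 0 * w 3 - v 3 * w 0) * b3)

/-- What has to be verified for an entry of the list. -/
theorem IsFrame.verify (h : IsFrame W e M τ ξ c₂ g h₁ h₂) (he : InClass W e) {S : Set StructConst}
    (hS : M.HasType S) {T X : VF} {Q : Fin 4 → VF} (hT : T = symField 0 τ ξ g)
    (hX : X = symField M.c 0 c₂ 0)
    (hQ : Q = ![T, X, uU h₁, uU h₂] ∨ Q = ![X, T, uU h₁, uU h₂]) :
    InClass W e ∧ IsMaximalAlgebra W e.rhs Q ∧ symDim W e.rhs = 4 ∧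
      ∃ C ∈ S, HasStructConst W Q C := by
  have hP := h.isParam he
  -- the coordinates of the listed basis
  obtain ⟨E, hE, hQE⟩ : ∃ E : Fin 4 → Fin 4 → ℝ, LinearIndependent ℝ E ∧
      ∀ i, Q i = frameField M.c τ ξ c₂ g h₁ h₂ (E i) := by
    have hb := Pi.linearIndependent_single_one (Fin 4) ℝ
    subst hT hX
    rcases hQ with rfl | rfl
    · refine ⟨_, hb, fun i => funext fun p => ?_⟩
      fin_cases i <;> simp [frameField, symField, uU]
    · refine ⟨_, hb.comp (Equiv.swap 0 1) (Equiv.injective _), fun i => funext fun p => ?_⟩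
      fin_cases i <;> simp [frameField, symField, uU, Equiv.swap_apply_def]
  have hm := hP.isMaximalAlgebra hE hQE
  obtain ⟨C, hC, E', hE', hbr⟩ := hS
  exact ⟨he, hm, hm.symDim_eq, C, hC, hP.hasStructConst hE hQE hE' hbr⟩

end Frame

/-! ### Frames for the normal forms -/

section NormalFrames

variable {W : Set Pt} {e : WaveEq} {p q r s n m k : ℝ} {g h₁ h₂ : ℝ → ℝ}

theorem SpanPair.mul_deriv₁ {J : Set ℝ} {c c₂ : ℝ} (H : SpanPair J c c₂ p q r s h₁ h₂) {x : ℝ}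
    (hx : x ∈ J) : (c * x + c₂) * deriv h₁ x = p * h₁ x + q * h₂ x := by
  rw [(H.deriv₁ x hx).deriv, mul_div_cancel₀ _ (H.ne x hx)]

theorem SpanPair.mul_deriv₂ {J : Set ℝ} {c c₂ : ℝ} (H : SpanPair J c c₂ p q r s h₁ h₂) {x : ℝ}
    (hx : x ∈ J) : (c * x + c₂) * deriv h₂ x = r * h₁ x + s * h₂ x := by
  rw [(H.deriv₂ x hx).deriv, mul_div_cancel₀ _ (H.ne x hx)]

theorem projX_ne_zero (hr : projTX W ⊆ xNonzero) : ∀ x ∈ projX W, x ≠ 0 := fun x hx => by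
  obtain ⟨t, ht⟩ := exists_of_mem_projX hx
  exact hr ht

theorem inClass_constEq (hW : IsAdmissible W) : InClass W (constEq n m k) :=
  ⟨hW, contDiffOn_const, contDiffOn_const, ContDiff.contDiffOn (by simp only [constEq]; fun_prop)⟩

theorem inClass_powEq (hW : IsAdmissible W) (hr : projTX W ⊆ xNonzero) :
    InClass W (powEq n m k) := by
  have h0 := projX_ne_zero hr
  refine ⟨hW, contDiffOn_const.mul (contDiffOn_id.inv h0),
    contDiffOn_const.mul (ContDiffOn.inv (by fun_prop) fun x hx => pow_ne_zero 2 (h0 x hx)), ?_⟩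
  exact ContDiffOn.mul (by fun_prop)
    (ContDiffOn.inv (by fun_prop) fun x hx => pow_ne_zero 3 (hr hx))

theorem hasDerivAt_pow_inv (n : ℕ) {x : ℝ} (hx : x ≠ 0) :
    HasDerivAt (fun x : ℝ => (x ^ n)⁻¹) (-n * (x ^ (n + 1))⁻¹) x := by
  refine ((hasDerivAt_pow n x).fun_inv (pow_ne_zero n hx)).congr_deriv ?_
  cases n with
  | zero => simp
  | succ n =>
    rw [Nat.add_sub_cancel]
    field_simp
    ring

theorem powEq_deriv (t : ℝ) {x : ℝ} (hx : x ≠ 0) :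
    deriv (powEq n m k).A x = -n * (x ^ 2)⁻¹ ∧ deriv (powEq n m k).B x = -2 * m * (x ^ 3)⁻¹ ∧
      dt (powEq n m k).D t x = k * (x ^ 3)⁻¹ ∧ dx (powEq n m k).D t x = -3 * k * t * (x ^ 4)⁻¹ := by
  refine ⟨?_, ?_, ?_, ?_⟩
  · have := ((hasDerivAt_pow_inv 1 hx).const_mul n).deriv
    simp only [pow_one] at this
    exact this.trans (by push_cast; ring)
  · exact ((hasDerivAt_pow_inv 2 hx).const_mul m).deriv.trans (by push_cast; ring)
  · exact (((hasDerivAt_id' t).const_mul k).mul_const (x ^ 3)⁻¹).deriv.trans (by ring)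
  · exact ((hasDerivAt_pow_inv 3 hx).const_mul (k * t)).deriv.trans (by push_cast; ring)

theorem constEq_deriv (t x : ℝ) :
    deriv (constEq n m k).A x = 0 ∧ deriv (constEq n m k).B x = 0 ∧
      dt (constEq n m k).D t x = k ∧ dx (constEq n m k).D t x = 0 := by
  refine ⟨deriv_const x n, deriv_const x m, ?_, deriv_const x (k * t)⟩
  exact ((hasDerivAt_id' t).const_mul k).deriv.trans (mul_one k)

/-- Equations with coefficients `n, m, k t`: the symmetry `∂_x`, and `∂_t + g(x) u ∂_u` for a
quadratic polynomial `g` with `g'' + n g' + m g = -k`. -/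
theorem isFrame_constEq (hW : IsAdmissible W) (H : SpanPair (projX W) 0 1 p q r s h₁ h₂)
    (htr : p + s = -n) (hdet : p * s - q * r = m) (h0 : n ≠ 0 ∨ m ≠ 0 ∨ k ≠ 0)
    {α₀ α₁ α₂ ρ₁ ρ₂ : ℝ} (e0 : m * α₀ + n * α₁ + 2 * α₂ = -k) (e1 : m * α₁ + 2 * n * α₂ = 0)
    (e2 : m * α₂ = 0)
    (hρ : ∀ x ∈ projX W, α₁ + 2 * α₂ * x = ρ₁ * h₁ x + ρ₂ * h₂ x) :
    IsFrame W (constEq n m k) ⟨0, ρ₁, ρ₂, p, q, r, s, 0⟩ 1 0 1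
      (fun x => α₀ + α₁ * x + α₂ * x ^ 2) h₁ h₂ := by
  have hJ := isOpen_projX hW.isOpen
  have D1 : ∀ x : ℝ, HasDerivAt (fun x => α₀ + α₁ * x + α₂ * x ^ 2) (α₁ + 2 * α₂ * x) x := fun x =>
    ((((hasDerivAt_id' x).const_mul α₁).const_add α₀).fun_add
      ((hasDerivAt_pow 2 x).const_mul α₂)).congr_deriv (by push_cast; ring)
  have D2 : ∀ x : ℝ, HasDerivAt (fun x => α₁ + 2 * α₂ * x) (2 * α₂) x := fun x => by
    simpa using ((hasDerivAt_id' x).const_mul (2 * α₂)).const_add α₁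
  have hpair : FundPair (projX W) (constEq n m k) h₁ h₂ :=
    H.fundPair hJ (n := n) (m := m) (by simp [constEq]) (by simp [constEq]) (by linarith) hdet
  have hdT : Determining W (constEq n m k) 0 1 0 (fun x => α₀ + α₁ * x + α₂ * x ^ 2) := by
    refine ⟨by fun_prop, fun x _ => by ring_nf, fun x _ => by ring_nf, fun t x htx => ?_⟩
    obtain ⟨-, -, d3, d4⟩ := constEq_deriv (n := n) (m := m) (k := k) t x
    rw [d3, op_eq hJ (fun x _ => D1 x) (mem_projX_of_projTX htx) (D2 x)]
    simp only [constEq]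
    linear_combination e0 + x * e1 + x ^ 2 * e2
  have hop : ∀ x, (constEq n m k).op 0 x = 0 := fun x => by
    have : deriv (0 : ℝ → ℝ) = 0 := deriv_const' 0
    rw [WaveEq.op, this, this]
    simp
  refine ⟨hpair, hdT, ⟨contDiffOn_const, fun x _ => ?_, fun x _ => ?_, fun t x _ => ?_⟩,
    fun v w _ h1 h2 => ?_, fun b b₁ b₂ a hd => ?_, fun x hx => ?_,
    fun x hx => H.mul_deriv₁ hx, fun x hx => H.mul_deriv₂ hx, fun x _ => ?_, fun x _ => ?_⟩
  · rw [(constEq_deriv 0 x).1]; ring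
  · rw [(constEq_deriv 0 x).2.1]; ring
  · rw [(constEq_deriv t x).2.2.2, hop]; ring
  · exact ⟨by simpa using h1, by simpa using h2⟩
  · refine ⟨b₁, b₂, ?_, by simp, by simp⟩
    simp only [mul_zero]
    obtain ⟨x, hx⟩ : (projX W).Nonempty := hW.isConnected.nonempty.image _
    rcases h0 with h | h | h
    · have := hd.eqA x hx
      rw [(constEq_deriv 0 x).1] at this
      simpa [constEq, h] using this
    · have := hd.eqB x hx
      rw [(constEq_deriv 0 x).2.1] at this
      simpa [constEq, h] using this
    · have := affine_eq_zero hW.isOpen (α := fun _ => 3 * b * k)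
        (β := fun x => (constEq n m k).op a x + b₁ * k) (fun t x htx => by
          have := hd.eqD t x htx
          rw [(constEq_deriv t x).2.2.1, (constEq_deriv t x).2.2.2] at this
          simp only [constEq] at this ⊢
          linear_combination this) x hx
      simpa [h] using this
  · rw [(D1 x).deriv]
    linear_combination hρ x hx
  · ring
  · ring

/-- Equations with coefficients `n x⁻¹, m x⁻², k t x⁻³`: the symmetry `t ∂_t + x ∂_x`, and
`∂_t + g(x) u ∂_u`, where `x g` is a quadratic polynomial in `ln |x|`. -/
theorem isFrame_powEq (hW : IsAdmissible W) (hr : projTX W ⊆ xNonzero)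
    (H : SpanPair (projX W) 1 0 p q r s h₁ h₂)
    (htr : p + s = 1 - n) (hdet : p * s - q * r = m) (h0 : n ≠ 0 ∨ m ≠ 0 ∨ k ≠ 0)
    {α₀ α₁ α₂ ρ₁ ρ₂ : ℝ} (e0 : (2 - n + m) * α₀ + (n - 3) * α₁ + 2 * α₂ = -k)
    (e1 : (2 - n + m) * α₁ + 2 * (n - 3) * α₂ = 0) (e2 : (2 - n + m) * α₂ = 0)
    (hρ : ∀ x ∈ projX W, x⁻¹ * (α₁ + 2 * α₂ * Real.log |x|) = ρ₁ * h₁ x + ρ₂ * h₂ x) :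
    IsFrame W (powEq n m k) ⟨1, ρ₁, ρ₂, p, q, r, s, 0⟩ 1 0 0
      (fun x => x⁻¹ * (α₀ + α₁ * Real.log |x| + α₂ * Real.log |x| ^ 2)) h₁ h₂ := by
  have hJ := isOpen_projX hW.isOpen
  have hx0 := projX_ne_zero hr
  have hlog : ∀ x ∈ projX W, HasDerivAt (fun x => Real.log |x|) x⁻¹ x := fun x hx => by
    simpa only [Real.log_abs] using Real.hasDerivAt_log (hx0 x hx)
  have hi : ∀ x ∈ projX W, HasDerivAt (fun x : ℝ => x⁻¹) (-(x ^ 2)⁻¹) x := fun x hx =>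
    hasDerivAt_inv (hx0 x hx)
  -- differentiation of `x⁻¹ y(ln |x|)`
  have D0 : ∀ (y₀ y₁ y₂ : ℝ), ∀ x ∈ projX W,
      HasDerivAt (fun x => y₀ + y₁ * Real.log |x| + y₂ * Real.log |x| ^ 2)
        (x⁻¹ * (y₁ + 2 * y₂ * Real.log |x|)) x := fun y₀ y₁ y₂ x hx =>
    ((((hlog x hx).const_mul y₁).const_add y₀).fun_add
      (((hlog x hx).fun_pow 2).const_mul y₂)).congr_deriv (by push_cast; ring)
  have D1 : ∀ x ∈ projX W, HasDerivAt
      (fun x => x⁻¹ * (α₀ + α₁ * Real.log |x| + α₂ * Real.log |x| ^ 2))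
      (x⁻¹ * (x⁻¹ * (α₁ - α₀ + (2 * α₂ - α₁) * Real.log |x| + -α₂ * Real.log |x| ^ 2))) x :=
    fun x hx => ((hi x hx).fun_mul (D0 _ _ _ x hx)).congr_deriv (by ring)
  have D2 : ∀ x ∈ projX W, HasDerivAt
      (fun x => x⁻¹ * (x⁻¹ * (α₁ - α₀ + (2 * α₂ - α₁) * Real.log |x| + -α₂ * Real.log |x| ^ 2)))
      (x⁻¹ ^ 3 * (2 * α₂ - 3 * α₁ + 2 * α₀ + (2 * α₁ - 6 * α₂) * Real.log |x|
        + 2 * α₂ * Real.log |x| ^ 2)) x :=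
    fun x hx => ((hi x hx).fun_mul ((hi x hx).fun_mul (D0 _ _ _ x hx))).congr_deriv (by ring)
  have hpair : FundPair (projX W) (powEq n m k) h₁ h₂ :=
    H.fundPair hJ (n := n) (m := m) (by simp [powEq]) (by simp [powEq]) htr hdet
  have hsm : ContDiffOn ℝ ∞ (fun x => x⁻¹ * (α₀ + α₁ * Real.log |x| + α₂ * Real.log |x| ^ 2))
      (projX W) := by
    have hl : ContDiffOn ℝ ∞ (fun x => Real.log |x|) (projX W) := by
      simpa only [Real.log_abs] using ContDiffOn.log (f := fun x => x) contDiffOn_id hx0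
    exact (contDiffOn_id.inv hx0).mul ((contDiffOn_const.add (contDiffOn_const.mul hl)).add
      (contDiffOn_const.mul (hl.pow 2)))
  have hdT : Determining W (powEq n m k) 0 1 0
      (fun x => x⁻¹ * (α₀ + α₁ * Real.log |x| + α₂ * Real.log |x| ^ 2)) := by
    refine ⟨hsm, fun x _ => by ring_nf, fun x _ => by ring_nf, fun t x htx => ?_⟩
    have hx := mem_projX_of_projTX htx
    obtain ⟨-, -, d3, d4⟩ := powEq_deriv (n := n) (m := m) (k := k) t (hx0 x hx)
    rw [d3, op_eq hJ D1 hx (D2 x hx)]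
    simp only [powEq]
    linear_combination x⁻¹ ^ 3 * e0 + x⁻¹ ^ 3 * Real.log |x| * e1 + x⁻¹ ^ 3 * Real.log |x| ^ 2 * e2
  have hop : ∀ x, (powEq n m k).op 0 x = 0 := fun x => by
    have : deriv (0 : ℝ → ℝ) = 0 := deriv_const' 0
    rw [WaveEq.op, this, this]
    simp
  refine ⟨hpair, hdT, ⟨contDiffOn_const, fun x hx => ?_, fun x hx => ?_, fun t x htx => ?_⟩,
    fun v w h1 h2 _ => ?_, fun b b₁ b₂ a hd => ?_, fun x hx => ?_,
    fun x hx => H.mul_deriv₁ hx, fun x hx => H.mul_deriv₂ hx, fun x _ => ?_, fun x _ => ?_⟩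
  · rw [(powEq_deriv 0 (hx0 x hx)).1]
    have := hx0 x hx
    simp only [powEq]
    field_simp
    ring
  · rw [(powEq_deriv 0 (hx0 x hx)).2.1]
    have := hx0 x hx
    simp only [powEq]
    field_simp
    ring
  · have := hx0 x (mem_projX_of_projTX htx)
    rw [(powEq_deriv t this).2.2.1, (powEq_deriv t this).2.2.2, hop]
    simp only [powEq]
    field_simp
    ring
  · exact ⟨by simpa using h2, by simpa using h1⟩
  · refine ⟨b₁, b, by simp, by simp, ?_⟩
    simp only [mul_zero, add_zero]
    obtain ⟨x, hx⟩ : (projX W).Nonempty := hW.isConnected.nonempty.image _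
    have hx' := hx0 x hx
    rcases h0 with h | h | h
    · have := hd.eqA x hx
      rw [(powEq_deriv 0 hx').1] at this
      simp only [powEq] at this
      field_simp at this
      have h2 : n * b₂ = 0 := by linear_combination -this
      exact (mul_eq_zero.1 h2).resolve_left h
    · have := hd.eqB x hx
      rw [(powEq_deriv 0 hx').2.1] at this
      simp only [powEq] at this
      field_simp at this
      have h2 : m * b₂ = 0 := by linear_combination -this / 2
      exact (mul_eq_zero.1 h2).resolve_left h
    · have := affine_eq_zero hW.isOpen (α := fun x => -3 * k * b₂ * (x ^ 4)⁻¹)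
        (β := fun x => (powEq n m k).op a x + b₁ * k * (x ^ 3)⁻¹) (fun t x htx => by
          have hx' := hx0 x (mem_projX_of_projTX htx)
          have := hd.eqD t x htx
          rw [(powEq_deriv t hx').2.2.1, (powEq_deriv t hx').2.2.2] at this
          simp only [powEq] at this ⊢
          rw [← this]
          field_simp
          ring) x hx
      simpa [h, hx'] using this
  · rw [(D1 x hx).deriv, ← hρ x hx]
    have := hx0 x hx
    field_simp
    ring
  · ring
  · ring

/-- Equations with `A = B = 0` and `D = K z⁻²`, where `z = μ t + l x`. -/
theorem isFrame_wave (he : InClass W e) (hA : ∀ x, e.A x = 0) (hB : ∀ x, e.B x = 0)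
    {K μ l τ ξ : ℝ} (hK : K ≠ 0) (hμ : μ ≠ 0) (hξ : ξ ≠ 0) (hτ : τ * μ + ξ * l = 0)
    (hD : ∀ t x, e.D t x = K * ((μ * t + l * x) ^ 2)⁻¹)
    (hz : ∀ t x, (t, x) ∈ projTX W → μ * t + l * x ≠ 0) :
    IsFrame W e ⟨1, 0, 0, 1, 0, 0, 0, ξ⟩ τ ξ 0 (fun _ => 0) (fun x => x) (fun _ => 1) := by
  have hW := he.domain
  have hA' : ∀ x, deriv e.A x = 0 := fun x => by
    rw [show e.A = fun _ => 0 from funext hA, deriv_const]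
  have hB' : ∀ x, deriv e.B x = 0 := fun x => by
    rw [show e.B = fun _ => 0 from funext hB, deriv_const]
  have hop : ∀ a x, e.op a x = deriv (deriv a) x := fun a x => by simp [WaveEq.op, hA, hB]
  have hop' : ∀ a x, e.op a x = freeEq.op a x := fun a x => by rw [hop, op_freeEq]
  have hpair : FundPair (projX W) e (fun x => x) (fun _ => 1) := by
    have h := fundPair_freeEq (projX W)
    exact ⟨h.1, h.2, fun x hx => (hop' _ _).trans (h.3 x hx),
      fun x hx => (hop' _ _).trans (h.4 x hx), h.5⟩
  have hDt : ∀ t x, (t, x) ∈ projTX W → dt e.D t x = -2 * K * μ * ((μ * t + l * x) ^ 3)⁻¹ :=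
    fun t x htx => by
      have h1 : HasDerivAt (fun s => μ * s + l * x) μ t := by
        simpa using ((hasDerivAt_id' t).const_mul μ).add_const (l * x)
      have h2 := ((hasDerivAt_pow_inv 2 (hz t x htx)).comp t h1).const_mul K
      rw [dt, show (fun s => e.D s x) = _ from funext fun s => hD s x]
      exact h2.deriv.trans (by push_cast; ring)
  have hDx : ∀ t x, (t, x) ∈ projTX W → dx e.D t x = -2 * K * l * ((μ * t + l * x) ^ 3)⁻¹ :=
    fun t x htx => by
      have h1 : HasDerivAt (fun y => μ * t + l * y) l x := by
        simpa using ((hasDerivAt_id' x).const_mul l).const_add (μ * t)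
      have h2 := ((hasDerivAt_pow_inv 2 (hz t x htx)).comp x h1).const_mul K
      rw [dx, show (fun y => e.D t y) = _ from funext fun y => hD t y]
      exact h2.deriv.trans (by push_cast; ring)
  -- the action of an arbitrary candidate on `D`
  have act : ∀ b b₁ b₂ t x, (t, x) ∈ projTX W →
      (b * t + b₁) * dt e.D t x + (b * x + b₂) * dx e.D t x + 2 * b * e.D t x
        = -2 * K * (b₁ * μ + b₂ * l) * ((μ * t + l * x) ^ 3)⁻¹ := fun b b₁ b₂ t x htx => by
    rw [hDt t x htx, hDx t x htx, hD]
    have := hz t x htx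
    field_simp
    ring
  have zero_op : ∀ x, e.op 0 x = 0 := fun x => by
    have : deriv (0 : ℝ → ℝ) = 0 := deriv_const' 0
    rw [hop, this, this]
    simp
  have det0 : ∀ b b₁ b₂, b₁ * μ + b₂ * l = 0 → Determining W e b b₁ b₂ 0 := fun b b₁ b₂ h =>
    ⟨contDiffOn_const, fun x _ => by rw [hA, hA']; ring, fun x _ => by rw [hB, hB']; ring,
      fun t x htx => by
        rw [zero_op]
        linear_combination act b b₁ b₂ t x htx - 2 * K * ((μ * t + l * x) ^ 3)⁻¹ * h⟩
  refine ⟨hpair, det0 0 τ ξ (by linarith), det0 1 0 0 (by ring), fun v w h1 _ h2 => ?_,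
    fun b b₁ b₂ a hd => ?_, fun x _ => ?_, fun x _ => ?_, fun x _ => ?_, fun x _ => ?_,
    fun x _ => ?_⟩
  · have hw : w = 0 := by simpa using h1
    subst hw
    exact ⟨by simpa [hξ] using h2, rfl⟩
  · -- compare the condition on `D` at two points with the same `x`
    obtain ⟨⟨t, x, u⟩, hp⟩ := hW.isConnected.nonempty
    obtain ⟨δ, hδ, hp'⟩ := exists_shift_t hW.isOpen hp
    have z1 := hz t x (mem_projTX hp)
    have z2 := hz (t + δ) x (mem_projTX hp')
    have h1 := hd.eqD t x (mem_projTX hp)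
    have h2 := hd.eqD (t + δ) x (mem_projTX hp')
    have h3 : -2 * K * (b₁ * μ + b₂ * l) * (((μ * t + l * x) ^ 3)⁻¹ -
        ((μ * (t + δ) + l * x) ^ 3)⁻¹) = 0 := by
      linear_combination h1 - h2 - act b b₁ b₂ t x (mem_projTX hp)
        + act b b₁ b₂ (t + δ) x (mem_projTX hp')
    have h4 : b₁ * μ + b₂ * l = 0 := by
      by_contra hne
      have h5 : (μ * t + l * x) ^ 3 = (μ * (t + δ) + l * x) ^ 3 := by
        have h6 := (mul_eq_zero.1 h3).resolve_left (mul_ne_zero (mul_ne_zero (by norm_num) hK) hne)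
        exact inv_injective (sub_eq_zero.1 h6)
      have h7 := (show Odd 3 by decide).strictMono_pow.injective h5
      have h8 : μ * δ = 0 := by linarith
      exact (mul_ne_zero hμ hδ) h8
    refine ⟨b₂ / ξ, b, by ring, ?_, by field_simp; ring⟩
    rw [div_mul_eq_mul_div, eq_div_iff hξ]
    exact mul_left_cancel₀ hμ (by linear_combination ξ * h4 - b₂ * hτ)
  · simp
  · simp
  · simp
  · simp
  · simp

end NormalFrames

/-! ### Isomorphism types -/

namespace Table

theorem br_self (M : Table) (v : Fin 4 → ℝ) : M.br v v = 0 := by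
  funext i
  fin_cases i <;> simp [br, mul_comm]

theorem br_swap (M : Table) (v w : Fin 4 → ℝ) : M.br w v = -M.br v w := by
  funext i
  fin_cases i <;> simp [br] <;> ring

/-- A type is recognized by a new basis, given by the rows of a matrix, and six brackets. -/
theorem hasType_of {M : Table} {S : Set StructConst} {b12 b13 b14 b23 b24 b34 : Fin 4 → ℝ}
    (hC : brackets b12 b13 b14 b23 b24 b34 ∈ S) (E : Fin 4 → Fin 4 → ℝ)
    (hE : (Matrix.of E).det ≠ 0)
    (h12 : M.br (E 0) (E 1) = ∑ l, b12 l • E l) (h13 : M.br (E 0) (E 2) = ∑ l, b13 l • E l)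
    (h14 : M.br (E 0) (E 3) = ∑ l, b14 l • E l) (h23 : M.br (E 1) (E 2) = ∑ l, b23 l • E l)
    (h24 : M.br (E 1) (E 3) = ∑ l, b24 l • E l) (h34 : M.br (E 2) (E 3) = ∑ l, b34 l • E l) :
    M.HasType S := by
  refine ⟨_, hC, E, Matrix.linearIndependent_rows_of_det_ne_zero hE, fun i j => ?_⟩
  have h0 : (∑ l, (0 : Fin 4 → ℝ) l • E l) = 0 := by simp
  have hn : ∀ b : Fin 4 → ℝ, (∑ l, (-b) l • E l) = -∑ l, b l • E l := by simp
  fin_cases i <;> fin_cases j <;>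
    first
    | exact (M.br_self _).trans h0.symm
    | assumption
    | exact (M.br_swap _ _).trans ((congrArg Neg.neg ‹_›).trans (hn _).symm)

theorem mem_typeA37A1 {a b : ℝ} (ha : a ≠ 0) (hab : |a| < |b|) :
    brackets 0 ![1, 0, 0, 0] 0 ![0, a / b, 0, 0] 0 0 ∈ typeA37A1 := by
  have hb : 0 < |b| := (abs_nonneg a).trans_lt hab
  refine ⟨a / b, ?_, ?_, rfl⟩
  · rw [abs_div]
    exact div_pos (abs_pos.2 ha) hb
  · rw [abs_div, div_lt_one hb]
    exact hab

theorem mem_typeA45 {u v w : ℝ} (hu : u ≠ 0) (hv : v ≠ 0) (hw : w ≠ 0) (h₁ : |v| ≤ |u|)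
    (h₂ : |w| ≤ |u|) (h : w / u ≤ v / u) :
    brackets 0 0 ![1, 0, 0, 0] 0 ![0, v / u, 0, 0] ![0, 0, w / u, 0] ∈ typeA45 := by
  have hu' : 0 < |u| := abs_pos.2 hu
  have h3 : |v / u| ≤ 1 := by rw [abs_div, div_le_one hu']; exact h₁
  have h4 : |w / u| ≤ 1 := by rw [abs_div, div_le_one hu']; exact h₂
  exact ⟨w / u, v / u, (abs_le.1 h4).1, h, (abs_le.1 h3).2,
    mul_ne_zero (div_ne_zero hw hu) (div_ne_zero hv hu), rfl⟩

theorem hasType_A36A1_hyp {β : ℝ} (hβ : β ≠ 0) :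
    HasType ⟨0, 0, 0, 0, β, β, 0, 0⟩ typeA36A1 := by
  refine hasType_of rfl
    ![![0, 0, 1, 1], ![0, 0, 1, -1], ![0, -β⁻¹, 0, 0], ![1, 0, 0, 0]] ?_ ?_ ?_ ?_ ?_ ?_ ?_
  · simp [Matrix.det_succ_row_zero, Fin.sum_univ_succ, Fin.succAbove]
    grind
  all_goals
    funext i
    fin_cases i <;> simp [br, Fin.sum_univ_four] <;> grind

theorem hasType_A36A1_dil :
    HasType ⟨1, 0, 0, 1, 0, 0, 0, 0⟩ typeA36A1 := by
  refine hasType_of rfl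
    ![![1, 0, 0, 0], ![0, 0, 1, 0], ![0, 1, 0, 0], ![0, 0, 0, 1]] ?_ ?_ ?_ ?_ ?_ ?_ ?_
  · simp [Matrix.det_succ_row_zero, Fin.sum_univ_succ, Fin.succAbove]
  all_goals
    funext i
    fin_cases i <;> simp [br, Fin.sum_univ_four]

theorem hasType_A38A1 {β : ℝ} (hβ : β ≠ 0) :
    HasType ⟨0, 0, 0, 0, -β, β, 0, 0⟩ typeA38A1 := by
  refine hasType_of rfl
    ![![0, 0, 1, 0], ![0, 0, 0, 1], ![0, -β⁻¹, 0, 0], ![1, 0, 0, 0]] ?_ ?_ ?_ ?_ ?_ ?_ ?_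
  · simp [Matrix.det_succ_row_zero, Fin.sum_univ_succ, Fin.succAbove]
    grind
  all_goals
    funext i
    fin_cases i <;> simp [br, Fin.sum_univ_four] <;> grind

theorem hasType_A21A22 :
    HasType ⟨0, 0, 0, 0, 0, 0, -1, 0⟩ typeA21A22 := by
  refine hasType_of rfl
    ![![0, -1, 0, 0], ![0, 0, 0, 1], ![1, 0, 0, 0], ![0, 0, 1, 0]] ?_ ?_ ?_ ?_ ?_ ?_ ?_
  · simp [Matrix.det_succ_row_zero, Fin.sum_univ_succ, Fin.succAbove]
  all_goals
    funext i
    fin_cases i <;> simp [br, Fin.sum_univ_four]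

theorem hasType_A34A1_jordan {a : ℝ} (ha : a ≠ 0) :
    HasType ⟨0, 0, 0, a, 0, 1, a, 0⟩ typeA34A1 := by
  refine hasType_of rfl
    ![![0, 0, a⁻¹, 0], ![0, 0, 0, 1], ![0, -a⁻¹, 0, 0], ![1, 0, 0, 0]] ?_ ?_ ?_ ?_ ?_ ?_ ?_
  · simp [Matrix.det_succ_row_zero, Fin.sum_univ_succ, Fin.succAbove]
    grind
  all_goals
    funext i
    fin_cases i <;> simp [br, Fin.sum_univ_four] <;> grind

theorem hasType_A34A1_dil {k : ℝ} (hk : k ≠ 0) :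
    HasType ⟨1, 0, k, 0, 0, 0, -1, 0⟩ typeA34A1 := by
  refine hasType_of rfl
    ![![0, 0, 0, -k], ![1, 0, 0, 0], ![0, 1, 0, 0], ![0, 0, 1, 0]] ?_ ?_ ?_ ?_ ?_ ?_ ?_
  · simp [Matrix.det_succ_row_zero, Fin.sum_univ_succ, Fin.succAbove]
    grind
  all_goals
    funext i
    fin_cases i <;> simp [br, Fin.sum_univ_four]

theorem hasType_A39A1 {a b : ℝ} (ha : a < 0) (hb : 0 < b) :
    HasType ⟨0, 0, 0, a, -b, b, a, 0⟩ typeA39A1 := by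
  refine hasType_of ⟨-a / b, div_pos (by linarith) hb, rfl⟩
    ![![0, 0, 0, 1], ![0, 0, 1, 0], ![0, b⁻¹, 0, 0], ![1, 0, 0, 0]] ?_ ?_ ?_ ?_ ?_ ?_ ?_
  · simp [Matrix.det_succ_row_zero, Fin.sum_univ_succ, Fin.succAbove]
    grind
  all_goals
    funext i
    fin_cases i <;> simp [br, Fin.sum_univ_four] <;> grind

theorem hasType_A37A1_hyp {b : ℝ} (hb : 0 < b) (hb1 : b ≠ 1) :
    HasType ⟨0, 0, 0, -1, b, b, -1, 0⟩ typeA37A1 := by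
  have h : |1 - b| < |1 + b| := sq_lt_sq.1 (by nlinarith)
  refine hasType_of (mem_typeA37A1 (sub_ne_zero.2 hb1.symm) h)
    ![![0, 0, 1, -1], ![0, 0, 1, 1], ![0, (1 + b)⁻¹, 0, 0], ![1, 0, 0, 0]] ?_ ?_ ?_ ?_ ?_ ?_ ?_
  · simp [Matrix.det_succ_row_zero, Fin.sum_univ_succ, Fin.succAbove]
    grind
  all_goals
    funext i
    fin_cases i <;> simp [br, Fin.sum_univ_four] <;> grind

/-! For `[T, X] = T`, `[X, H₁] = a H₁`, `[X, H₂] = b H₂` the map `v ↦ [v, X]` has the eigenvalues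
`1, -a, -b`. The normal form `A_{4.5}` puts one of largest absolute value first and scales it to `1`;
the quotients of the two others by it follow in decreasing order. The six lemmas are the six orders
of the eigenvectors `T` (t), `H₁` (a), `H₂` (b). -/

theorem hasType_A45_tab {a b : ℝ} (ha : a ≠ 0) (hb : b ≠ 0) (h₁ : |(-a : ℝ)| ≤ |(1 : ℝ)|)
    (h₂ : |(-b : ℝ)| ≤ |(1 : ℝ)|) (h : (-b : ℝ) / 1 ≤ -a / 1) :
    HasType ⟨1, 0, 0, a, 0, 0, b, 0⟩ typeA45 := by
  refine hasType_of (mem_typeA45 one_ne_zero (neg_ne_zero.2 ha) (neg_ne_zero.2 hb) h₁ h₂ h)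
    ![![1, 0, 0, 0], ![0, 0, 1, 0], ![0, 0, 0, 1], ![0, 1, 0, 0]] ?_ ?_ ?_ ?_ ?_ ?_ ?_
  · simp [Matrix.det_succ_row_zero, Fin.sum_univ_succ, Fin.succAbove]
  all_goals
    funext i
    fin_cases i <;> simp [br, Fin.sum_univ_four]

theorem hasType_A45_tba {a b : ℝ} (ha : a ≠ 0) (hb : b ≠ 0) (h₁ : |(-b : ℝ)| ≤ |(1 : ℝ)|)
    (h₂ : |(-a : ℝ)| ≤ |(1 : ℝ)|) (h : (-a : ℝ) / 1 ≤ -b / 1) :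
    HasType ⟨1, 0, 0, a, 0, 0, b, 0⟩ typeA45 := by
  refine hasType_of (mem_typeA45 one_ne_zero (neg_ne_zero.2 hb) (neg_ne_zero.2 ha) h₁ h₂ h)
    ![![1, 0, 0, 0], ![0, 0, 0, 1], ![0, 0, 1, 0], ![0, 1, 0, 0]] ?_ ?_ ?_ ?_ ?_ ?_ ?_
  · simp [Matrix.det_succ_row_zero, Fin.sum_univ_succ, Fin.succAbove]
  all_goals
    funext i
    fin_cases i <;> simp [br, Fin.sum_univ_four]

theorem hasType_A45_atb {a b : ℝ} (ha : a ≠ 0) (hb : b ≠ 0) (h₁ : |(1 : ℝ)| ≤ |(-a : ℝ)|)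
    (h₂ : |(-b : ℝ)| ≤ |(-a : ℝ)|) (h : (-b : ℝ) / (-a) ≤ 1 / (-a)) :
    HasType ⟨1, 0, 0, a, 0, 0, b, 0⟩ typeA45 := by
  refine hasType_of (mem_typeA45 (neg_ne_zero.2 ha) one_ne_zero (neg_ne_zero.2 hb) h₁ h₂ h)
    ![![0, 0, 1, 0], ![1, 0, 0, 0], ![0, 0, 0, 1], ![0, -a⁻¹, 0, 0]] ?_ ?_ ?_ ?_ ?_ ?_ ?_
  · simp [Matrix.det_succ_row_zero, Fin.sum_univ_succ, Fin.succAbove]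
    grind
  all_goals
    funext i
    fin_cases i <;> simp [br, Fin.sum_univ_four] <;> grind

theorem hasType_A45_abt {a b : ℝ} (ha : a ≠ 0) (hb : b ≠ 0) (h₁ : |(-b : ℝ)| ≤ |(-a : ℝ)|)
    (h₂ : |(1 : ℝ)| ≤ |(-a : ℝ)|) (h : (1 : ℝ) / (-a) ≤ -b / (-a)) :
    HasType ⟨1, 0, 0, a, 0, 0, b, 0⟩ typeA45 := by
  refine hasType_of (mem_typeA45 (neg_ne_zero.2 ha) (neg_ne_zero.2 hb) one_ne_zero h₁ h₂ h)
    ![![0, 0, 1, 0], ![0, 0, 0, 1], ![1, 0, 0, 0], ![0, -a⁻¹, 0, 0]] ?_ ?_ ?_ ?_ ?_ ?_ ?_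
  · simp [Matrix.det_succ_row_zero, Fin.sum_univ_succ, Fin.succAbove]
    grind
  all_goals
    funext i
    fin_cases i <;> simp [br, Fin.sum_univ_four] <;> grind

theorem hasType_A45_bta {a b : ℝ} (ha : a ≠ 0) (hb : b ≠ 0) (h₁ : |(1 : ℝ)| ≤ |(-b : ℝ)|)
    (h₂ : |(-a : ℝ)| ≤ |(-b : ℝ)|) (h : (-a : ℝ) / (-b) ≤ 1 / (-b)) :
    HasType ⟨1, 0, 0, a, 0, 0, b, 0⟩ typeA45 := by
  refine hasType_of (mem_typeA45 (neg_ne_zero.2 hb) one_ne_zero (neg_ne_zero.2 ha) h₁ h₂ h)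
    ![![0, 0, 0, 1], ![1, 0, 0, 0], ![0, 0, 1, 0], ![0, -b⁻¹, 0, 0]] ?_ ?_ ?_ ?_ ?_ ?_ ?_
  · simp [Matrix.det_succ_row_zero, Fin.sum_univ_succ, Fin.succAbove]
    grind
  all_goals
    funext i
    fin_cases i <;> simp [br, Fin.sum_univ_four] <;> grind

theorem hasType_A45_bat {a b : ℝ} (ha : a ≠ 0) (hb : b ≠ 0) (h₁ : |(-a : ℝ)| ≤ |(-b : ℝ)|)
    (h₂ : |(1 : ℝ)| ≤ |(-b : ℝ)|) (h : (1 : ℝ) / (-b) ≤ -a / (-b)) :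
    HasType ⟨1, 0, 0, a, 0, 0, b, 0⟩ typeA45 := by
  refine hasType_of (mem_typeA45 (neg_ne_zero.2 hb) (neg_ne_zero.2 ha) one_ne_zero h₁ h₂ h)
    ![![0, 0, 0, 1], ![0, 0, 1, 0], ![1, 0, 0, 0], ![0, -b⁻¹, 0, 0]] ?_ ?_ ?_ ?_ ?_ ?_ ?_
  · simp [Matrix.det_succ_row_zero, Fin.sum_univ_succ, Fin.succAbove]
    grind
  all_goals
    funext i
    fin_cases i <;> simp [br, Fin.sum_univ_four] <;> grind

theorem hasType_A37A1_diag {a b : ℝ} (ha : a ≠ 0) (hab : |a| < |b|) :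
    HasType ⟨0, 0, 0, a, 0, 0, b, 0⟩ typeA37A1 := by
  have hb : b ≠ 0 := abs_pos.1 ((abs_nonneg a).trans_lt hab)
  refine hasType_of (mem_typeA37A1 ha hab)
    ![![0, 0, 0, 1], ![0, 0, 1, 0], ![0, -b⁻¹, 0, 0], ![1, 0, 0, 0]] ?_ ?_ ?_ ?_ ?_ ?_ ?_
  · simp [Matrix.det_succ_row_zero, Fin.sum_univ_succ, Fin.succAbove]
    grind
  all_goals
    funext i
    fin_cases i <;> simp [br, Fin.sum_univ_four] <;> grind

theorem hasType_A37A1_dil_lt {a : ℝ} (ha : a ≠ 0) (h1 : |a| < 1) :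
    HasType ⟨1, 0, 0, -a, 0, 0, 0, 0⟩ typeA37A1 := by
  refine hasType_of ⟨a, abs_pos.2 ha, h1, rfl⟩
    ![![1, 0, 0, 0], ![0, 0, 1, 0], ![0, 1, 0, 0], ![0, 0, 0, 1]] ?_ ?_ ?_ ?_ ?_ ?_ ?_
  · simp [Matrix.det_succ_row_zero, Fin.sum_univ_succ, Fin.succAbove]
  all_goals
    funext i
    fin_cases i <;> simp [br, Fin.sum_univ_four]

theorem hasType_A37A1_dil_gt {a : ℝ} (h1 : 1 < |a|) :
    HasType ⟨1, 0, 0, -a, 0, 0, 0, 0⟩ typeA37A1 := by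
  have ha : a ≠ 0 := abs_pos.1 (zero_lt_one.trans h1)
  refine hasType_of (mem_typeA37A1 one_ne_zero (by simpa using h1))
    ![![0, 0, 1, 0], ![1, 0, 0, 0], ![0, a⁻¹, 0, 0], ![0, 0, 0, 1]] ?_ ?_ ?_ ?_ ?_ ?_ ?_
  · simp [Matrix.det_succ_row_zero, Fin.sum_univ_succ, Fin.succAbove]
    grind
  all_goals
    funext i
    fin_cases i <;> simp [br, Fin.sum_univ_four] <;> grind

theorem hasType_A35A1 :
    HasType ⟨1, 0, 0, -1, 0, 0, 0, 0⟩ typeA35A1 := by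
  refine hasType_of rfl
    ![![1, 0, 0, 0], ![0, 0, 1, 0], ![0, 1, 0, 0], ![0, 0, 0, 1]] ?_ ?_ ?_ ?_ ?_ ?_ ?_
  · simp [Matrix.det_succ_row_zero, Fin.sum_univ_succ, Fin.succAbove]
  all_goals
    funext i
    fin_cases i <;> simp [br, Fin.sum_univ_four]

theorem hasType_A41 {k : ℝ} (hk : k ≠ 0) :
    HasType ⟨0, -k, 0, 0, 1, 0, 0, 0⟩ typeA41 := by
  refine hasType_of rfl
    ![![0, 0, 0, -k], ![0, 0, k, 0], ![1, 0, 0, 0], ![0, 1, 0, 0]] ?_ ?_ ?_ ?_ ?_ ?_ ?_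
  · simp [Matrix.det_succ_row_zero, Fin.sum_univ_succ, Fin.succAbove]
    grind
  all_goals
    funext i
    fin_cases i <;> simp [br, Fin.sum_univ_four]

theorem hasType_A43_const {k : ℝ} (hk : k ≠ 0) :
    HasType ⟨0, 0, -k, -1, 0, 0, 0, 0⟩ typeA43 := by
  refine hasType_of rfl
    ![![0, 0, 1, 0], ![0, 0, 0, k], ![1, 0, 0, 0], ![0, 1, 0, 0]] ?_ ?_ ?_ ?_ ?_ ?_ ?_
  · simp [Matrix.det_succ_row_zero, Fin.sum_univ_succ, Fin.succAbove]
    grind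
  all_goals
    funext i
    fin_cases i <;> simp [br, Fin.sum_univ_four]

theorem hasType_A43_dil :
    HasType ⟨1, 0, 0, 0, 1, 0, 0, 0⟩ typeA43 := by
  refine hasType_of rfl
    ![![1, 0, 0, 0], ![0, 0, 0, -1], ![0, 0, 1, 0], ![0, 1, 0, 0]] ?_ ?_ ?_ ?_ ?_ ?_ ?_
  · simp [Matrix.det_succ_row_zero, Fin.sum_univ_succ, Fin.succAbove]
  all_goals
    funext i
    fin_cases i <;> simp [br, Fin.sum_univ_four]

theorem hasType_A42_jordan {a : ℝ} (ha : a ≠ 0) :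
    HasType ⟨1, 0, 0, a, 0, 1, a, 0⟩ typeA42 := by
  refine hasType_of ⟨-a⁻¹, by simpa using ha, rfl⟩
    ![![1, 0, 0, 0], ![0, 0, a⁻¹, 0], ![0, 0, 0, 1], ![0, -a⁻¹, 0, 0]] ?_ ?_ ?_ ?_ ?_ ?_ ?_
  · simp [Matrix.det_succ_row_zero, Fin.sum_univ_succ, Fin.succAbove]
    grind
  all_goals
    funext i
    fin_cases i <;> simp [br, Fin.sum_univ_four] <;> grind

theorem hasType_A42_right {a k : ℝ} (ha : a ≠ 0) (hk : k ≠ 0) :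
    HasType ⟨1, 0, k, a, 0, 0, -1, 0⟩ typeA42 := by
  refine hasType_of ⟨-a, by simpa using ha, rfl⟩
    ![![0, 0, 1, 0], ![0, 0, 0, -k], ![1, 0, 0, 0], ![0, 1, 0, 0]] ?_ ?_ ?_ ?_ ?_ ?_ ?_
  · simp [Matrix.det_succ_row_zero, Fin.sum_univ_succ, Fin.succAbove]
    grind
  all_goals
    funext i
    fin_cases i <;> simp [br, Fin.sum_univ_four]

theorem hasType_A44 {k : ℝ} (hk : k ≠ 0) :
    HasType ⟨1, 0, -k, -1, 0, 1, -1, 0⟩ typeA44 := by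
  refine hasType_of rfl
    ![![0, 0, -k, 0], ![0, 0, 0, k], ![1, 0, 0, 0], ![0, 1, 0, 0]] ?_ ?_ ?_ ?_ ?_ ?_ ?_
  · simp [Matrix.det_succ_row_zero, Fin.sum_univ_succ, Fin.succAbove]
    grind
  all_goals
    funext i
    fin_cases i <;> simp [br, Fin.sum_univ_four]

theorem hasType_A46_pos {a b : ℝ} (ha : 0 ≤ a) (hb : 0 < b) :
    HasType ⟨1, 0, 0, a, -b, b, a, 0⟩ typeA46 := by
  refine hasType_of ⟨a / b, -b⁻¹, by simpa using hb.ne', by positivity, rfl⟩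
    ![![1, 0, 0, 0], ![0, 0, 1, 0], ![0, 0, 0, 1], ![0, -b⁻¹, 0, 0]] ?_ ?_ ?_ ?_ ?_ ?_ ?_
  · simp [Matrix.det_succ_row_zero, Fin.sum_univ_succ, Fin.succAbove]
    grind
  all_goals
    funext i
    fin_cases i <;> simp [br, Fin.sum_univ_four] <;> grind

theorem hasType_A46_neg {a b : ℝ} (ha : a < 0) (hb : 0 < b) :
    HasType ⟨1, 0, 0, a, -b, b, a, 0⟩ typeA46 := by
  refine hasType_of ⟨-a / b, b⁻¹, by simpa using hb.ne', div_nonneg (by linarith) hb.le, rfl⟩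
    ![![1, 0, 0, 0], ![0, 0, 0, 1], ![0, 0, 1, 0], ![0, b⁻¹, 0, 0]] ?_ ?_ ?_ ?_ ?_ ?_ ?_
  · simp [Matrix.det_succ_row_zero, Fin.sum_univ_succ, Fin.succAbove]
    grind
  all_goals
    funext i
    fin_cases i <;> simp [br, Fin.sum_univ_four] <;> grind

theorem hasType_A48 {ν : ℝ} (hν : ν ≠ 0) :
    HasType ⟨1, 0, 0, 1, 0, 0, 0, ν⟩ typeA48 := by
  refine hasType_of rfl
    ![![0, 0, 0, ν], ![1, 0, 0, 0], ![0, 0, 1, 0], ![0, 1, 0, 0]] ?_ ?_ ?_ ?_ ?_ ?_ ?_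
  · simp [Matrix.det_succ_row_zero, Fin.sum_univ_succ, Fin.succAbove]
    grind
  all_goals
    funext i
    fin_cases i <;> simp [br, Fin.sum_univ_four]

theorem hasType_A45 {a b : ℝ} (ha : a ≠ 0) (hb : b ≠ 0) :
    HasType ⟨1, 0, 0, a, 0, 0, b, 0⟩ typeA45 := by
  rcases le_total |-a| |(1 : ℝ)| with h1 | h1
  · rcases le_total |-b| |(1 : ℝ)| with h2 | h2
    · rcases le_total (-b / 1) (-a / 1) with h | h
      · exact hasType_A45_tab ha hb h1 h2 h
      · exact hasType_A45_tba ha hb h2 h1 h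
    · rcases le_total (-a / -b) (1 / -b) with h | h
      · exact hasType_A45_bta ha hb h2 (h1.trans h2) h
      · exact hasType_A45_bat ha hb (h1.trans h2) h2 h
  · rcases le_total |-b| |-a| with h2 | h2
    · rcases le_total (-b / -a) (1 / -a) with h | h
      · exact hasType_A45_atb ha hb h1 h2 h
      · exact hasType_A45_abt ha hb h2 h1 h
    · rcases le_total (-a / -b) (1 / -b) with h | h
      · exact hasType_A45_bta ha hb (h1.trans h2) h2 h
      · exact hasType_A45_bat ha hb h2 (h1.trans h2) h

/-- Interchanging `H₁` and `H₂`. -/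
theorem HasType.swap {c ρ₁ ρ₂ p q r s : ℝ} {S : Set StructConst}
    (h : HasType ⟨c, ρ₁, ρ₂, p, q, r, s, 0⟩ S) : HasType ⟨c, ρ₂, ρ₁, s, r, q, p, 0⟩ S := by
  obtain ⟨C, hC, E, hE, hbr⟩ := h
  refine ⟨C, hC, fun i => E i ∘ Equiv.swap 2 3, ?_, fun i j => ?_⟩
  · exact hE.map' (LinearEquiv.funCongrLeft ℝ ℝ (Equiv.swap (2 : Fin 4) 3)).toLinearMap
      (LinearEquiv.ker _)
  · have e2 : Equiv.swap (2 : Fin 4) 3 2 = 3 := by decide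
    have e3 : Equiv.swap (2 : Fin 4) 3 3 = 2 := by decide
    have e0 : Equiv.swap (2 : Fin 4) 3 0 = 0 := by decide
    have e1 : Equiv.swap (2 : Fin 4) 3 1 = 1 := by decide
    have e4 : (∑ l, C i j l • (E l ∘ Equiv.swap 2 3)) = (∑ l, C i j l • E l) ∘ Equiv.swap 2 3 := by
      funext l
      simp
    rw [e4, ← hbr]
    funext l
    fin_cases l <;> simp [br, e0, e1, e2, e3] <;> ring

end Table

/-! ### Verification of the list -/

/-- The properties of a listed equation. -/
def Verified (W : Set Pt) (e : WaveEq) (Q : Fin 4 → VF) (S : Set StructConst) : Prop :=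
  InClass W e ∧ IsMaximalAlgebra W e.rhs Q ∧ symDim W e.rhs = 4 ∧ ∃ C ∈ S, HasStructConst W Q C

/-- A solution without zeros of `(c x + c₂) E' = a E`. -/
structure Eigen (J : Set ℝ) (c c₂ a : ℝ) (E : ℝ → ℝ) : Prop where
  deriv : ∀ x ∈ J, HasDerivAt E (a * E x / (c * x + c₂)) x
  ne : ∀ x ∈ J, E x ≠ 0

section Eigen

variable {J : Set ℝ}

theorem eigen_one (c c₂ : ℝ) : Eigen J c c₂ 0 (fun _ => 1) where
  deriv x _ := (hasDerivAt_const x 1).congr_deriv (by simp)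
  ne _ _ := one_ne_zero

theorem eigen_exp (a : ℝ) : Eigen J 0 1 a (fun x => Real.exp (a * x)) where
  deriv x _ := ((hasDerivAt_id' x).const_mul a).exp.congr_deriv (by ring)
  ne _ _ := Real.exp_ne_zero _

theorem eigen_exp_neg : Eigen J 0 1 (-1) (fun x => Real.exp (-x)) := by
  simpa only [neg_one_mul] using eigen_exp (J := J) (-1)

theorem eigen_exp_neg_half : Eigen J 0 1 (-1 / 2) (fun x => Real.exp (-x / 2)) := by
  have h := eigen_exp (J := J) (-1 / 2)
  have e : (fun x : ℝ => Real.exp (-1 / 2 * x)) = fun x => Real.exp (-x / 2) :=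
    funext fun x => by ring_nf
  rwa [e] at h

theorem eigen_rpow (h0 : ∀ x ∈ J, x ≠ 0) (a : ℝ) : Eigen J 1 0 a (fun x => |x| ^ a) where
  deriv x hx := by
    have h := (hasDerivAt_abs (h0 x hx)).rpow_const (p := a) (Or.inl (abs_pos.2 (h0 x hx)).ne')
    refine h.congr_deriv ?_
    have hx' := h0 x hx
    rw [Real.rpow_sub_one (abs_pos.2 hx').ne']
    rcases lt_or_gt_of_ne hx' with h | h
    · rw [abs_of_neg h, sign_neg h]
      simp
      field_simp
    · rw [abs_of_pos h, sign_pos h]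
      simp
      field_simp
  ne x hx := (Real.rpow_pos_of_pos (abs_pos.2 (h0 x hx)) a).ne'

theorem eigen_sqrt (h0 : ∀ x ∈ J, x ≠ 0) : Eigen J 1 0 (1 / 2) (fun x => √|x|) := by
  simpa only [Real.sqrt_eq_rpow] using eigen_rpow h0 (1 / 2)

theorem eigen_id (h0 : ∀ x ∈ J, x ≠ 0) : Eigen J 1 0 1 (fun x => x) where
  deriv x hx := (hasDerivAt_id' x).congr_deriv (by have := h0 x hx; rw [one_mul, add_zero]; field_simp)
  ne := h0

theorem eigen_sq (h0 : ∀ x ∈ J, x ≠ 0) : Eigen J 1 0 2 (fun x => x ^ 2) where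
  deriv x hx := (hasDerivAt_pow 2 x).congr_deriv (by have := h0 x hx; rw [one_mul, add_zero]; field_simp; norm_num)
  ne x hx := pow_ne_zero 2 (h0 x hx)

theorem eigen_inv (h0 : ∀ x ∈ J, x ≠ 0) : Eigen J 1 0 (-1) (fun x => x⁻¹) where
  deriv x hx := (hasDerivAt_inv (h0 x hx)).congr_deriv (by have := h0 x hx; rw [one_mul, add_zero]; field_simp)
  ne x hx := inv_ne_zero (h0 x hx)

end Eigen

section List

variable {W : Set Pt} {e : WaveEq} {p q r s n m k : ℝ} {h₁ h₂ : ℝ → ℝ} {S : Set StructConst}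
  {T : VF} {Q : Fin 4 → VF}

theorem dX_eq : dX = symField 0 0 1 0 := by
  funext p
  simp [dX, symField]

theorem dil_eq : dil = symField 1 0 0 0 := by
  funext p
  simp [dil, symField]

/-- Constant coefficients, for general `g`. -/
theorem verified_constEq (hW : IsAdmissible W) (H : SpanPair (projX W) 0 1 p q r s h₁ h₂)
    (htr : p + s = -n) (hdet : p * s - q * r = m) (h0 : n ≠ 0 ∨ m ≠ 0 ∨ k ≠ 0)
    (α₀ α₁ α₂ : ℝ) {ρ₁ ρ₂ : ℝ} (e0 : m * α₀ + n * α₁ + 2 * α₂ = -k)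
    (e1 : m * α₁ + 2 * n * α₂ = 0) (e2 : m * α₂ = 0)
    (hρ : ∀ x ∈ projX W, α₁ + 2 * α₂ * x = ρ₁ * h₁ x + ρ₂ * h₂ x)
    (hS : Table.HasType ⟨0, ρ₁, ρ₂, p, q, r, s, 0⟩ S)
    (hT : ∀ p, T p = (1, 0, (α₀ + α₁ * p.2.1 + α₂ * p.2.1 ^ 2) * p.2.2))
    (hQ : Q = ![T, dX, uU h₁, uU h₂] ∨ Q = ![dX, T, uU h₁, uU h₂]) :
    Verified W (constEq n m k) Q S :=
  (isFrame_constEq hW H htr hdet h0 e0 e1 e2 hρ).verify (inClass_constEq hW) hS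
    (funext fun p => (hT p).trans (by simp [symField])) dX_eq hQ

/-- Constant coefficients, for constant `g`. -/
theorem verified_constEq' (hW : IsAdmissible W) (H : SpanPair (projX W) 0 1 p q r s h₁ h₂)
    (htr : p + s = -n) (hdet : p * s - q * r = m) (h0 : n ≠ 0 ∨ m ≠ 0) (α : ℝ) (e0 : m * α = -k)
    (hS : Table.HasType ⟨0, 0, 0, p, q, r, s, 0⟩ S) (hT : ∀ p, T p = (1, 0, α * p.2.2))
    (hQ : Q = ![T, dX, uU h₁, uU h₂] ∨ Q = ![dX, T, uU h₁, uU h₂]) :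
    Verified W (constEq n m k) Q S :=
  verified_constEq hW H htr hdet (by tauto) α 0 0 (by simpa using e0) (by simp) (by simp)
    (by simp) hS (by simpa using hT) hQ

/-- Euler coefficients, for general `g`. -/
theorem verified_powEq (hW : IsAdmissible W) (hr : projTX W ⊆ xNonzero)
    (H : SpanPair (projX W) 1 0 p q r s h₁ h₂)
    (htr : p + s = 1 - n) (hdet : p * s - q * r = m) (h0 : n ≠ 0 ∨ m ≠ 0 ∨ k ≠ 0)
    (α₀ α₁ α₂ : ℝ) {ρ₁ ρ₂ : ℝ} (e0 : (2 - n + m) * α₀ + (n - 3) * α₁ + 2 * α₂ = -k)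
    (e1 : (2 - n + m) * α₁ + 2 * (n - 3) * α₂ = 0) (e2 : (2 - n + m) * α₂ = 0)
    (hρ : ∀ x ∈ projX W, x⁻¹ * (α₁ + 2 * α₂ * Real.log |x|) = ρ₁ * h₁ x + ρ₂ * h₂ x)
    (hS : Table.HasType ⟨1, ρ₁, ρ₂, p, q, r, s, 0⟩ S)
    (hT : ∀ p, T p = (1, 0, p.2.1⁻¹ * (α₀ + α₁ * Real.log |p.2.1| + α₂ * Real.log |p.2.1| ^ 2)
      * p.2.2))
    (hQ : Q = ![T, dil, uU h₁, uU h₂] ∨ Q = ![dil, T, uU h₁, uU h₂]) :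
    Verified W (powEq n m k) Q S :=
  (isFrame_powEq hW hr H htr hdet h0 e0 e1 e2 hρ).verify (inClass_powEq hW hr) hS
    (funext fun p => (hT p).trans (by simp [symField])) dil_eq hQ

/-- Euler coefficients, for `g` without logarithms. -/
theorem verified_powEq' (hW : IsAdmissible W) (hr : projTX W ⊆ xNonzero)
    (H : SpanPair (projX W) 1 0 p q r s h₁ h₂)
    (htr : p + s = 1 - n) (hdet : p * s - q * r = m) (h0 : n ≠ 0 ∨ m ≠ 0 ∨ k ≠ 0)
    (α : ℝ) (e0 : (2 - n + m) * α = -k) (hS : Table.HasType ⟨1, 0, 0, p, q, r, s, 0⟩ S)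
    (hT : ∀ p, T p = (1, 0, α * p.2.1⁻¹ * p.2.2))
    (hQ : Q = ![T, dil, uU h₁, uU h₂] ∨ Q = ![dil, T, uU h₁, uU h₂]) :
    Verified W (powEq n m k) Q S :=
  verified_powEq hW hr H htr hdet h0 α 0 0 (by simpa using e0) (by simp) (by simp)
    (by simp) hS (by simpa [mul_comm α] using hT) hQ

theorem ne_one : ∀ x ∈ projX W, 0 * x + 1 ≠ (0 : ℝ) := by simp

theorem deriv_x : ∀ x ∈ projX W, HasDerivAt (fun x => x) (0 * x + 1)⁻¹ x := fun x _ => by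
  simpa using hasDerivAt_id' x

theorem ne_x (hr : projTX W ⊆ xNonzero) : ∀ x ∈ projX W, 1 * x + 0 ≠ (0 : ℝ) := by
  simpa using projX_ne_zero hr

theorem deriv_log (hr : projTX W ⊆ xNonzero) :
    ∀ x ∈ projX W, HasDerivAt (fun x => Real.log |x|) (1 * x + 0)⁻¹ x := fun x hx => by
  simpa using Real.hasDerivAt_log (projX_ne_zero hr x hx)

/-! The families that occur both with `D = 0` and with `D ≠ 0`. -/

theorem verified_cosh {β α : ℝ} (hW : IsAdmissible W) (hβ : β ≠ 0) (hα : -β ^ 2 * α = -k)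
    (hT : ∀ p, T p = (1, 0, α * p.2.2))
    (hQ : Q = ![T, dX, uU fun x => Real.cosh (β * x), uU fun x => Real.sinh (β * x)] ∨
      Q = ![dX, T, uU fun x => Real.cosh (β * x), uU fun x => Real.sinh (β * x)]) :
    Verified W (constEq 0 (-β ^ 2) k) Q typeA36A1 := by
  have E := eigen_one (J := projX W) 0 1
  have H := spanPair_cosh_sinh ne_one E.deriv E.ne deriv_x hβ
  simp only [one_mul] at H
  exact verified_constEq' hW H (by ring) (by ring) (Or.inr (by simpa using hβ)) α hα
    (Table.hasType_A36A1_hyp hβ) hT hQ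

theorem verified_cos {β α : ℝ} (hW : IsAdmissible W) (hβ : β ≠ 0) (hα : β ^ 2 * α = -k)
    (hT : ∀ p, T p = (1, 0, α * p.2.2))
    (hQ : Q = ![T, dX, uU fun x => Real.cos (β * x), uU fun x => Real.sin (β * x)] ∨
      Q = ![dX, T, uU fun x => Real.cos (β * x), uU fun x => Real.sin (β * x)]) :
    Verified W (constEq 0 (β ^ 2) k) Q typeA38A1 := by
  have E := eigen_one (J := projX W) 0 1
  have H := spanPair_cos_sin ne_one E.deriv E.ne deriv_x hβ
  simp only [one_mul] at H
  exact verified_constEq' hW H (by ring) (by ring) (Or.inr (by simpa using hβ)) α hα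
    (Table.hasType_A38A1 hβ) hT hQ

theorem verified_const_jordan {a α : ℝ} {E : ℝ → ℝ} (hW : IsAdmissible W)
    (hE : Eigen (projX W) 0 1 a E) (ha : a ≠ 0) (hn : n = -(2 * a)) (hm : m = a ^ 2)
    (hα : m * α = -k) (hT : ∀ p, T p = (1, 0, α * p.2.2))
    (hQ : Q = ![T, dX, uU E, uU fun x => x * E x] ∨ Q = ![dX, T, uU E, uU fun x => x * E x]) :
    Verified W (constEq n m k) Q typeA34A1 := by
  have H := spanPair_jordan ne_one hE.deriv hE.ne deriv_x
  simp only [mul_comm (E _)] at H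
  exact verified_constEq' hW H (by linarith) (by rw [hm]; ring)
    (Or.inl (by rw [hn]; simpa using ha)) α hα (Table.hasType_A34A1_jordan ha) hT hQ

theorem verified_const_cos {a b α : ℝ} {E : ℝ → ℝ} (hW : IsAdmissible W)
    (hE : Eigen (projX W) 0 1 a E) (ha : a < 0) (hb : 0 < b) (hn : n = -(2 * a))
    (hm : m = a ^ 2 + b ^ 2) (hα : m * α = -k) (hT : ∀ p, T p = (1, 0, α * p.2.2))
    (hQ : Q = ![T, dX, uU fun x => E x * Real.cos (b * x), uU fun x => E x * Real.sin (b * x)] ∨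
      Q = ![dX, T, uU fun x => E x * Real.cos (b * x), uU fun x => E x * Real.sin (b * x)]) :
    Verified W (constEq n m k) Q typeA39A1 :=
  verified_constEq' hW (spanPair_cos_sin ne_one hE.deriv hE.ne deriv_x hb.ne') (by linarith)
    (by rw [hm]; ring) (Or.inl (by rw [hn]; simpa using ha.ne)) α hα (Table.hasType_A39A1 ha hb)
    hT hQ

theorem verified_pow_jordan {a α : ℝ} {E : ℝ → ℝ} (hW : IsAdmissible W)
    (hr : projTX W ⊆ xNonzero) (hE : Eigen (projX W) 1 0 a E) (ha : a ≠ 0)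
    (hn : n = 1 - 2 * a) (hm : m = a ^ 2) (hα : (2 - n + m) * α = -k)
    (hT : ∀ p, T p = (1, 0, α * p.2.1⁻¹ * p.2.2))
    (hQ : Q = ![T, dil, uU E, uU fun x => E x * Real.log |x|] ∨
      Q = ![dil, T, uU E, uU fun x => E x * Real.log |x|]) :
    Verified W (powEq n m k) Q typeA42 :=
  verified_powEq' hW hr (spanPair_jordan (ne_x hr) hE.deriv hE.ne (deriv_log hr)) (by linarith)
    (by rw [hm]; ring) (Or.inr (Or.inl (by rw [hm]; simpa using ha))) α hα
    (Table.hasType_A42_jordan ha) hT hQ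

theorem verified_pow_diag {a b α : ℝ} {E₁ E₂ : ℝ → ℝ} (hW : IsAdmissible W)
    (hr : projTX W ⊆ xNonzero) (hE₁ : Eigen (projX W) 1 0 a E₁) (hE₂ : Eigen (projX W) 1 0 b E₂)
    (hab : a ≠ b) (hm0 : m ≠ 0) (hn : a + b = 1 - n) (hm : a * b = m)
    (hα : (2 - n + m) * α = -k) (hT : ∀ p, T p = (1, 0, α * p.2.1⁻¹ * p.2.2))
    (hQ : Q = ![T, dil, uU E₁, uU E₂] ∨ Q = ![dil, T, uU E₁, uU E₂]) :
    Verified W (powEq n m k) Q typeA45 :=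
  verified_powEq' hW hr (spanPair_diag (ne_x hr) hE₁.deriv hE₁.ne hE₂.deriv hE₂.ne hab) hn
    (by rw [← hm]; ring) (Or.inr (Or.inl hm0)) α hα
    (Table.hasType_A45 (left_ne_zero_of_mul (hm ▸ hm0)) (right_ne_zero_of_mul (hm ▸ hm0))) hT hQ

theorem verified_pow_cos {a b α : ℝ} {E : ℝ → ℝ} (hW : IsAdmissible W)
    (hr : projTX W ⊆ xNonzero) (hE : Eigen (projX W) 1 0 a E) (hb : 0 < b)
    (hn : n = 1 - 2 * a) (hm : m = a ^ 2 + b ^ 2) (hα : (2 - n + m) * α = -k)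
    (hT : ∀ p, T p = (1, 0, α * p.2.1⁻¹ * p.2.2))
    (hQ : Q = ![T, dil, uU fun x => E x * Real.cos (b * Real.log |x|),
        uU fun x => E x * Real.sin (b * Real.log |x|)] ∨
      Q = ![dil, T, uU fun x => E x * Real.cos (b * Real.log |x|),
        uU fun x => E x * Real.sin (b * Real.log |x|)]) :
    Verified W (powEq n m k) Q typeA46 :=
  verified_powEq' hW hr (spanPair_cos_sin (ne_x hr) hE.deriv hE.ne (deriv_log hr) hb.ne')
    (by linarith) (by rw [hm]; ring) (Or.inr (Or.inl (by rw [hm]; positivity))) α hα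
    ((le_or_gt 0 a).elim (fun h => Table.hasType_A46_pos h hb) fun h => Table.hasType_A46_neg h hb)
    hT hQ

theorem verified_wave (he : InClass W e) (hA : ∀ x, e.A x = 0) (hB : ∀ x, e.B x = 0)
    {K μ l τ ξ : ℝ} (hK : K ≠ 0) (hμ : μ ≠ 0) (hξ : ξ ≠ 0) (hτ : τ * μ + ξ * l = 0)
    (hD : ∀ t x, e.D t x = K * ((μ * t + l * x) ^ 2)⁻¹)
    (hz : ∀ t x, (t, x) ∈ projTX W → μ * t + l * x ≠ 0) (hT : ∀ p, T p = (τ, ξ, 0))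
    (hQ : Q = ![T, dil, uU fun x => x, uU fun _ => 1]) : Verified W e Q typeA48 :=
  (isFrame_wave he hA hB hK hμ hξ hτ hD hz).verify he (Table.hasType_A48 hξ)
    (funext fun p => (hT p).trans (by simp [symField])) dil_eq (Or.inl hQ)

end List

section List

variable {W : Set Pt} {k n m β : ℝ}

theorem spanPair_log_one (hr : projTX W ⊆ xNonzero) :
    SpanPair (projX W) 1 0 0 1 0 0 (fun x => Real.log |x|) (fun _ => 1) where
  ne := ne_x hr
  deriv₁ x hx := (deriv_log hr x hx).congr_deriv (by ring)
  deriv₂ x _ := (hasDerivAt_const x 1).congr_deriv (by ring)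
  wronskian x _ := by norm_num

theorem spanPair_x_one :
    SpanPair (projX W) 0 1 0 1 0 0 (fun x => x) (fun _ => 1) where
  ne := ne_one
  deriv₁ x hx := (hasDerivAt_id' x).congr_deriv (by ring)
  deriv₂ x _ := (hasDerivAt_const x 1).congr_deriv (by ring)
  wronskian x _ := by norm_num

/-- The properties of the equation listed under the label `a`. -/
def IsVerified (W : Set Pt) (a : Listed) : Prop :=
  Verified W (entry a).eqn (entry a).basis (entry a).type

/-- `D = 0`, constant coefficients. -/
theorem verified_I_const (hW : IsAdmissible W) :
    (∀ β, (entry (.I1 β)).valid → IsVerified W (.I1 β)) ∧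
    (∀ β, (entry (.I2 β)).valid → IsVerified W (.I2 β)) ∧
    IsVerified W .I3 ∧
    IsVerified W .I4 ∧
    (∀ m, (entry (.I5 m)).valid → IsVerified W (.I5 m)) ∧
    (∀ m, (entry (.I6 m)).valid → IsVerified W (.I6 m)) := by
  have hT : ∀ p, dT p = (1, 0, (0 : ℝ) * p.2.2) := by simp [dT]
  refine ⟨fun β h => ?_, fun β h => ?_, ?_, ?_, fun m h => ?_, fun m h => ?_⟩
  · exact verified_cosh hW h (by ring) hT (Or.inl rfl)
  · exact verified_cos hW h (by ring) hT (Or.inl rfl)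
  · have E₁ := eigen_one (J := projX W) 0 1
    have E₂ := eigen_exp_neg (J := projX W)
    exact verified_constEq' hW (spanPair_diag ne_one E₁.deriv E₁.ne E₂.deriv E₂.ne (by norm_num))
      (by norm_num) (by norm_num) (by norm_num) 0 (by norm_num) Table.hasType_A21A22 hT (Or.inl rfl)
  · exact verified_const_jordan hW eigen_exp_neg (by norm_num) (by norm_num) (by norm_num)
      (by norm_num) hT (Or.inl rfl)
  · have h' : 0 < m - 1 := sub_pos.2 h
    exact verified_const_cos hW eigen_exp_neg (by norm_num) (Real.sqrt_pos.2 h') (by norm_num)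
      (by rw [Real.sq_sqrt h'.le]; ring) (by norm_num) hT (Or.inl rfl)
  · obtain ⟨h1, h2⟩ := h
    have h' : 0 < 1 - m := sub_pos.2 h1
    have E := eigen_exp_neg (J := projX W)
    have hb : √(1 - m) ≠ 1 := fun hb => h2 (by
      have := Real.sq_sqrt h'.le
      rw [hb] at this
      linarith)
    exact verified_constEq' hW (spanPair_cosh_sinh ne_one E.deriv E.ne deriv_x
      (Real.sqrt_pos.2 h').ne') (by norm_num) (by linear_combination -(Real.sq_sqrt h'.le))
      (by norm_num) 0 (by norm_num) (Table.hasType_A37A1_hyp (Real.sqrt_pos.2 h') hb) hT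
      (Or.inl rfl)

theorem hasType_I11 (h0 : n ≠ 0) (h1 : n ≠ 1) (h2 : n ≠ 2) :
    Table.HasType ⟨1, 0, 0, 1 - n, 0, 0, 0, 0⟩ typeA37A1 := by
  have e : 1 - n = -(n - 1) := by ring
  rw [e]
  rcases lt_trichotomy |n - 1| 1 with h | h | h
  · exact Table.hasType_A37A1_dil_lt (sub_ne_zero.2 h1) h
  · rcases (abs_eq one_pos.le).1 h with h | h
    · exact absurd (by linarith) h2
    · exact absurd (by linarith) h0
  · exact Table.hasType_A37A1_dil_gt h

/-- `D = 0`, Euler coefficients. -/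
theorem verified_I_pow (hW : IsAdmissible W) (hr : projTX W ⊆ xNonzero) :
    IsVerified W .I7 ∧
    (∀ m, (entry (.I8 m)).valid → IsVerified W (.I8 m)) ∧
    (∀ m, (entry (.I9 m)).valid → IsVerified W (.I9 m)) ∧
    IsVerified W .I10 ∧
    (∀ n, (entry (.I11 n)).valid → IsVerified W (.I11 n)) ∧
    (∀ n, (entry (.I12 n)).valid → IsVerified W (.I12 n)) ∧
    (∀ n m, (entry (.I13 n m)).valid → IsVerified W (.I13 n m)) ∧
    (∀ n m, (entry (.I14 n m)).valid → IsVerified W (.I14 n m)) := by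
  have hT : ∀ p, dT p = (1, 0, (0 : ℝ) * p.2.1⁻¹ * p.2.2) := by simp [dT]
  have h0 := projX_ne_zero hr
  refine ⟨?_, fun m h => ?_, fun m h => ?_, ?_, fun n h => ?_, fun n h => ?_, fun n m h => ?_,
    fun n m h => ?_⟩
  · exact verified_pow_jordan hW hr (eigen_sqrt h0) (by norm_num) (by norm_num) (by norm_num)
      (by norm_num) hT (Or.inl rfl)
  · obtain ⟨h1, h2⟩ := h
    have h' : 0 < 1 / 4 - m := sub_pos.2 h1
    have hs := Real.sqrt_pos.2 h'
    exact verified_pow_diag hW hr (eigen_rpow h0 _) (eigen_rpow h0 _) (fun h => by linarith) h2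
      (by ring) (by linear_combination -(Real.sq_sqrt h'.le)) (by ring) hT (Or.inl rfl)
  · have h' : 0 < m - 1 / 4 := sub_pos.2 h
    exact verified_pow_cos hW hr (eigen_sqrt h0) (Real.sqrt_pos.2 h') (by norm_num)
      (by rw [Real.sq_sqrt h'.le]; ring) (by ring) hT (Or.inl rfl)
  · exact verified_powEq' hW hr (spanPair_log_one hr) (by norm_num) (by norm_num) (by norm_num)
      0 (by norm_num) Table.hasType_A43_dil hT (Or.inl rfl)
  · obtain ⟨hn0, hn1⟩ := h
    have E₁ := eigen_rpow h0 (1 - n)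
    have E₂ := eigen_one (J := projX W) 1 0
    have hS : Table.HasType ⟨1, 0, 0, 1 - n, 0, 0, 0, 0⟩ (entry (.I11 n)).type := by
      by_cases h2 : n = 2
      · have e : 1 - n = -1 := by linarith
        rw [e]
        obtain ⟨C, hC, hE⟩ := Table.hasType_A35A1
        exact ⟨C, Or.inr ⟨h2, hC⟩, hE⟩
      · obtain ⟨C, hC, hE⟩ := hasType_I11 hn0 hn1 h2
        exact ⟨C, Or.inl ⟨h2, hC⟩, hE⟩
    exact verified_powEq' hW hr (spanPair_diag (ne_x hr) E₁.deriv E₁.ne E₂.deriv E₂.ne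
      (sub_ne_zero.2 hn1.symm)) (by ring) (by ring) (Or.inl hn0) 0 (by ring) hS hT (Or.inl rfl)
  · obtain ⟨hn0, hn1⟩ := h
    exact verified_pow_jordan hW hr (eigen_rpow h0 _)
      (div_ne_zero (sub_ne_zero.2 hn1.symm) two_ne_zero) (by ring) (by ring)
      (by ring) hT (Or.inl rfl)
  · obtain ⟨hn0, hm0, h⟩ := h
    have h' : 0 < (n - 1) ^ 2 - 4 * m := by linarith
    have hs := Real.sqrt_pos.2 h'
    exact verified_pow_diag hW hr (eigen_rpow h0 _) (eigen_rpow h0 _) (fun h => by linarith) hm0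
      (by ring) (by linear_combination -(Real.sq_sqrt h'.le) / 4) (by ring) hT (Or.inl rfl)
  · obtain ⟨hn0, h⟩ := h
    have h' : 0 < m - (n - 1) ^ 2 / 4 := sub_pos.2 h
    exact verified_pow_cos hW hr (eigen_rpow h0 _) (Real.sqrt_pos.2 h') (by ring)
      (by rw [Real.sq_sqrt h'.le]; ring) (by ring) hT (Or.inl rfl)

/-- `D = k t x⁻³`. -/
theorem verified_II (hW : IsAdmissible W) (hr : projTX W ⊆ xNonzero) :
    (∀ k, (entry (.II1 k)).valid → IsVerified W (.II1 k)) ∧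
    (∀ k, (entry (.II2 k)).valid → IsVerified W (.II2 k)) ∧
    (∀ k m, (entry (.II3 k m)).valid → IsVerified W (.II3 k m)) ∧
    (∀ k, (entry (.II4 k)).valid → IsVerified W (.II4 k)) ∧
    (∀ k m, (entry (.II5 k m)).valid → IsVerified W (.II5 k m)) ∧
    (∀ k, (entry (.II6 k)).valid → IsVerified W (.II6 k)) ∧
    (∀ k, (entry (.II7 k)).valid → IsVerified W (.II7 k)) ∧
    (∀ k n, (entry (.II8 k n)).valid → IsVerified W (.II8 k n)) ∧
    (∀ k, (entry (.II9 k)).valid → IsVerified W (.II9 k)) ∧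
    (∀ k n, (entry (.II10 k n)).valid → IsVerified W (.II10 k n)) ∧
    (∀ k n m, (entry (.II11 k n m)).valid → IsVerified W (.II11 k n m)) ∧
    (∀ k n, (entry (.II12 k n)).valid → IsVerified W (.II12 k n)) ∧
    (∀ k n m, (entry (.II13 k n m)).valid → IsVerified W (.II13 k n m)) := by
  have hT : ∀ α : ℝ, ∀ p, (dT + uU fun x => α * x⁻¹) p = (1, 0, α * p.2.1⁻¹ * p.2.2) := by
    simp [dT, uU]
  have h0 := projX_ne_zero hr
  refine ⟨fun k h => ?_, fun k h => ?_, fun k m h => ?_, fun k h => ?_, fun k m h => ?_,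
    fun k h => ?_, fun k h => ?_, fun k n h => ?_, fun k h => ?_, fun k n h => ?_,
    fun k n m h => ?_, fun k n h => ?_, fun k n m h => ?_⟩
  · have E₁ := eigen_id h0
    have E₂ := eigen_one (J := projX W) 1 0
    exact verified_powEq' hW hr (spanPair_diag (ne_x hr) E₁.deriv E₁.ne E₂.deriv E₂.ne
      one_ne_zero) (by ring) (by ring) (Or.inr (Or.inr (ne_of_gt h))) _ (by ring)
      Table.hasType_A36A1_dil (hT _) (Or.inl rfl)
  · exact verified_pow_jordan hW hr (eigen_sqrt h0) (by norm_num) (by norm_num) (by norm_num)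
      (by ring) (hT _) (Or.inl rfl)
  · obtain ⟨hk, h2, h3, h1⟩ := h
    have h' : 0 < 1 / 4 - m := sub_pos.2 h1
    have hs := Real.sqrt_pos.2 h'
    have hm : m + 2 ≠ 0 := fun h => h3 (by linarith)
    exact verified_pow_diag hW hr (eigen_rpow h0 _) (eigen_rpow h0 _) (fun h => by linarith) h2
      (by ring) (by linear_combination -(Real.sq_sqrt h'.le)) (by field_simp; ring) (hT _)
      (Or.inl rfl)
  · have hk : k ≠ 0 := ne_of_gt h
    have E₁ := eigen_sq h0
    have E₂ := eigen_inv h0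
    refine verified_powEq hW hr (spanPair_diag (ne_x hr) E₁.deriv E₁.ne E₂.deriv E₂.ne
      (by norm_num)) (by norm_num) (by norm_num) (by norm_num) (k / 9) (k / 3) 0 (by ring)
      (by ring) (by ring) (fun x _ => ?_) (Table.hasType_A42_right two_ne_zero
        (div_ne_zero hk three_ne_zero)) (fun p => ?_) (Or.inl rfl)
    · ring
    · simp only [dT, uU, Pi.add_apply, Prod.mk_add_mk, add_zero, zero_add]
      refine Prod.ext rfl (Prod.ext rfl ?_)
      simp only
      ring
  · obtain ⟨hk, h⟩ := h
    have h' : 0 < m - 1 / 4 := sub_pos.2 h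
    have hm : m + 2 ≠ 0 := by linarith
    exact verified_pow_cos hW hr (eigen_sqrt h0) (Real.sqrt_pos.2 h') (by norm_num)
      (by rw [Real.sq_sqrt h'.le]; ring) (by field_simp; ring) (hT _) (Or.inl rfl)
  · have E := eigen_one (J := projX W) 1 0
    have H := spanPair_jordan (ne_x hr) E.deriv E.ne (deriv_log hr)
    simp only [one_mul] at H
    exact verified_powEq' hW hr H (by norm_num) (by norm_num) (by norm_num)
      (-k) (by ring) Table.hasType_A43_dil.swap (hT _) (Or.inl rfl)
  · have hk : k ≠ 0 := ne_of_gt h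
    have E₁ := eigen_one (J := projX W) 1 0
    have E₂ := eigen_inv h0
    refine verified_powEq hW hr (spanPair_diag (ne_x hr) E₁.deriv E₁.ne E₂.deriv E₂.ne
      (by norm_num)) (by norm_num) (by norm_num) (by norm_num) k k 0 (by ring)
      (by ring) (by ring) (fun x _ => ?_) (Table.hasType_A34A1_dil hk) (fun p => ?_) (Or.inl rfl)
    · ring
    · simp only [dT, uU, Pi.add_apply, Prod.mk_add_mk, add_zero, zero_add]
      refine Prod.ext rfl (Prod.ext rfl ?_)
      simp only
      ring
  · obtain ⟨hk, hn0, hn1, hn2⟩ := h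
    have E₁ := eigen_rpow h0 (1 - n)
    have E₂ := eigen_one (J := projX W) 1 0
    have hn : n - 2 ≠ 0 := sub_ne_zero.2 hn2
    exact verified_powEq' hW hr (spanPair_diag (ne_x hr) E₂.deriv E₂.ne E₁.deriv E₁.ne
      (sub_ne_zero.2 hn1.symm).symm) (by ring) (by ring) (Or.inl hn0) _ (by field_simp; ring)
      (hasType_I11 hn0 hn1 hn2).swap (hT _) (Or.inl rfl)
  · have hk : k ≠ 0 := ne_of_gt h
    have E := eigen_inv h0
    refine verified_powEq hW hr (spanPair_jordan (ne_x hr) E.deriv E.ne (deriv_log hr))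
      (by norm_num) (by norm_num) (by norm_num) 0 0 (-(k / 2)) (by ring)
      (by ring) (by ring) (fun x _ => ?_) (Table.hasType_A44 hk) (fun p => ?_) (Or.inl rfl)
    · ring
    · simp only [dT, uU, Pi.add_apply, Prod.mk_add_mk, add_zero, zero_add]
      refine Prod.ext rfl (Prod.ext rfl ?_)
      simp only
      ring
  · obtain ⟨hk, hn0, hn1, hn3⟩ := h
    have hn : n - 3 ≠ 0 := sub_ne_zero.2 hn3
    exact verified_pow_jordan hW hr (eigen_rpow h0 _)
      (div_ne_zero (sub_ne_zero.2 hn1.symm) two_ne_zero) (by ring) (by ring)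
      (by field_simp; ring) (hT _) (Or.inl rfl)
  · obtain ⟨hk, hn0, hm0, hmn, h⟩ := h
    have h' : 0 < (n - 1) ^ 2 - 4 * m := by linarith
    have hs := Real.sqrt_pos.2 h'
    have hm : 2 - n + m ≠ 0 := fun h => hmn (by linarith)
    exact verified_pow_diag hW hr (eigen_rpow h0 _) (eigen_rpow h0 _) (fun h => by linarith) hm0
      (by ring) (by linear_combination -(Real.sq_sqrt h'.le) / 4) (by field_simp) (hT _)
      (Or.inr rfl)
  · obtain ⟨hk, hn0, hn2, hn3⟩ := h
    have hn : 3 - n ≠ 0 := sub_ne_zero.2 hn3.symm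
    have E₁ := eigen_inv h0
    have E₂ := eigen_rpow h0 (2 - n)
    refine verified_powEq hW hr (spanPair_diag (ne_x hr) E₁.deriv E₁.ne E₂.deriv E₂.ne
      (fun h => hn (by linarith))) (by ring) (by ring) (Or.inl hn0) 0 (k / (3 - n)) 0
      (by field_simp; ring) (by ring) (by ring) (fun x _ => ?_)
      (Table.hasType_A42_right (sub_ne_zero.2 hn2.symm) (div_ne_zero hk.ne' hn)).swap
      (fun p => ?_) (Or.inr rfl)
    · ring
    · simp only [dT, uU, Pi.add_apply, Prod.mk_add_mk, add_zero, zero_add]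
      refine Prod.ext rfl (Prod.ext rfl ?_)
      simp only
      ring
  · obtain ⟨hk, hn0, h⟩ := h
    have h' : 0 < m - (n - 1) ^ 2 / 4 := sub_pos.2 h
    have hm : 2 - n + m ≠ 0 := by nlinarith [sq_nonneg (n - 3)]
    exact verified_pow_cos hW hr (eigen_rpow h0 _) (Real.sqrt_pos.2 h') (by ring)
      (by rw [Real.sq_sqrt h'.le]; ring) (by field_simp) (hT _) (Or.inr rfl)

/-- `D = k t`. -/
theorem verified_III (hW : IsAdmissible W) :
    (∀ k, (entry (.III1 k)).valid → IsVerified W (.III1 k)) ∧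
    (∀ k, (entry (.III2 k)).valid → IsVerified W (.III2 k)) ∧
    (∀ k β, (entry (.III3 k β)).valid → IsVerified W (.III3 k β)) ∧
    (∀ k β, (entry (.III4 k β)).valid → IsVerified W (.III4 k β)) ∧
    (∀ k, (entry (.III5 k)).valid → IsVerified W (.III5 k)) ∧
    (∀ k m, (entry (.III6 k m)).valid → IsVerified W (.III6 k m)) ∧
    (∀ k m, (entry (.III7 k m)).valid → IsVerified W (.III7 k m)) := by
  have hT : ∀ α : ℝ, ∀ p, (dT + uU fun _ => α) p = (1, 0, α * p.2.2) := by
    simp [dT, uU]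
  refine ⟨fun k h => ?_, fun k h => ?_, fun k β h => ?_, fun k β h => ?_, fun k h => ?_,
    fun k m h => ?_, fun k m h => ?_⟩
  · have hk : k ≠ 0 := ne_of_gt h
    exact verified_constEq hW spanPair_x_one (by ring) (by ring) (Or.inr (Or.inr hk)) 0 0
      (-(k / 2)) (by ring) (by ring) (by ring) (fun x _ => by ring) (Table.hasType_A41 hk)
      (fun p => by simp [dT, uU]) (Or.inr rfl)
  · have hk : k ≠ 0 := ne_of_gt h
    have E₁ := eigen_exp_neg (J := projX W)
    have E₂ := eigen_one (J := projX W) 0 1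
    exact verified_constEq hW (spanPair_diag ne_one E₁.deriv E₁.ne E₂.deriv E₂.ne (by norm_num))
      (by ring) (by ring) (Or.inr (Or.inr hk)) 0 (-k) 0 (by ring) (by ring) (by ring)
      (fun x _ => by ring) (Table.hasType_A43_const hk) (fun p => by simp [dT, uU]) (Or.inr rfl)
  · have hβ := h.2
    exact verified_cos hW hβ (by field_simp) (hT _) (Or.inr rfl)
  · have hβ := h.2
    exact verified_cosh hW hβ (by field_simp) (hT _) (Or.inr rfl)
  · exact verified_const_jordan hW eigen_exp_neg_half (by norm_num) (by norm_num) (by norm_num)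
      (by ring) (hT _) (Or.inr rfl)
  · obtain ⟨hk, h1, h2⟩ := h
    have h' : 0 < 1 - 4 * m := by linarith
    have hs := Real.sqrt_pos.2 h'
    have hs2 := Real.sq_sqrt h'.le
    have E₁ := eigen_exp (J := projX W) (-((1 - √(1 - 4 * m)) / 2))
    have E₂ := eigen_exp (J := projX W) (-((1 + √(1 - 4 * m)) / 2))
    refine verified_constEq' hW (spanPair_diag ne_one E₁.deriv E₁.ne E₂.deriv E₂.ne
      (fun h => by linarith)) (by ring) (by linear_combination -hs2 / 4) (Or.inl one_ne_zero) _
      (by field_simp) (Table.hasType_A37A1_diag (fun h => h2 ?_) (sq_lt_sq.1 ?_)) (hT _)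
      (Or.inr rfl)
    · have h3 : √(1 - 4 * m) = 1 := by linarith
      rw [h3] at hs2
      linarith
    · nlinarith
  · obtain ⟨hk, h⟩ := h
    have h' : 0 < m - 1 / 4 := sub_pos.2 h
    have hm : m ≠ 0 := by linarith
    exact verified_const_cos hW eigen_exp_neg_half (by norm_num) (Real.sqrt_pos.2 h')
      (by norm_num) (by rw [Real.sq_sqrt h'.le]; ring) (by field_simp) (hT _) (Or.inr rfl)

theorem verified_IV (hW : IsAdmissible W) (hk : k ≠ 0) (hr : projTX W ⊆ (entry (.IV k)).regular) :
    IsVerified W (.IV k) := by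
  have he : InClass W (entry (.IV k)).eqn := ⟨hW, contDiffOn_const, contDiffOn_const,
    contDiffOn_const.mul (ContDiffOn.inv (by fun_prop) fun p hp => pow_ne_zero 2 (hr hp))⟩
  exact verified_wave he (μ := 1) (l := 0) (τ := 0) (ξ := 1) (fun _ => rfl) (fun _ => rfl) hk
    one_ne_zero one_ne_zero (by ring) (fun t x => by simp [entry])
    (fun t x htx => by simpa [entry] using hr htx) (fun p => rfl) rfl

theorem verified_V (hW : IsAdmissible W) (hv : (entry (.V k m)).valid)
    (hr : projTX W ⊆ (entry (.V k m)).regular) :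
    IsVerified W (.V k m) := by
  have he : InClass W (entry (.V k m)).eqn := ⟨hW, contDiffOn_const, contDiffOn_const,
    contDiffOn_const.mul (ContDiffOn.inv (by fun_prop) fun p hp => pow_ne_zero 2 (hr hp))⟩
  have hk : k ≠ 0 := ne_of_gt hv.1
  have e : ∀ t x, -k * t + 1 * x = x - k * t := fun t x => by ring
  exact verified_wave he (μ := -k) (l := 1) (τ := 1) (ξ := k) (fun _ => rfl) (fun _ => rfl) hv.2
    (neg_ne_zero.2 hk) hk (by ring) (fun t x => by rw [e]; rfl)
    (fun t x htx => by rw [e]; exact hr htx) (fun p => by simp [dT, dX]) rfl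

theorem verified_listed (a : Listed) (hv : (entry a).valid) (hW : IsAdmissible W)
    (hr : projTX W ⊆ (entry a).regular) :
    IsVerified W a := by
  obtain ⟨c1, c2, c3, c4, c5, c6⟩ := verified_I_const hW
  obtain ⟨d1, d2, d3, d4, d5, d6, d7⟩ := verified_III hW
  have hI := verified_I_pow (W := W) hW
  have hII := verified_II (W := W) hW
  cases a with
  | I1 β => exact c1 β hv
  | I2 β => exact c2 β hv
  | I3 => exact c3
  | I4 => exact c4
  | I5 m => exact c5 m hv
  | I6 m => exact c6 m hv
  | I7 => exact (hI hr).1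
  | I8 m => exact (hI hr).2.1 m hv
  | I9 m => exact (hI hr).2.2.1 m hv
  | I10 => exact (hI hr).2.2.2.1
  | I11 n => exact (hI hr).2.2.2.2.1 n hv
  | I12 n => exact (hI hr).2.2.2.2.2.1 n hv
  | I13 n m => exact (hI hr).2.2.2.2.2.2.1 n m hv
  | I14 n m => exact (hI hr).2.2.2.2.2.2.2 n m hv
  | II1 k => exact (hII hr).1 k hv
  | II2 k => exact (hII hr).2.1 k hv
  | II3 k m => exact (hII hr).2.2.1 k m hv
  | II4 k => exact (hII hr).2.2.2.1 k hv
  | II5 k m => exact (hII hr).2.2.2.2.1 k m hv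
  | II6 k => exact (hII hr).2.2.2.2.2.1 k hv
  | II7 k => exact (hII hr).2.2.2.2.2.2.1 k hv
  | II8 k n => exact (hII hr).2.2.2.2.2.2.2.1 k n hv
  | II9 k => exact (hII hr).2.2.2.2.2.2.2.2.1 k hv
  | II10 k n => exact (hII hr).2.2.2.2.2.2.2.2.2.1 k n hv
  | II11 k n m => exact (hII hr).2.2.2.2.2.2.2.2.2.2.1 k n m hv
  | II12 k n => exact (hII hr).2.2.2.2.2.2.2.2.2.2.2.1 k n hv
  | II13 k n m => exact (hII hr).2.2.2.2.2.2.2.2.2.2.2.2 k n m hv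
  | III1 k => exact d1 k hv
  | III2 k => exact d2 k hv
  | III3 k β => exact d3 k β hv
  | III4 k β => exact d4 k β hv
  | III5 k => exact d5 k hv
  | III6 k m => exact d6 k m hv
  | III7 k m => exact d7 k m hv
  | IV k => exact verified_IV hW hv hr
  | V k m => exact verified_V hW hv hr

end List

/-! ### Coincidences in the list -/

section Same

/-- A domain on which all listed equations are defined. -/
def commonDomain : Set Pt := {p | p.1 < 0 ∧ 0 < p.2.1 ∧ 0 < p.2.2}

theorem convex_commonDomain : Convex ℝ commonDomain := by
  have h1 : Convex ℝ {p : Pt | p.1 < 0} := convex_halfSpace_lt (LinearMap.fst ℝ ℝ (ℝ × ℝ)).isLinear 0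
  have h2 : Convex ℝ {p : Pt | 0 < p.2.1} :=
    convex_halfSpace_gt (LinearMap.fst ℝ ℝ ℝ ∘ₗ LinearMap.snd ℝ ℝ (ℝ × ℝ)).isLinear 0
  have h3 : Convex ℝ {p : Pt | 0 < p.2.2} :=
    convex_halfSpace_gt (LinearMap.snd ℝ ℝ ℝ ∘ₗ LinearMap.snd ℝ ℝ (ℝ × ℝ)).isLinear 0
  exact h1.inter (h2.inter h3)

theorem isAdmissible_commonDomain : IsAdmissible commonDomain where
  isOpen := (isOpen_lt continuous_fst continuous_const).inter
    ((isOpen_lt continuous_const (continuous_fst.comp continuous_snd)).inter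
      (isOpen_lt continuous_const (continuous_snd.comp continuous_snd)))
  isConnected := ⟨⟨(-1, 1, 1), by simp [commonDomain]⟩, convex_commonDomain.isPreconnected⟩
  u_ne_zero _ hp := hp.2.2.ne'
  slice x := (convex_commonDomain.inter (convex_hyperplane
    (LinearMap.fst ℝ ℝ ℝ ∘ₗ LinearMap.snd ℝ ℝ (ℝ × ℝ)).isLinear x)).isPreconnected

theorem mem_projTX_commonDomain {t x : ℝ} :
    (t, x) ∈ projTX commonDomain → t < 0 ∧ 0 < x := by
  rintro ⟨p, hp, h⟩
  obtain ⟨rfl, rfl⟩ := Prod.ext_iff.1 h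
  exact ⟨hp.1, hp.2.1⟩

theorem mem_regular {a : Listed} (hv : (entry a).valid) {t x : ℝ} (ht : t < 0) (hx : 0 < x) :
    (t, x) ∈ (entry a).regular := by
  cases a
  case IV k => exact ht.ne
  case V k m =>
    have hk : 0 < k := hv.1
    have : 0 < x - k * t := by nlinarith [mul_neg_of_pos_of_neg hk ht]
    exact this.ne'
  all_goals first | exact Set.mem_univ _ | exact hx.ne'

/-- Equations that a scaling carries into each other are equivalent. -/
theorem equivalent_of_scaling {a b : Listed} (ha : (entry a).valid) (hb : (entry b).valid) {κ : ℝ}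
    (hκ : 0 < κ) (hA : ∀ x, (entry a).eqn.A x = κ * (entry b).eqn.A (κ * x))
    (hB : ∀ x, (entry a).eqn.B x = κ ^ 2 * (entry b).eqn.B (κ * x))
    (hD : ∀ t x, (entry a).eqn.D t x = κ ^ 2 * (entry b).eqn.D (κ * t) (κ * x)) :
    ∃ W W' : Set Pt, IsAdmissible W ∧ projTX W ⊆ (entry a).regular ∧ IsAdmissible W' ∧
      projTX W' ⊆ (entry b).regular ∧ Equivalent W (entry a).eqn.rhs W' (entry b).eqn.rhs := by
  have hrel : Related commonDomain (entry a).eqn (entry b).eqn κ 0 0 1 (fun _ => 0) := by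
    refine ⟨hκ.ne', Or.inl rfl, contDiffOn_const, fun x _ => ?_, fun x _ => ?_, fun t x _ => ?_⟩
    · simpa using hA x
    · simpa using hB x
    · simpa [WaveEq.op] using hD t x
  obtain ⟨W', h1, h2, h3⟩ := hrel.equivalent isAdmissible_commonDomain
  refine ⟨commonDomain, W', isAdmissible_commonDomain, ?_, h1, ?_, h2⟩
  · rintro ⟨t, x⟩ h
    obtain ⟨ht, hx⟩ := mem_projTX_commonDomain h
    exact mem_regular ha ht hx
  · rintro ⟨s, y⟩ h
    obtain ⟨t, x, htx, rfl, rfl⟩ := h3 s y h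
    obtain ⟨ht, hx⟩ := mem_projTX_commonDomain htx
    refine mem_regular hb ?_ ?_
    · nlinarith [mul_neg_of_pos_of_neg hκ ht]
    · nlinarith [mul_pos hκ hx]

theorem equivalent_of_constEq {a b : Listed} (ha : (entry a).valid) (hb : (entry b).valid)
    {m k m' k' κ : ℝ} (hκ : 0 < κ) (ea : (entry a).eqn = constEq 0 m k)
    (eb : (entry b).eqn = constEq 0 m' k') (hm : m = κ ^ 2 * m') (hk : k = κ ^ 3 * k') :
    ∃ W W' : Set Pt, IsAdmissible W ∧ projTX W ⊆ (entry a).regular ∧ IsAdmissible W' ∧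
      projTX W' ⊆ (entry b).regular ∧ Equivalent W (entry a).eqn.rhs W' (entry b).eqn.rhs := by
  refine equivalent_of_scaling ha hb hκ ?_ ?_ ?_ <;> rw [ea, eb] <;> simp only [constEq]
  · simp
  · exact fun _ => hm
  · exact fun t x => by rw [hk]; ring

theorem equivalent_of_sameClass {a b : Listed} (ha : (entry a).valid) (hb : (entry b).valid)
    (h : SameClass a b) :
    ∃ W W' : Set Pt, IsAdmissible W ∧ projTX W ⊆ (entry a).regular ∧ IsAdmissible W' ∧
      projTX W' ⊆ (entry b).regular ∧ Equivalent W (entry a).eqn.rhs W' (entry b).eqn.rhs := by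
  have key : a = b → ∃ W W' : Set Pt, IsAdmissible W ∧ projTX W ⊆ (entry a).regular ∧
      IsAdmissible W' ∧ projTX W' ⊆ (entry b).regular ∧
      Equivalent W (entry a).eqn.rhs W' (entry b).eqn.rhs := by
    rintro rfl
    exact equivalent_of_scaling ha hb one_pos (by simp) (by simp) (by simp)
  have hq : ∀ {β β' : ℝ}, β ≠ 0 → β' ≠ 0 → 0 < |β| / |β'| ∧ β ^ 2 = (|β| / |β'|) ^ 2 * β' ^ 2 := by
    intro β β' h h'
    refine ⟨by positivity, ?_⟩
    rw [div_pow, sq_abs, sq_abs]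
    field_simp
  have hk3 : ∀ {β β' k k' : ℝ}, β' ≠ 0 → k * |β'| ^ 3 = k' * |β| ^ 3 →
      k = (|β| / |β'|) ^ 3 * k' := by
    intro β β' k k' h' h
    have := abs_pos.2 h'
    rw [div_pow]
    field_simp
    linarith
  unfold SameClass at h
  split at h
  · obtain ⟨h1, h2⟩ := hq ha hb
    exact equivalent_of_constEq ha hb h1 rfl rfl (by rw [h2]; ring) (by ring)
  · obtain ⟨h1, h2⟩ := hq ha hb
    exact equivalent_of_constEq ha hb h1 rfl rfl h2 (by ring)
  · rename_i k k'
    have hk : 0 < k := ha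
    have hk' : 0 < k' := hb
    have h3 : 0 < k / k' := div_pos hk hk'
    refine equivalent_of_constEq ha hb (κ := (k / k') ^ (1 / 3 : ℝ)) (by positivity) rfl rfl
      (by ring) ?_
    rw [← Real.rpow_natCast, ← Real.rpow_mul h3.le]
    norm_num
    field_simp
  · obtain ⟨h1, h2⟩ := hq ha.2 hb.2
    exact equivalent_of_constEq ha hb h1 rfl rfl h2 (hk3 hb.2 h)
  · obtain ⟨h1, h2⟩ := hq ha.2 hb.2
    exact equivalent_of_constEq ha hb h1 rfl rfl (by rw [h2]; ring) (hk3 hb.2 h)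
  · exact key h

end Same

/-! ### Invariants -/

section Invariants

/-- The families with `A = 0`, `B = m`, `D = k t`, in which a scaling changes the parameters. -/
def InScalingFamily (a : Listed) (m k : ℝ) : Prop :=
  (∃ β ≠ 0, a = .I1 β ∧ m = -β ^ 2 ∧ k = 0) ∨ (∃ β ≠ 0, a = .I2 β ∧ m = β ^ 2 ∧ k = 0) ∨
    (a = .III1 k ∧ 0 < k ∧ m = 0) ∨ (∃ β ≠ 0, a = .III3 k β ∧ 0 < k ∧ m = β ^ 2) ∨
    (∃ β ≠ 0, a = .III4 k β ∧ 0 < k ∧ m = -β ^ 2)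

/-- The listed equations have Euler coefficients, constant coefficients, or belong to `IV`, `V`.
Except for the scaling families, the coefficients determine the label. -/
theorem listed_cases {a : Listed} (hv : (entry a).valid) :
    (∃ n m k, (entry a).eqn = powEq n m k ∧ (entry a).regular = xNonzero ∧ 0 ≤ k ∧
      (n ≠ 0 ∨ m ≠ 0 ∨ k ≠ 0) ∧ a = powLabel n m k) ∨
    (∃ n m k, (entry a).eqn = constEq n m k ∧ (n ≠ 0 ∨ m ≠ 0 ∨ k ≠ 0) ∧
      ((n ≠ 0 ∧ 0 ≤ k ∧
        ((k = 0 ∧ m = 0 ∧ n = 1) ∨ (k = 0 ∧ m ≠ 0 ∧ n = 2) ∨ (k ≠ 0 ∧ n = 1)) ∧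
        a = constLabel n m k) ∨ (n = 0 ∧ InScalingFamily a m k))) ∨
    ((∃ k ≠ 0, a = .IV k) ∨ (∃ k m, a = .V k m ∧ 0 < k ∧ m ≠ 0)) := by
  cases a with
  | IV k => exact Or.inr (Or.inr (Or.inl ⟨k, hv, rfl⟩))
  | V k m => exact Or.inr (Or.inr (Or.inr ⟨k, m, rfl, hv⟩))
  | I1 β => exact Or.inr (Or.inl ⟨_, _, _, rfl, Or.inr (Or.inl (neg_ne_zero.2 (pow_ne_zero 2 hv))),
      Or.inr ⟨rfl, Or.inl ⟨β, hv, rfl, rfl, rfl⟩⟩⟩)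
  | I2 β => exact Or.inr (Or.inl ⟨_, _, _, rfl, Or.inr (Or.inl (pow_ne_zero 2 hv)),
      Or.inr ⟨rfl, Or.inr (Or.inl ⟨β, hv, rfl, rfl, rfl⟩)⟩⟩)
  | III1 k => exact Or.inr (Or.inl ⟨_, _, _, rfl, Or.inr (Or.inr (ne_of_gt hv)),
      Or.inr ⟨rfl, Or.inr (Or.inr (Or.inl ⟨rfl, hv, rfl⟩))⟩⟩)
  | III3 k β => exact Or.inr (Or.inl ⟨_, _, _, rfl, Or.inr (Or.inr (ne_of_gt hv.1)),
      Or.inr ⟨rfl, Or.inr (Or.inr (Or.inr (Or.inl ⟨β, hv.2, rfl, hv.1, rfl⟩)))⟩⟩)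
  | III4 k β => exact Or.inr (Or.inl ⟨_, _, _, rfl, Or.inr (Or.inr (ne_of_gt hv.1)),
      Or.inr ⟨rfl, Or.inr (Or.inr (Or.inr (Or.inr ⟨β, hv.2, rfl, hv.1, rfl⟩)))⟩⟩)
  | I14 n m =>
    have h1 : (n - 1) ^ 2 / 4 < m := hv.2
    have h2 : 0 ≤ (n - 1) ^ 2 / 4 := by positivity
    have hn : n ≠ 0 := hv.1
    refine Or.inl ⟨n, m, 0, rfl, rfl, le_rfl, Or.inl hn, ?_⟩
    unfold powLabel
    grind
  | II13 k n m =>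
    have h1 : (n - 1) ^ 2 / 4 < m := hv.2.2
    have h2 : 0 ≤ (n - 1) ^ 2 / 4 := by positivity
    have hn : n ≠ 0 := hv.2.1
    have hk : 0 < k := hv.1
    have hm : m ≠ n - 2 := by nlinarith [sq_nonneg (n - 3)]
    refine Or.inl ⟨n, m, k, rfl, rfl, hk.le, Or.inl hn, ?_⟩
    unfold powLabel
    grind
  | _ =>
    simp only [entry] at hv
    first
    | refine Or.inl ⟨_, _, _, rfl, rfl, ?_, ?_, ?_⟩
      · first | exact le_rfl | grind
      · grind
      · unfold powLabel; grind
    | refine Or.inr (Or.inl ⟨_, _, _, rfl, Or.inl (by norm_num), Or.inl ⟨by norm_num, ?_, ?_, ?_⟩⟩)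
      · first | exact le_rfl | grind
      · grind
      · unfold constLabel; grind

/-- Constant or Euler coefficients: `A = n / z`, `B = m / z²`, `D = k t / z³`, where `z = 1` if
`c = 0`, and `z = x` if `c = 1`. -/
structure IsEuler (J : Set ℝ) (e : WaveEq) (c n m k : ℝ) : Prop where
  ne : ∀ x ∈ J, c * x + (1 - c) ≠ 0
  eqA : ∀ x, e.A x = n * (c * x + (1 - c))⁻¹
  eqB : ∀ x, e.B x = m * ((c * x + (1 - c)) ^ 2)⁻¹
  eqD : ∀ t x, e.D t x = k * t * ((c * x + (1 - c)) ^ 3)⁻¹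

/-- `A = B = 0` and `D = K z⁻²`, where `z = μ t + l x` depends on `t`. -/
structure IsWave (U : Set (ℝ × ℝ)) (e : WaveEq) (K μ l : ℝ) : Prop where
  K_ne : K ≠ 0
  μ_ne : μ ≠ 0
  ne : ∀ t x, (t, x) ∈ U → μ * t + l * x ≠ 0
  eqD : ∀ t x, e.D t x = K * ((μ * t + l * x) ^ 2)⁻¹

theorem isEuler_constEq (J : Set ℝ) (n m k : ℝ) : IsEuler J (constEq n m k) 0 n m k := by
  constructor <;> simp [constEq]

theorem isEuler_powEq {J : Set ℝ} (hJ : ∀ x ∈ J, x ≠ 0) (n m k : ℝ) :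
    IsEuler J (powEq n m k) 1 n m k := by
  constructor <;> simp [powEq]
  simpa using hJ

theorem isWave_IV {U : Set (ℝ × ℝ)} {k : ℝ} (hk : k ≠ 0) (hU : U ⊆ (entry (.IV k)).regular) :
    IsWave U (entry (.IV k)).eqn k 1 0 := by
  refine ⟨hk, one_ne_zero, fun t x h => ?_, fun t x => ?_⟩
  · simpa [entry] using hU h
  · simp [entry]

theorem isWave_V {U : Set (ℝ × ℝ)} {k m : ℝ} (hk : k ≠ 0) (hm : m ≠ 0)
    (hU : U ⊆ (entry (.V k m)).regular) : IsWave U (entry (.V k m)).eqn m (-k) 1 := by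
  have e : ∀ t x, -k * t + 1 * x = x - k * t := fun t x => by ring
  refine ⟨hm, neg_ne_zero.2 hk, fun t x h => ?_, fun t x => ?_⟩
  · rw [e]
    exact hU h
  · rw [e]
    rfl

theorem IsEuler.dt_eq {J : Set ℝ} {e : WaveEq} {c n m k : ℝ} (h : IsEuler J e c n m k) (t x : ℝ) :
    dt e.D t x = k * ((c * x + (1 - c)) ^ 3)⁻¹ := by
  rw [dt, show (fun s => e.D s x) = _ from funext fun s => h.eqD s x]
  exact (((hasDerivAt_id' t).const_mul k).mul_const _).deriv.trans (by ring)

theorem IsWave.dt_eq {U : Set (ℝ × ℝ)} {e : WaveEq} {K μ l : ℝ} (h : IsWave U e K μ l) {t x : ℝ}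
    (htx : (t, x) ∈ U) : dt e.D t x = -2 * K * μ * ((μ * t + l * x) ^ 3)⁻¹ := by
  have h1 : HasDerivAt (fun s => μ * s + l * x) μ t := by
    simpa using ((hasDerivAt_id' t).const_mul μ).add_const (l * x)
  have h2 := ((hasDerivAt_pow_inv 2 (h.ne t x htx)).comp t h1).const_mul K
  rw [dt, show (fun s => e.D s x) = _ from funext fun s => h.eqD s x]
  exact h2.deriv.trans (by push_cast; ring)

variable {W : Set Pt} {e e' : WaveEq} {κ κ₁ κ₂ ε : ℝ} {θ : ℝ → ℝ}

theorem Related.dt_eq (h : Related W e e' κ κ₁ κ₂ ε θ) (hW : IsOpen W) {t x : ℝ}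
    (htx : (t, x) ∈ projTX W) :
    dt e.D t x = κ ^ 3 * dt e'.D (κ * t + κ₁) (ε * κ * x + κ₂) := by
  have h1 : (fun s => e.D s x) =ᶠ[𝓝 t]
      fun s => e.op θ x + κ ^ 2 * e'.D (κ * s + κ₁) (ε * κ * x + κ₂) := by
    filter_upwards [(continuous_id.prodMk continuous_const).continuousAt.preimage_mem_nhds
      ((isOpen_projTX hW).mem_nhds htx)] with s hs using h.eqD s x hs
  have h2 : deriv (fun s => e'.D (κ * s + κ₁) (ε * κ * x + κ₂)) t
      = κ * dt e'.D (κ * t + κ₁) (ε * κ * x + κ₂) := by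
    have h3 := deriv_comp_mul_left κ (fun s => e'.D (s + κ₁) (ε * κ * x + κ₂)) t
    rw [deriv_comp_add_const (f := fun s => e'.D s (ε * κ * x + κ₂))] at h3
    exact h3
  rw [dt, h1.deriv_eq, deriv_const_add, deriv_const_mul_field, h2]
  ring

/-- A cubic polynomial that vanishes on a nonempty open set is zero. -/
theorem cubic_eq_zero {J : Set ℝ} (hJ : IsOpen J) (hne : J.Nonempty) {a₀ a₁ a₂ a₃ : ℝ}
    (h : ∀ x ∈ J, a₀ + a₁ * x + a₂ * x ^ 2 + a₃ * x ^ 3 = 0) :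
    a₀ = 0 ∧ a₁ = 0 ∧ a₂ = 0 ∧ a₃ = 0 := by
  open Polynomial in
  obtain ⟨x, hx⟩ := hne
  have hz : (C a₀ + C a₁ * X + C a₂ * X ^ 2 + C a₃ * X ^ 3 : ℝ[X]) = 0 := by
    refine eq_zero_of_infinite_isRoot _ ((infinite_of_mem_nhds x (hJ.mem_nhds hx)).mono ?_)
    intro y hy
    simpa [IsRoot] using h y hy
  refine ⟨?_, ?_, ?_, ?_⟩
  · simpa [coeff_X, coeff_X_pow, coeff_C] using congrArg (coeff · 0) hz
  · simpa [coeff_X, coeff_X_pow, coeff_C] using congrArg (coeff · 1) hz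
  · simpa [coeff_X, coeff_X_pow, coeff_C] using congrArg (coeff · 2) hz
  · simpa [coeff_X, coeff_X_pow, coeff_C] using congrArg (coeff · 3) hz

end Invariants

section Inequivalence

variable {W : Set Pt} {e e' : WaveEq} {κ κ₁ κ₂ ε : ℝ} {θ : ℝ → ℝ} {J' : Set ℝ}
  {U' : Set (ℝ × ℝ)} {c c' n m k n' m' k' K μ l K' μ' l' : ℝ}

/-- The relations between the coefficients, without denominators. -/
theorem Related.euler (h : Related W e e' κ κ₁ κ₂ ε θ) (hW : IsOpen W)
    (h1 : IsEuler (projX W) e c n m k) (h2 : IsEuler J' e' c' n' m' k')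
    (hmap : ∀ x ∈ projX W, ε * κ * x + κ₂ ∈ J') {x : ℝ} (hx : x ∈ projX W) :
    n * (c' * (ε * κ * x + κ₂) + (1 - c')) = ε * κ * n' * (c * x + (1 - c)) ∧
    m * (c' * (ε * κ * x + κ₂) + (1 - c')) ^ 2 = κ ^ 2 * m' * (c * x + (1 - c)) ^ 2 ∧
    k * (c' * (ε * κ * x + κ₂) + (1 - c')) ^ 3 = κ ^ 3 * k' * (c * x + (1 - c)) ^ 3 := by
  have z1 := h1.ne x hx
  have z2 := h2.ne _ (hmap x hx)
  have eA := h.eqA x hx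
  have eB := h.eqB x hx
  obtain ⟨t, htx⟩ := exists_of_mem_projX hx
  have eD := h.dt_eq hW htx
  rw [h1.eqA, h2.eqA] at eA
  rw [h1.eqB, h2.eqB] at eB
  rw [h1.dt_eq, h2.dt_eq] at eD
  generalize c * x + (1 - c) = z at *
  generalize c' * (ε * κ * x + κ₂) + (1 - c') = z' at *
  field_simp at eA eB eD
  exact ⟨by linarith, by linarith, by linarith⟩

/-- Between constant coefficients there are only the scalings. -/
theorem Related.const_const (h : Related W (constEq n m k) (constEq n' m' k') κ κ₁ κ₂ ε θ)
    (hW : IsAdmissible W) : n = ε * κ * n' ∧ m = κ ^ 2 * m' ∧ k = κ ^ 3 * k' := by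
  obtain ⟨x, hx⟩ : (projX W).Nonempty := hW.isConnected.nonempty.image _
  simpa using h.euler hW.isOpen (isEuler_constEq _ n m k) (isEuler_constEq Set.univ n' m' k')
    (fun _ _ => trivial) hx

/-- Euler coefficients are invariants: the shift in `x` cannot move the pole, and scalings do not
change the parameters. -/
theorem Related.pow_pow (h : Related W (powEq n m k) (powEq n' m' k') κ κ₁ κ₂ ε θ)
    (hW : IsAdmissible W) (hx0 : ∀ x ∈ projX W, x ≠ 0)
    (hx0' : ∀ x ∈ projX W, ε * κ * x + κ₂ ≠ 0) (hk : 0 ≤ k) (hk' : 0 ≤ k') :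
    n = n' ∧ m = m' ∧ k = k' := by
  have hJ := isOpen_projX hW.isOpen
  have hne : (projX W).Nonempty := hW.isConnected.nonempty.image _
  have key := fun {x} (hx : x ∈ projX W) => h.euler hW.isOpen (isEuler_powEq hx0 n m k)
    (isEuler_powEq (J := {x | x ≠ 0}) (fun _ => id) n' m' k') hx0' hx
  have hκ := h.k_ne
  have hε2 : ε ^ 2 = 1 := by rcases h.sign with rfl | rfl <;> norm_num
  have hε0 : ε ≠ 0 := by rintro rfl; norm_num at hε2
  obtain ⟨-, e1, -, -⟩ := cubic_eq_zero hJ hne (a₀ := n * κ₂) (a₁ := ε * κ * (n - n')) (a₂ := 0)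
    (a₃ := 0) fun x hx => by linear_combination (key hx).1
  obtain ⟨-, -, e2, -⟩ := cubic_eq_zero hJ hne (a₀ := m * κ₂ ^ 2) (a₁ := 2 * m * (ε * κ) * κ₂)
    (a₂ := κ ^ 2 * (m - m')) (a₃ := 0) fun x hx => by
      linear_combination (key hx).2.1 - m * κ ^ 2 * x ^ 2 * hε2
  obtain ⟨-, -, -, e3⟩ := cubic_eq_zero hJ hne (a₀ := k * κ₂ ^ 3)
    (a₁ := 3 * k * (ε * κ) * κ₂ ^ 2) (a₂ := 3 * k * (ε * κ) ^ 2 * κ₂)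
    (a₃ := κ ^ 3 * (ε * k - k')) fun x hx => by
      linear_combination (key hx).2.2 - ε * k * κ ^ 3 * x ^ 3 * hε2
  have e4 : ε * k = k' := sub_eq_zero.1 ((mul_eq_zero.1 e3).resolve_left (pow_ne_zero 3 hκ))
  refine ⟨sub_eq_zero.1 ((mul_eq_zero.1 e1).resolve_left (mul_ne_zero hε0 hκ)),
    sub_eq_zero.1 ((mul_eq_zero.1 e2).resolve_left (pow_ne_zero 2 hκ)), ?_⟩
  rcases h.sign with rfl | rfl <;> linarith

/-- Constant coefficients are not carried into Euler coefficients, unless all of them vanish: a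
constant multiple of a power of a nonconstant affine function is not constant. -/
theorem Related.not_const_pow (h : Related W (constEq n m k) (powEq n' m' k') κ κ₁ κ₂ ε θ)
    (hW : IsAdmissible W) (hx0' : ∀ x ∈ projX W, ε * κ * x + κ₂ ≠ 0) :
    n = 0 ∧ m = 0 ∧ k = 0 := by
  have hJ := isOpen_projX hW.isOpen
  have hne : (projX W).Nonempty := hW.isConnected.nonempty.image _
  have key := fun {x} (hx : x ∈ projX W) => h.euler hW.isOpen (isEuler_constEq _ n m k)
    (isEuler_powEq (J := {x | x ≠ 0}) (fun _ => id) n' m' k') hx0' hx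
  have hl : ε * κ ≠ 0 := mul_ne_zero
    (by rcases h.sign with rfl | rfl <;> norm_num) h.k_ne
  obtain ⟨-, e1, -, -⟩ := cubic_eq_zero hJ hne (a₀ := n * κ₂ - ε * κ * n') (a₁ := n * (ε * κ))
    (a₂ := 0) (a₃ := 0) fun x hx => by linear_combination (key hx).1
  obtain ⟨-, -, e2, -⟩ := cubic_eq_zero hJ hne (a₀ := m * κ₂ ^ 2 - κ ^ 2 * m')
    (a₁ := 2 * m * (ε * κ) * κ₂) (a₂ := m * (ε * κ) ^ 2) (a₃ := 0) fun x hx => by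
      linear_combination (key hx).2.1
  obtain ⟨-, -, -, e3⟩ := cubic_eq_zero hJ hne (a₀ := k * κ₂ ^ 3 - κ ^ 3 * k')
    (a₁ := 3 * k * (ε * κ) * κ₂ ^ 2) (a₂ := 3 * k * (ε * κ) ^ 2 * κ₂)
    (a₃ := k * (ε * κ) ^ 3) fun x hx => by linear_combination (key hx).2.2
  exact ⟨(mul_eq_zero.1 e1).resolve_right hl,
    (mul_eq_zero.1 e2).resolve_right (pow_ne_zero 2 hl),
    (mul_eq_zero.1 e3).resolve_right (pow_ne_zero 3 hl)⟩

/-- The converse of `Related.not_const_pow`. -/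
theorem Related.not_pow_const (h : Related W (powEq n m k) (constEq n' m' k') κ κ₁ κ₂ ε θ)
    (hW : IsAdmissible W) (hx0 : ∀ x ∈ projX W, x ≠ 0) : n = 0 ∧ m = 0 ∧ k = 0 := by
  have hJ := isOpen_projX hW.isOpen
  have hne : (projX W).Nonempty := hW.isConnected.nonempty.image _
  have key := fun {x} (hx : x ∈ projX W) => h.euler hW.isOpen (isEuler_powEq hx0 n m k)
    (isEuler_constEq Set.univ n' m' k') (fun _ _ => trivial) hx
  obtain ⟨e1, -, -, -⟩ := cubic_eq_zero hJ hne (a₀ := n) (a₁ := -(ε * κ * n'))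
    (a₂ := 0) (a₃ := 0) fun x hx => by linear_combination (key hx).1
  obtain ⟨e2, -, -, -⟩ := cubic_eq_zero hJ hne (a₀ := m) (a₁ := 0) (a₂ := -(κ ^ 2 * m'))
    (a₃ := 0) fun x hx => by linear_combination (key hx).2.1
  obtain ⟨e3, -, -, -⟩ := cubic_eq_zero hJ hne (a₀ := k) (a₁ := 0) (a₂ := 0)
    (a₃ := -(κ ^ 3 * k')) fun x hx => by linear_combination (key hx).2.2
  exact ⟨e1, e2, e3⟩

theorem exists_shift {U : Set (ℝ × ℝ)} (hU : IsOpen U) {t x : ℝ} (h : (t, x) ∈ U) :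
    ∃ δ ≠ 0, (t + δ, x) ∈ U ∧ (t, x + δ) ∈ U := by
  have hc₁ : Continuous (fun δ : ℝ => ((t + δ, x) : ℝ × ℝ)) := by fun_prop
  have hc₂ : Continuous (fun δ : ℝ => ((t, x + δ) : ℝ × ℝ)) := by fun_prop
  have h₁ := hc₁.continuousAt.preimage_mem_nhds (x := 0) (hU.mem_nhds (by simpa using h))
  have h₂ := hc₂.continuousAt.preimage_mem_nhds (x := 0) (hU.mem_nhds (by simpa using h))
  obtain ⟨r, hr, hb⟩ := Metric.mem_nhds_iff.1 (inter_mem h₁ h₂)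
  have h₃ := hb (show r / 2 ∈ Metric.ball (0 : ℝ) r by simp [abs_of_pos hr, hr])
  exact ⟨r / 2, by positivity, h₃⟩

theorem pow_three_injective : Function.Injective fun x : ℝ => x ^ 3 :=
  (show Odd 3 by decide).strictMono_pow.injective

/-- For constant or Euler coefficients `D_t` does not depend on `t`, for the others it does. -/
theorem Related.not_euler_wave (h : Related W e e' κ κ₁ κ₂ ε θ) (hW : IsAdmissible W)
    (h1 : IsEuler (projX W) e c n m k) (h2 : IsWave U' e' K μ l)
    (hmap : ∀ t x, (t, x) ∈ projTX W → (κ * t + κ₁, ε * κ * x + κ₂) ∈ U') : False := by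
  obtain ⟨⟨t, x, u⟩, hp⟩ := hW.isConnected.nonempty
  obtain ⟨δ, hδ, hp', -⟩ := exists_shift (isOpen_projTX hW.isOpen) (mem_projTX hp)
  have e1 := h.dt_eq hW.isOpen (mem_projTX hp)
  have e2 := h.dt_eq hW.isOpen hp'
  rw [h1.dt_eq, h2.dt_eq (hmap _ _ (mem_projTX hp))] at e1
  rw [h1.dt_eq, h2.dt_eq (hmap _ _ hp')] at e2
  rw [e2] at e1
  have e3 := mul_left_cancel₀ (pow_ne_zero 3 h.k_ne) e1
  have e4 := mul_left_cancel₀ (mul_ne_zero (mul_ne_zero (by norm_num) h2.K_ne) h2.μ_ne) e3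
  have e5 := pow_three_injective (inv_injective e4)
  have e6 : μ * (κ * δ) = 0 := by linarith
  exact mul_ne_zero h2.μ_ne (mul_ne_zero h.k_ne hδ) e6

theorem Related.not_wave_euler (h : Related W e e' κ κ₁ κ₂ ε θ) (hW : IsAdmissible W)
    (h1 : IsWave (projTX W) e K μ l) (h2 : IsEuler J' e' c n m k) : False := by
  obtain ⟨⟨t, x, u⟩, hp⟩ := hW.isConnected.nonempty
  obtain ⟨δ, hδ, hp', -⟩ := exists_shift (isOpen_projTX hW.isOpen) (mem_projTX hp)
  have e1 := h.dt_eq hW.isOpen (mem_projTX hp)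
  have e2 := h.dt_eq hW.isOpen hp'
  rw [h2.dt_eq, h1.dt_eq (mem_projTX hp)] at e1
  rw [h2.dt_eq, h1.dt_eq hp'] at e2
  rw [← e2] at e1
  have e4 := mul_left_cancel₀ (mul_ne_zero (mul_ne_zero (by norm_num) h1.K_ne) h1.μ_ne) e1
  have e5 := pow_three_injective (inv_injective e4)
  have e6 : μ * δ = 0 := by linarith
  exact mul_ne_zero h1.μ_ne hδ e6

/-- The linear forms in the denominators are proportional. -/
theorem Related.wave_wave (h : Related W e e' κ κ₁ κ₂ ε θ) (hW : IsAdmissible W)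
    (h1 : IsWave (projTX W) e K μ l) (h2 : IsWave U' e' K' μ' l')
    (hmap : ∀ t x, (t, x) ∈ projTX W → (κ * t + κ₁, ε * κ * x + κ₂) ∈ U') :
    ∃ ρ : ℝ, μ' * κ = ρ * μ ∧ l' * (ε * κ) = ρ * l ∧ K * μ * ρ ^ 3 = κ ^ 3 * (K' * μ') := by
  have hU := isOpen_projTX hW.isOpen
  have key : ∀ t x, (t, x) ∈ projTX W →
      K * μ * (μ' * (κ * t + κ₁) + l' * (ε * κ * x + κ₂)) ^ 3
        = κ ^ 3 * (K' * μ') * (μ * t + l * x) ^ 3 := fun t x htx => by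
    have e1 := h.dt_eq hW.isOpen htx
    have z1 := h1.ne _ _ htx
    have z2 := h2.ne _ _ (hmap _ _ htx)
    rw [h1.dt_eq htx, h2.dt_eq (hmap _ _ htx)] at e1
    generalize μ * t + l * x = z at *
    generalize μ' * (κ * t + κ₁) + l' * (ε * κ * x + κ₂) = z' at *
    field_simp at e1
    linear_combination -e1
  obtain ⟨⟨t, x, u⟩, hp⟩ := hW.isConnected.nonempty
  have hp := mem_projTX hp
  obtain ⟨δ, hδ, hp₁, hp₂⟩ := exists_shift hU hp
  simp only at hp hp₁ hp₂
  have z0 := h1.ne _ _ hp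
  set ρ := (μ' * (κ * t + κ₁) + l' * (ε * κ * x + κ₂)) / (μ * t + l * x) with hρ
  have e0 : K * μ * ρ ^ 3 = κ ^ 3 * (K' * μ') := by
    rw [hρ, div_pow, mul_div_assoc', div_eq_iff (pow_ne_zero 3 z0)]
    exact key t x hp
  have prop : ∀ t x, (t, x) ∈ projTX W →
      μ' * (κ * t + κ₁) + l' * (ε * κ * x + κ₂) = ρ * (μ * t + l * x) := fun t x htx => by
    have e1 := key t x htx
    rw [← e0, mul_assoc (K * μ), ← mul_pow] at e1
    exact pow_three_injective (mul_left_cancel₀ (mul_ne_zero h1.K_ne h1.μ_ne) e1)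
  have f0 := prop _ _ hp
  have f1 := prop _ _ hp₁
  have f2 := prop _ _ hp₂
  exact ⟨ρ, mul_right_cancel₀ hδ (by linarith), mul_right_cancel₀ hδ (by linarith), e0⟩

theorem sameClass_refl (a : Listed) : SameClass a a := by
  cases a <;> simp [SameClass]

/-- Equations with constant coefficients and `A = 0` differ by a scaling at most. -/
theorem sameClass_of_scaling {a b : Listed} {m k m' k' κ : ℝ} (hκ : κ ≠ 0) (hm : m = κ ^ 2 * m')
    (hk : k = κ ^ 3 * k')
    (ha : InScalingFamily a m k) (hb : InScalingFamily b m' k') : SameClass a b := by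
  have sq : ∀ {β : ℝ}, β ≠ 0 → 0 < β ^ 2 := fun h => by positivity
  have h2 : 0 < κ ^ 2 := sq hκ
  -- the signs of `m` and `k` are invariants
  have m_pos : 0 < m ↔ 0 < m' := by rw [hm]; exact mul_pos_iff_of_pos_left h2
  have m_neg : m < 0 ↔ m' < 0 := by rw [hm]; simp [mul_neg_iff, h2, h2.not_gt]
  have k_zero : k = 0 ↔ k' = 0 := by rw [hk]; simp [hκ]
  have κ_pos : 0 < k → 0 < k' → 0 < κ := fun h h' => by
    rw [hk] at h
    exact (show Odd 3 by decide).pow_pos_iff.1 (pos_of_mul_pos_left h h'.le)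
  have scale : ∀ {β β' : ℝ}, 0 < k → 0 < k' → β ^ 2 = κ ^ 2 * β' ^ 2 →
      k * |β'| ^ 3 = k' * |β| ^ 3 := fun {β β'} h h' hβ => by
    have e : |β| = κ * |β'| := by
      rw [← abs_of_pos (κ_pos h h'), ← abs_mul]
      exact (sq_eq_sq_iff_abs_eq_abs _ _).1 (by rw [hβ]; ring)
    rw [e, hk]
    ring
  rcases ha with ⟨β, hβ, rfl, h3, h4⟩ | ⟨β, hβ, rfl, h3, h4⟩ | ⟨rfl, h3, h4⟩ | ⟨β, hβ, rfl, h3, h4⟩ |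
    ⟨β, hβ, rfl, h3, h4⟩ <;>
  rcases hb with ⟨β', hβ', rfl, h5, h6⟩ | ⟨β', hβ', rfl, h5, h6⟩ | ⟨rfl, h5, h6⟩ |
    ⟨β', hβ', rfl, h5, h6⟩ | ⟨β', hβ', rfl, h5, h6⟩ <;>
  simp only [SameClass, reduceCtorEq] <;>
  first
  | exact scale h3 h5 (by nlinarith)
  | (have := sq hβ; have := sq hβ'; grind)
  | (have := sq hβ; grind)
  | (have := sq hβ'; grind)

/-- Equivalent equations of the list have related coefficients, which compares the three kinds of
coefficients. Between equations of the same kind, the parameters agree up to the scalings. -/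
theorem sameClass_of_equivalent {a b : Listed} (ha : (entry a).valid) (hb : (entry b).valid)
    {W W' : Set Pt} (hW : IsAdmissible W) (hWa : projTX W ⊆ (entry a).regular)
    (hW' : IsAdmissible W') (hWb : projTX W' ⊆ (entry b).regular)
    (h : Equivalent W (entry a).eqn.rhs W' (entry b).eqn.rhs) : SameClass a b := by
  obtain ⟨κ, κ₁, κ₂, ε, θ, hr, hmap⟩ := h.exists_related hW hW'
  have hκ := hr.k_ne
  have hε0 : ε ≠ 0 := by rcases hr.sign with rfl | rfl <;> norm_num
  have hmapx : ∀ x ∈ projX W, ε * κ * x + κ₂ ∈ projX W' := fun x hx => by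
    obtain ⟨t, htx⟩ := exists_of_mem_projX hx
    exact mem_projX_of_projTX (hmap t x htx)
  have wave : ∀ {U : Set (ℝ × ℝ)} {a : Listed}, U ⊆ (entry a).regular →
      ((∃ k ≠ 0, a = .IV k) ∨ ∃ k m, a = .V k m ∧ 0 < k ∧ m ≠ 0) →
      ∃ K μ l, IsWave U (entry a).eqn K μ l := by
    rintro U a hU (⟨k, hk, rfl⟩ | ⟨k, m, rfl, hk, hm⟩)
    · exact ⟨_, _, _, isWave_IV hk hU⟩
    · exact ⟨_, _, _, isWave_V hk.ne' hm hU⟩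
  rcases listed_cases ha with ⟨n, m, k, e, er, hk, hne, ea⟩ | ⟨n, m, k, e, hne, hd⟩ | ca <;>
    rcases listed_cases hb with ⟨n', m', k', e', er', hk', hne', eb⟩ |
      ⟨n', m', k', e', hne', hd'⟩ | cb
  · rw [e, e'] at hr
    rw [er] at hWa
    rw [er'] at hWb
    obtain ⟨rfl, rfl, rfl⟩ := hr.pow_pow hW (projX_ne_zero hWa)
      (fun x hx => projX_ne_zero hWb _ (hmapx x hx)) hk hk'
    rw [ea, ← eb]
    exact sameClass_refl b
  · rw [e, e'] at hr
    rw [er] at hWa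
    obtain ⟨h1, h2, h3⟩ := hr.not_pow_const hW (projX_ne_zero hWa)
    tauto
  · rw [er] at hWa
    obtain ⟨K, μ, l, h2⟩ := wave hWb cb
    exact (hr.not_euler_wave hW (e ▸ isEuler_powEq (projX_ne_zero hWa) n m k) h2 hmap).elim
  · rw [e, e'] at hr
    rw [er'] at hWb
    obtain ⟨h1, h2, h3⟩ := hr.not_const_pow hW fun x hx => projX_ne_zero hWb _ (hmapx x hx)
    tauto
  · rw [e, e'] at hr
    obtain ⟨h1, h2, h3⟩ := hr.const_const hW
    have hn : n = 0 ↔ n' = 0 := by rw [h1]; simp [hε0, hκ]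
    have hm : m = 0 ↔ m' = 0 := by rw [h2]; simp [hκ]
    have hk : k = 0 ↔ k' = 0 := by rw [h3]; simp [hκ]
    rcases hd with ⟨hn0, hk0, hd, ea⟩ | ⟨hn0, hd⟩ <;>
      rcases hd' with ⟨hn0', hk0', hd', eb⟩ | ⟨hn0', hd'⟩
    · have e1 : n = n' := by grind
      have e2 : ε * κ = 1 := by
        rw [← e1] at h1
        exact mul_right_cancel₀ hn0 (by linarith)
      have e3 : m = m' ∧ k = k' := by
        rcases hr.sign with h | h <;> rw [h] at e2
        · have e4 : κ = 1 := by linarith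
          rw [e4] at h2 h3
          exact ⟨by linarith, by linarith⟩
        · have e4 : κ = -1 := by linarith
          rw [e4] at h2 h3
          exact ⟨by linarith, by linarith⟩
      rw [ea, e1, e3.1, e3.2, ← eb]
      exact sameClass_refl b
    · exact (hn0 (hn.2 hn0')).elim
    · exact (hn0' (hn.1 hn0)).elim
    · exact sameClass_of_scaling hκ h2 h3 hd hd'
  · obtain ⟨K, μ, l, h2⟩ := wave hWb cb
    exact (hr.not_euler_wave hW (e ▸ isEuler_constEq _ n m k) h2 hmap).elim
  · rw [er'] at hWb
    obtain ⟨K, μ, l, h1⟩ := wave hWa ca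
    exact (hr.not_wave_euler hW h1 (e' ▸ isEuler_powEq (projX_ne_zero hWb) n' m' k')).elim
  · obtain ⟨K, μ, l, h1⟩ := wave hWa ca
    exact (hr.not_wave_euler hW h1 (e' ▸ isEuler_constEq Set.univ n' m' k')).elim
  · rcases ca with ⟨k, hk, rfl⟩ | ⟨k, m, rfl, hk, hm⟩ <;>
      rcases cb with ⟨k', hk', rfl⟩ | ⟨k', m', rfl, hk', hm'⟩
    · obtain ⟨ρ, e1, e2, e3⟩ := hr.wave_wave hW (isWave_IV hk hWa) (isWave_IV hk' hWb) hmap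
      have e4 : κ = ρ := by linarith
      subst e4
      have e5 : k = k' := mul_right_cancel₀ (pow_ne_zero 3 hκ) (by linarith)
      rw [e5]
      exact sameClass_refl _
    · obtain ⟨ρ, e1, e2, e3⟩ := hr.wave_wave hW (isWave_IV hk hWa)
        (isWave_V hk'.ne' hm' hWb) hmap
      exact (mul_ne_zero hε0 hκ (by linarith)).elim
    · obtain ⟨ρ, e1, e2, e3⟩ := hr.wave_wave hW (isWave_V hk.ne' hm hWa) (isWave_IV hk' hWb) hmap
      have e4 : ρ = 0 := by linarith
      rw [e4] at e1
      exact (hκ (by linarith)).elim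
    · obtain ⟨ρ, e1, e2, e3⟩ := hr.wave_wave hW (isWave_V hk.ne' hm hWa)
        (isWave_V hk'.ne' hm' hWb) hmap
      have e4 : ρ = ε * κ := by linarith
      subst e4
      have e5 : k' = ε * k := mul_right_cancel₀ hκ (by linarith)
      have e6 : ε = 1 := by
        rcases hr.sign with h | h
        · exact h
        · rw [h] at e5
          linarith
      subst e6
      have e7 : k' = k := by linarith
      subst e7
      have e8 : m * (κ ^ 3 * k') = m' * (κ ^ 3 * k') := by linear_combination -e3
      rw [mul_right_cancel₀ (mul_ne_zero (pow_ne_zero 3 hκ) hk.ne') e8]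
      exact sameClass_refl _

end Inequivalence

end WaveClass

end

theorem mainTheorem2 :
    -- no symmetry algebra in the class has dimension above five
    (∀ (W : Set WaveClass.Pt) (e : WaveClass.WaveEq), WaveClass.InClass W e →
      WaveClass.symDim W e.rhs ≤ 5) ∧
    -- the maximal invariance algebra of `u_tt = u_xx - u⁻¹ u_x²`
    (∀ W : Set WaveClass.Pt, WaveClass.IsAdmissible W →
      WaveClass.InClass W WaveClass.freeEq ∧
      WaveClass.IsMaximalAlgebra W WaveClass.freeEq.rhs WaveClass.freeBasis ∧
      WaveClass.symDim W WaveClass.freeEq.rhs = 5) ∧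
    -- dimension above four occurs only for equations equivalent to this one
    (∀ (W : Set WaveClass.Pt) (e : WaveClass.WaveEq), WaveClass.InClass W e →
      4 < WaveClass.symDim W e.rhs →
      ∃ W' : Set WaveClass.Pt, WaveClass.IsAdmissible W' ∧
        WaveClass.Equivalent W e.rhs W' WaveClass.freeEq.rhs) ∧
    -- an equation with a four-dimensional algebra is equivalent to a listed one
    (∀ (W : Set WaveClass.Pt) (e : WaveClass.WaveEq), WaveClass.InClass W e →
      WaveClass.symDim W e.rhs = 4 →
      ∃ (a : WaveClass.Listed) (W' : Set WaveClass.Pt),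
        (WaveClass.entry a).valid ∧ WaveClass.IsAdmissible W' ∧
        WaveClass.projTX W' ⊆ (WaveClass.entry a).regular ∧
        WaveClass.Equivalent W e.rhs W' (WaveClass.entry a).eqn.rhs) ∧
    -- every listed equation has the listed four-dimensional maximal algebra
    (∀ (a : WaveClass.Listed) (W : Set WaveClass.Pt), (WaveClass.entry a).valid →
      WaveClass.IsAdmissible W → WaveClass.projTX W ⊆ (WaveClass.entry a).regular →
      WaveClass.InClass W (WaveClass.entry a).eqn ∧
      WaveClass.IsMaximalAlgebra W (WaveClass.entry a).eqn.rhs (WaveClass.entry a).basis ∧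
      WaveClass.symDim W (WaveClass.entry a).eqn.rhs = 4 ∧
      ∃ c ∈ (WaveClass.entry a).type,
        WaveClass.HasStructConst W (WaveClass.entry a).basis c) ∧
    -- the listed equations are inequivalent, up to the scalings recorded in `SameClass`
    (∀ a b : WaveClass.Listed, (WaveClass.entry a).valid → (WaveClass.entry b).valid →
      ((∃ W W' : Set WaveClass.Pt,
          WaveClass.IsAdmissible W ∧ WaveClass.projTX W ⊆ (WaveClass.entry a).regular ∧
          WaveClass.IsAdmissible W' ∧ WaveClass.projTX W' ⊆ (WaveClass.entry b).regular ∧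
          WaveClass.Equivalent W (WaveClass.entry a).eqn.rhs
            W' (WaveClass.entry b).eqn.rhs) ↔
        WaveClass.SameClass a b)) := by
  refine ⟨fun W e he => WaveClass.symDim_le_five he, fun W hW => ⟨WaveClass.inClass_freeEq hW,
    WaveClass.isMaximalAlgebra_freeEq hW, ?_⟩, fun W e he h => WaveClass.equivalent_free he h,
    fun W e he h => WaveClass.equivalent_listed he h,
    fun a W hv hW hr => WaveClass.verified_listed a hv hW hr,
    fun a b ha hb => ⟨?_, WaveClass.equivalent_of_sameClass ha hb⟩⟩
  · simpa using (WaveClass.isMaximalAlgebra_freeEq hW).symDim_eq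
  · rintro ⟨W, W', hW, hWa, hW', hWb, h⟩
    exact WaveClass.sameClass_of_equivalent ha hb hW hWa hW' hWb h
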